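/- Peg solitaire is played on a board, a finite set $B\subset\mathbb Z^2$ of holes. A position is the set of holes that hold a peg. A jump takes a peg from a hole $p\in B$ over a peg in the hole $p+d\in B$ into the empty hole $p+2d\in B$, where $d\in\{(\pm1,0),(0,\pm1)\}$, and removes the peg jumped over. The board is solvable at $X\in B$ if, starting with a peg in every hole except $X$, some sequence of jumps ends with a single peg, located in $X$; it is solvable at every location if it is solvable at every $X\in B$. For integers $n_1,n_2,n_3,n_4\ge 0$, the generalized cross board $(n_1,n_2,n_3,n_4)$ is a $3\times3$ square with $3\times n_1$, $3\times n_2$, $3\times n_3$, $3\times n_4$ arms attached, in this cyclic order, to its four sides; it has $9+3(n_1+n_2+n_3+n_4)$ holes. Then a generalized cross board is solvable at every location if and only if it is congruent (by rotation, reflection and translation of $\mathbb Z^2$) to one of the following 12 boards, no two of which are congruent: | $(n_1,n_2,n_3,n_4)$ | holes | symmetry | |---|---|---| | $(2,1,2,0)$ | 24 | lateral | | $(2,1,2,1)$ | 27 | rectangular | | $(2,2,1,1)$ | 27 | diagonal | | $(3,2,0,1)$ | 27 | none | | $(3,2,1,1)$ | 30 | none | | $(2,2,2,2)$ (the standard board)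 | 33 | square | | $(3,2,2,1)$ | 33 | none | | $(3,3,2,1)$ | 36 | none | | $(3,2,3,1)$ | 36 | lateral | | $(3,2,3,2)$ | 39 | rectangular | | $(3,3,2,2)$ | 39 | diagonal | | $(3,3,3,2)$ | 42 | lateral | Here lateral means that the only nontrivial symmetry is the reflection in one horizontal or vertical axis; diagonal, that it is the reflection in one diagonal axis; rectangular, that the symmetries are the identity, the reflections in a horizontal and in a vertical axis, and the half-turn; square, that there are all eight symmetries of a square; none, that there is only the identity. -/

import Mathlib

/-! Peg solitaire on boards whose holes are points of the square lattice `ℤ × ℤ`.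
A position on a board is the set of holes that hold a peg. -/

/-- The generalized cross board with arms of lengths `n 0`, `n 1`, `n 2`, `n 3`: a `3 × 3` square
centred at the origin, with a `3 × n 0` arm attached to its upper side, a `3 × n 1` arm to its
right-hand side, a `3 × n 2` arm to its lower side and a `3 × n 3` arm to its left-hand side. -/
noncomputable def crossBoard (n : Fin 4 → ℕ) : Finset (ℤ × ℤ) :=
  (Finset.Icc (-1 : ℤ) 1 ×ˢ Finset.Icc (-1 - (n 2 : ℤ)) (1 + (n 0 : ℤ))) ∪
    (Finset.Icc (-1 - (n 3 : ℤ)) (1 + (n 1 : ℤ)) ×ˢ Finset.Icc (-1 : ℤ) 1)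

/-- The four directions in which a peg may jump. -/
def jumpDirections : Finset (ℤ × ℤ) := {(1, 0), (-1, 0), (0, 1), (0, -1)}

/-- `Jump B S T`: on the board `B`, the position `T` arises from the position `S` by one jump: a peg
in hole `p` jumps over a peg in the adjacent hole `p + d` into the empty hole `p + d + d`, and the
peg that was jumped over is removed. -/
def Jump (B S T : Finset (ℤ × ℤ)) : Prop :=
  ∃ p : ℤ × ℤ, ∃ d ∈ jumpDirections,
    p ∈ B ∧ p + d ∈ B ∧ p + d + d ∈ B ∧
    p ∈ S ∧ p + d ∈ S ∧ p + d + d ∉ S ∧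
    T = insert (p + d + d) ((S.erase p).erase (p + d))

/-- The problem "vacate `X`, play to finish at `X`" can be solved on `B`: starting with a peg in
every hole except `X`, some sequence of jumps leaves a single peg, and that peg is in `X`. -/
def SolvableAt (B : Finset (ℤ × ℤ)) (X : ℤ × ℤ) : Prop :=
  Relation.ReflTransGen (Jump B) (B.erase X) {X}

/-- The board is solvable at every location. -/
def SolvableEverywhere (B : Finset (ℤ × ℤ)) : Prop :=
  ∀ X ∈ B, SolvableAt B X

/-- The eight orthogonal maps of the lattice: `(s, a, b)` swaps the coordinates if `s` is true,
and then multiplies them by the signs `a` and `b`. -/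
def orthMap (g : Bool × ℤˣ × ℤˣ) (p : ℤ × ℤ) : ℤ × ℤ :=
  if g.1 then ((g.2.1 : ℤ) * p.2, (g.2.2 : ℤ) * p.1) else ((g.2.1 : ℤ) * p.1, (g.2.2 : ℤ) * p.2)

/-- The image of a board under the lattice isometry with linear part `g` and translation `t`. -/
def moveBoard (g : Bool × ℤˣ × ℤˣ) (t : ℤ × ℤ) (B : Finset (ℤ × ℤ)) : Finset (ℤ × ℤ) :=
  B.image fun p => orthMap g p + t

/-- Two boards agree up to rotation, reflection and translation. -/
def BoardsCongruent (B C : Finset (ℤ × ℤ)) : Prop :=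
  ∃ g t, moveBoard g t B = C

/-- The linear parts of the lattice isometries that map the board to itself. -/
def symmetries (B : Finset (ℤ × ℤ)) : Set (Bool × ℤˣ × ℤˣ) :=
  {g | ∃ t, moveBoard g t B = B}

inductive SymmetryType
  | asymmetric
  | lateral
  | diagonal
  | rectangular
  | square

/-- The symmetry of a board. Asymmetric: no symmetry but the identity. Lateral: only the reflection
in one axis parallel to a lattice direction. Diagonal: only the reflection in one diagonal axis.
Rectangular: exactly the identity, the reflections in both lattice directions, and the half-turn.
Square: all eight symmetries of a square. -/
def HasSymmetryType (B : Finset (ℤ × ℤ)) : SymmetryType → Prop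
  | .asymmetric => symmetries B = {(false, 1, 1)}
  | .lateral =>
      symmetries B = {(false, 1, 1), (false, -1, 1)} ∨ symmetries B = {(false, 1, 1), (false, 1, -1)}
  | .diagonal =>
      symmetries B = {(false, 1, 1), (true, 1, 1)} ∨ symmetries B = {(false, 1, 1), (true, -1, -1)}
  | .rectangular =>
      symmetries B = {(false, 1, 1), (false, -1, 1), (false, 1, -1), (false, -1, -1)}
  | .square => symmetries B = Set.univ

/-- The twelve boards: arm lengths, number of holes, symmetry. -/
def boardTable : List ((Fin 4 → ℕ) × ℕ × SymmetryType) :=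
  [ (![2, 1, 2, 0], 24, .lateral),
    (![2, 1, 2, 1], 27, .rectangular),
    (![2, 2, 1, 1], 27, .diagonal),
    (![3, 2, 0, 1], 27, .asymmetric),
    (![3, 2, 1, 1], 30, .asymmetric),
    (![2, 2, 2, 2], 33, .square),
    (![3, 2, 2, 1], 33, .asymmetric),
    (![3, 3, 2, 1], 36, .asymmetric),
    (![3, 2, 3, 1], 36, .lateral),
    (![3, 2, 3, 2], 39, .rectangular),
    (![3, 3, 2, 2], 39, .diagonal),
    (![3, 3, 3, 2], 42, .lateral) ]

/-!
For the twelve boards of the table, a solution is recorded for every hole and verified by running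
it, and solvability is carried to congruent boards by `solvableEverywhere_congr`. It remains to
find, on every other cross board, one hole `X` that cannot be vacated and refilled.

The obstructions are linear inequalities for the number of times that each jump is made in a
solution. Three sources of inequalities are needed.

* Weights on the holes: the total weight changes by a fixed amount over the whole solution, and
  each jump contributes its own `drop` to this change (`IsPlay.sum_drop`).
* Regions: a region not containing `X` is full at the start and empty at the end, so the first jump
  that takes a peg out of it and the last one both end outside it. These are two different jumps
  unless one jump can empty the region (`IsPlay.two_le_sum_exits`). Similarly, both the first and
  the last jump end in `X` (`IsPlay.two_le_sum_landsAt`).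
* Parity: if the sum of some region inequalities and the number of pegs in a set of holes disagree
  modulo two, then either one of the inequalities is strict or a jump of odd coefficient is made,
  which strengthens the sum by one (`Cut.bound_le`).

If the arms of such a board have length at most four, a weighted sum of such inequalities is
contradictory, if need be after finitely many case distinctions on how often a jump is made. The
resulting proof trees (`Cert`) are listed up to congruence, and `Cert.sound` shows that a tree that
passes the checker proves unsolvability. The checker works with two boards `lo` and `hi` and
covers all the boards between them: regions, which have to be nonempty, are intersected with `lo`,
and weights have to be nonnegative outside it. In this way one tree covers all boards whose
longest arm has length five, and one covers all those whose longest arm has length six.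

If the longest arm has length at least seven, geometric weights suffice for the hole `X` at the
end of the middle column of this arm. With the ratio `5 / 8`, slightly more than the golden
section `0.618…`, no jump increases the total weight, and a jump into `X` takes away `1 + 5 / 8`.
Two such jumps take away more than the weight of the whole board, which is bounded by geometric
series (`not_solvableAt_of_long_arm`).

That the boards of the table are pairwise incongruent and have the stated symmetries is a finite
matter, because a congruence is determined by its linear part: it has to carry the centre of mass
of one board to that of the other (`exists_moveBoard_iff`).
-/

namespace PegSolitaire

/-! ### Plays and the inequalities that they satisfy -/

/-- `IsPlay B S L T`: the jumps listed in `L`, each given by its starting hole and its direction,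
can be made in this order on the board `B`, and they lead from the position `S` to `T`. -/
def IsPlay (B : Finset (ℤ × ℤ)) :
    Finset (ℤ × ℤ) → List ((ℤ × ℤ) × (ℤ × ℤ)) → Finset (ℤ × ℤ) → Prop
  | S, [], T => S = T
  | S, (p, d) :: L, T =>
      (d ∈ jumpDirections ∧ p ∈ B ∧ p + d ∈ B ∧ p + d + d ∈ B ∧
        p ∈ S ∧ p + d ∈ S ∧ p + d + d ∉ S) ∧
      IsPlay B (insert (p + d + d) ((S.erase p).erase (p + d))) L T

theorem exists_isPlay {B S T : Finset (ℤ × ℤ)} (h : Relation.ReflTransGen (Jump B) S T) :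
    ∃ L, IsPlay B S L T := by
  induction h using Relation.ReflTransGen.head_induction_on with
  | refl => exact ⟨[], rfl⟩
  | head h _ ih =>
    obtain ⟨L, hL⟩ := ih
    obtain ⟨p, d, hd, h1, h2, h3, h4, h5, h6, rfl⟩ := h
    exact ⟨(p, d) :: L, ⟨hd, h1, h2, h3, h4, h5, h6⟩, hL⟩

theorem IsPlay.legal {B S T : Finset (ℤ × ℤ)} {L} (h : IsPlay B S L T) :
    ∀ m ∈ L, m.2 ∈ jumpDirections ∧ m.1 ∈ B ∧ m.1 + m.2 ∈ B ∧ m.1 + m.2 + m.2 ∈ B := by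
  induction L generalizing S with
  | nil => simp
  | cons m L ih =>
    obtain ⟨⟨hd, h1, h2, h3, -⟩, hL⟩ := h
    intro m' hm'
    rcases List.mem_cons.1 hm' with rfl | hm'
    · exact ⟨hd, h1, h2, h3⟩
    · exact ih hL m' hm'

theorem ne_zero_of_mem_jumpDirections {d : ℤ × ℤ} (hd : d ∈ jumpDirections) : d ≠ 0 := by
  rintro rfl
  revert hd
  decide

/-- The total weight that a jump takes off the board. -/
def drop {R : Type*} [AddCommGroup R] (w : ℤ × ℤ → R) (m : (ℤ × ℤ) × (ℤ × ℤ)) : R :=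
  w m.1 + w (m.1 + m.2) - w (m.1 + m.2 + m.2)

theorem IsPlay.sum_drop {R : Type*} [AddCommGroup R] {B S T : Finset (ℤ × ℤ)} {L}
    (h : IsPlay B S L T) (w : ℤ × ℤ → R) :
    (L.map (drop w)).sum = ∑ p ∈ S, w p - ∑ p ∈ T, w p := by
  induction L generalizing S with
  | nil => cases h; simp
  | cons m L ih =>
    obtain ⟨p, d⟩ := m
    obtain ⟨⟨hd, -, -, -, h1, h2, h3⟩, hL⟩ := h
    have hd0 := ne_zero_of_mem_jumpDirections hd
    have hpq : p + d ≠ p := by simpa using hd0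
    rw [List.map_cons, List.sum_cons, ih hL, Finset.sum_insert (by simp [h3]),
      Finset.sum_erase_eq_sub (by simp [h2, hpq]), Finset.sum_erase_eq_sub h1]
    simp only [drop]
    abel

/-- A jump leaves the region `R` if it takes a peg out of `R` and ends outside `R`. -/
def exits (R : Finset (ℤ × ℤ)) (m : (ℤ × ℤ) × (ℤ × ℤ)) : ℕ :=
  if (m.1 ∈ R ∨ m.1 + m.2 ∈ R) ∧ m.1 + m.2 + m.2 ∉ R then 1 else 0

/-- The jump that takes the last peg out of a region leaves the region. -/
theorem IsPlay.one_le_sum_exits {B S T R : Finset (ℤ × ℤ)} {L} (h : IsPlay B S L T)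
    (hS : ∃ x ∈ R, x ∈ S) (hT : ∀ x ∈ R, x ∉ T) : 1 ≤ (L.map (exits R)).sum := by
  induction L generalizing S with
  | nil =>
    cases h
    obtain ⟨x, hx, hxS⟩ := hS
    exact absurd hxS (hT x hx)
  | cons m L ih =>
    obtain ⟨p, d⟩ := m
    obtain ⟨⟨-, -, -, -, h1, h2, h3⟩, hL⟩ := h
    rw [List.map_cons, List.sum_cons]
    by_cases hR : ∃ x ∈ R, x ∈ insert (p + d + d) ((S.erase p).erase (p + d))
    · exact (ih hL hR).trans (Nat.le_add_left _ _)
    · push Not at hR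
      obtain ⟨x, hx, hxS⟩ := hS
      have hr : p + d + d ∉ R := fun hr => hR _ hr (Finset.mem_insert_self _ _)
      have hx' := hR x hx
      have : p ∈ R ∨ p + d ∈ R := by
        by_contra hc
        push Not at hc
        apply hx'
        simp only [Finset.mem_insert, Finset.mem_erase]
        refine Or.inr ⟨?_, ?_, hxS⟩
        · rintro rfl; exact hc.2 hx
        · rintro rfl; exact hc.1 hx
      simp [exits, this, hr]

/-- If a region starts full and ends empty, then the first jump that takes a peg out of it leaves
it, and so does the last one. These jumps differ if no single jump can empty the region. -/
theorem IsPlay.two_le_sum_exits {B S T R : Finset (ℤ × ℤ)} {L} (h : IsPlay B S L T)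
    (hne : R.Nonempty) (hS : R ⊆ S) (hT : ∀ x ∈ R, x ∉ T)
    (hR : ∀ m ∈ L, ∃ x ∈ R, x ≠ m.1 ∧ x ≠ m.1 + m.2) : 2 ≤ (L.map (exits R)).sum := by
  induction L generalizing S with
  | nil =>
    cases h
    obtain ⟨x, hx⟩ := hne
    exact absurd (hS hx) (hT x hx)
  | cons m L ih =>
    obtain ⟨p, d⟩ := m
    obtain ⟨⟨-, -, -, -, h1, h2, h3⟩, hL⟩ := h
    rw [List.map_cons, List.sum_cons]
    by_cases hpq : p ∈ R ∨ p + d ∈ R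
    · have hr : p + d + d ∉ R := fun hr => h3 (hS hr)
      obtain ⟨x, hx, hxp, hxq⟩ := hR (p, d) List.mem_cons_self
      have := hL.one_le_sum_exits (R := R) ⟨x, hx, by
        simp only at hxp hxq
        simp [hxp, hxq, hS hx]⟩ hT
      have h1 : exits R (p, d) = 1 := by simp [exits, hpq, hr]
      omega
    · push Not at hpq
      have := ih hL (fun x hx => by
        have h1 : x ≠ p := by rintro rfl; exact hpq.1 hx
        have h2 : x ≠ p + d := by rintro rfl; exact hpq.2 hx
        simp [h1, h2, hS hx]) (fun m hm => hR m (List.mem_cons_of_mem _ hm))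
      omega

/-- Indicator of the jumps that end in the hole `X`. -/
def landsAt (X : ℤ × ℤ) (m : (ℤ × ℤ) × (ℤ × ℤ)) : ℕ := if m.1 + m.2 + m.2 = X then 1 else 0

theorem IsPlay.one_le_sum_landsAt {B S : Finset (ℤ × ℤ)} {X : ℤ × ℤ} {L}
    (h : IsPlay B S L {X}) (hS : S ≠ {X}) : 1 ≤ (L.map (landsAt X)).sum := by
  induction L generalizing S with
  | nil => exact absurd h hS
  | cons m L ih =>
    obtain ⟨p, d⟩ := m
    rw [List.map_cons, List.sum_cons]
    by_cases hS' : insert (p + d + d) ((S.erase p).erase (p + d)) = {X}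
    · have : p + d + d ∈ ({X} : Finset _) := hS' ▸ Finset.mem_insert_self _ _
      rw [Finset.mem_singleton] at this
      simp [landsAt, this]
    · exact (ih h.2 hS').trans (Nat.le_add_left _ _)

/-- Both the first and the last jump of a solution end in the hole that starts empty. -/
theorem IsPlay.two_le_sum_landsAt {B : Finset (ℤ × ℤ)} {X : ℤ × ℤ} {L}
    (h : IsPlay B (B.erase X) L {X}) (hB : 4 ≤ B.card) : 2 ≤ (L.map (landsAt X)).sum := by
  cases L with
  | nil =>
    have h1 : B.erase X = {X} := h
    have := Finset.mem_singleton_self X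
    rw [← h1] at this
    simp at this
  | cons m L =>
    obtain ⟨p, d⟩ := m
    obtain ⟨⟨-, -, -, h3, -, -, h6⟩, hL⟩ := h
    have hX : p + d + d = X := by
      by_contra hne
      exact h6 (Finset.mem_erase.2 ⟨hne, h3⟩)
    rw [List.map_cons, List.sum_cons]
    have h2 : 1 ≤ (L.map (landsAt X)).sum := by
      refine hL.one_le_sum_landsAt fun hc => ?_
      have hsub : B ⊆ {X, p, p + d} := by
        intro x hx
        by_contra hxn
        simp only [Finset.mem_insert, Finset.mem_singleton, not_or] at hxn
        have : x ∈ ({X} : Finset _) := by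
          rw [← hc]
          simp [hxn, hx]
        exact hxn.1 (Finset.mem_singleton.1 this)
      have := (Finset.card_le_card hsub).trans Finset.card_le_three
      omega
    have h1 : landsAt X (p, d) = 1 := by simp [landsAt, hX]
    omega

/-! ### Lists and numberings of holes -/

/-- The integers `a, a + 1, …, a + k - 1`. -/
def intRange (a : ℤ) (k : ℕ) : List ℤ := (List.range k).map fun i : ℕ => a + (i : ℤ)

theorem mem_intRange {a x : ℤ} {k : ℕ} : x ∈ intRange a k ↔ a ≤ x ∧ x < a + k := by
  simp only [intRange, List.mem_map, List.mem_range]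
  constructor
  · rintro ⟨i, hi, rfl⟩; omega
  · rintro ⟨h1, h2⟩; exact ⟨(x - a).toNat, by omega, by omega⟩

theorem nodup_intRange (a : ℤ) (k : ℕ) : (intRange a k).Nodup :=
  List.nodup_range.map fun i j h => by simpa using h

/-- The holes of a cross board without repetition: the vertical strip of width three, then the
right-hand and the left-hand arm. -/
def holes (n : Fin 4 → ℕ) : List (ℤ × ℤ) :=
  (intRange (-1) 3 ×ˢ intRange (-1 - n 2) (3 + n 0 + n 2)) ++
    ((intRange 2 (n 1) ++ intRange (-1 - n 3) (n 3)) ×ˢ intRange (-1) 3)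

theorem mem_crossBoard {n : Fin 4 → ℕ} {p : ℤ × ℤ} : p ∈ crossBoard n ↔
    (-1 ≤ p.1 ∧ p.1 ≤ 1 ∧ -1 - (n 2 : ℤ) ≤ p.2 ∧ p.2 ≤ 1 + n 0) ∨
      (-1 - (n 3 : ℤ) ≤ p.1 ∧ p.1 ≤ 1 + n 1 ∧ -1 ≤ p.2 ∧ p.2 ≤ 1) := by
  simp [crossBoard, and_assoc]

theorem mem_holes {n : Fin 4 → ℕ} {p : ℤ × ℤ} : p ∈ holes n ↔ p ∈ crossBoard n := by
  obtain ⟨x, y⟩ := p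
  simp only [holes, List.mem_append, List.mem_product, mem_intRange, mem_crossBoard]
  push_cast
  omega

theorem nodup_holes (n : Fin 4 → ℕ) : (holes n).Nodup := by
  refine List.Nodup.append ((nodup_intRange _ _).product (nodup_intRange _ _))
    (List.Nodup.product (List.Nodup.append (nodup_intRange _ _) (nodup_intRange _ _) ?_)
      (nodup_intRange _ _)) ?_
  · intro x h1 h2
    rw [mem_intRange] at h1 h2
    omega
  · rintro ⟨x, y⟩ h1 h2
    simp only [List.mem_append, List.mem_product, mem_intRange] at h1 h2
    omega

theorem toFinset_holes (n : Fin 4 → ℕ) : (holes n).toFinset = crossBoard n := by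
  ext p
  rw [List.mem_toFinset, mem_holes]

theorem sum_crossBoard {R : Type*} [AddCommMonoid R] (n : Fin 4 → ℕ) (g : ℤ × ℤ → R) :
    ∑ p ∈ crossBoard n, g p = ((holes n).map g).sum := by
  rw [← toFinset_holes, List.sum_toFinset g (nodup_holes n)]

theorem crossBoard_mono {n k : Fin 4 → ℕ} (h : ∀ i, n i ≤ k i) : crossBoard n ⊆ crossBoard k := by
  intro p
  have h0 := h 0
  have h1 := h 1
  have h2 := h 2
  have h3 := h 3
  rw [mem_crossBoard, mem_crossBoard]
  omega

theorem four_le_card_crossBoard (n : Fin 4 → ℕ) : 4 ≤ (crossBoard n).card := by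
  have h : (Finset.Icc (-1 : ℤ) 1 ×ˢ Finset.Icc (-1 : ℤ) 1) ⊆ crossBoard n := by
    rintro ⟨x, y⟩ h
    simp only [Finset.mem_product, Finset.mem_Icc] at h
    rw [mem_crossBoard]
    omega
  exact le_trans (by decide) (Finset.card_le_card h)

/-- Membership in a cross board as a Boolean. -/
def onBoard (n : Fin 4 → ℕ) (p : ℤ × ℤ) : Bool :=
  (decide (-1 ≤ p.1) && decide (p.1 ≤ 1) && decide (-1 - (n 2 : ℤ) ≤ p.2) &&
    decide (p.2 ≤ 1 + n 0)) ||
  (decide (-1 - (n 3 : ℤ) ≤ p.1) && decide (p.1 ≤ 1 + n 1) && decide (-1 ≤ p.2) &&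
    decide (p.2 ≤ 1))

theorem onBoard_iff {n : Fin 4 → ℕ} {p : ℤ × ℤ} : onBoard n p = true ↔ p ∈ crossBoard n := by
  simp [onBoard, mem_crossBoard, and_assoc]

/-- A numbering of the holes of the cross boards with arms of length at most `m`: first the vertical
strip, row by row, then the horizontal strip, column by column. -/
def code (m : ℕ) (p : ℤ × ℤ) : ℕ :=
  if -1 ≤ p.1 ∧ p.1 ≤ 1 then (3 * (p.2 + m + 1) + (p.1 + 1)).toNat
  else 3 * (2 * m + 3) + (3 * (p.1 + m + 1) + (p.2 + 1)).toNat

theorem code_injOn {m : ℕ} {n : Fin 4 → ℕ} (hn : ∀ i, n i ≤ m) {p q : ℤ × ℤ}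
    (hp : p ∈ crossBoard n) (hq : q ∈ crossBoard n) (h : code m p = code m q) : p = q := by
  obtain ⟨x, y⟩ := p
  obtain ⟨u, v⟩ := q
  have h0 := hn 0
  have h1 := hn 1
  have h2 := hn 2
  have h3 := hn 3
  rw [mem_crossBoard] at hp hq
  simp only [code] at h hp hq
  rw [Prod.mk.injEq]
  split_ifs at h <;> omega

/-- The numbers of the three holes that take part in a jump. -/
def jumpCode (m : ℕ) (j : (ℤ × ℤ) × (ℤ × ℤ)) : ℕ × ℕ × ℕ :=
  (code m j.1, code m (j.1 + j.2), code m (j.1 + j.2 + j.2))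

/-- The jumps of a cross board, given by the numbers of the holes that take part in them. -/
def boardJumps (m : ℕ) (n : Fin 4 → ℕ) : List (ℕ × ℕ × ℕ) :=
  (holes n).flatMap fun p => [(1, 0), (-1, 0), (0, 1), (0, -1)].filterMap fun d =>
    if onBoard n (p + d) && onBoard n (p + d + d) then some (jumpCode m (p, d)) else none

theorem jumpCode_mem_boardJumps {m : ℕ} {n : Fin 4 → ℕ} {p d : ℤ × ℤ} (hd : d ∈ jumpDirections)
    (h1 : p ∈ crossBoard n) (h2 : p + d ∈ crossBoard n) (h3 : p + d + d ∈ crossBoard n) :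
    jumpCode m (p, d) ∈ boardJumps m n := by
  rw [boardJumps, List.mem_flatMap]
  refine ⟨p, mem_holes.2 h1, ?_⟩
  rw [List.mem_filterMap]
  refine ⟨d, ?_, ?_⟩
  · simpa [jumpDirections] using hd
  · simp [onBoard_iff.2 h2, onBoard_iff.2 h3]

/-! ### Proof trees for unsolvability -/

/-- A valid inequality for the numbers of jumps of each kind in a solution, with its multiplier in
the weighted sum. The regions in `rows` are sets of holes, given by the bits of a number; `0` stands
for the inequality that at least two jumps end in the hole `X`. The sum of the inequalities in `rows`
is strengthened by a parity argument if `parity` is the set of holes `H`; see `Cut.bound_le`. -/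
structure Cut where
  mult : ℕ
  parity : Option ℕ
  rows : List ℕ

/-- A proof tree that a board cannot be solved. At a leaf, `weights` gives a weight to every hole,
and `branch` gives multipliers of the inequalities met on the way from the root. At a node, the
cases are that the jump occurs at most `k` times, and that it occurs at least `k + 1` times. -/
inductive Cert where
  | leaf (weights : ℕ) (cuts : List Cut) (branch : List ℕ)
  | split (jump : ℕ × ℕ × ℕ) (k : ℕ) (below above : Cert)

/-- The bit `i` of `R` as a number. -/
def bit (R i : ℕ) : ℕ := (R.testBit i).toNat

/-- The contribution of a jump, given by the numbers of its holes, to the inequality of a region: for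
`R ≠ 0`, whether it takes a peg out of `R` and ends outside `R`; for `R = 0`, whether it ends in the
hole number `x`. -/
def hit (x R : ℕ) (t : ℕ × ℕ × ℕ) : ℕ :=
  if R = 0 then (t.2.2 == x).toNat
  else ((R.testBit t.1 || R.testBit t.2.1) && !R.testBit t.2.2).toNat

/-- The right-hand side of the inequality of a region. It is `2` unless the part of the region inside
`K` can be emptied by one of the jumps in `M`. -/
def rowBound (M : List (ℕ × ℕ × ℕ)) (K R : ℕ) : ℕ :=
  if R = 0 then 2
  else if M.all fun t =>
    ((R &&& K) ||| (2 ^ t.1 ||| 2 ^ t.2.1)) != (2 ^ t.1 ||| 2 ^ t.2.1) then 2 else 1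

/-- The region has to meet the smaller board, whose holes form the set `K`, and must not contain the
hole number `x`. -/
def rowValid (x K R : ℕ) : Bool := R == 0 || (R &&& K != 0 && !R.testBit x)

def hitSum (x : ℕ) (rows : List ℕ) (t : ℕ × ℕ × ℕ) : ℕ := (rows.map fun R => hit x R t).sum

def boundSum (M : List (ℕ × ℕ × ℕ)) (K : ℕ) (rows : List ℕ) : ℕ :=
  (rows.map fun R => rowBound M K R).sum

/-- The coefficient of a jump in a cut. -/
def Cut.value (x : ℕ) (c : Cut) (t : ℕ × ℕ × ℕ) : ℕ :=
  match c.parity with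
  | none => hitSum x c.rows t
  | some H => hitSum x c.rows t +
      (hitSum x c.rows t + bit H t.1 + bit H t.2.1 + bit H t.2.2) % 2

/-- The right-hand side of a cut. -/
def Cut.bound (M : List (ℕ × ℕ × ℕ)) (K : ℕ) (c : Cut) : ℕ :=
  match c.parity with
  | none => boundSum M K c.rows
  | some _ => boundSum M K c.rows + 1

/-- The weight of the hole number `i`, increased by `512` in order to be a natural number. It is
stored in twelve bits of `W`. -/
def field (W i : ℕ) : ℕ := W / 4096 ^ i % 4096

/-- The total coefficient of a jump in the branching inequalities that bound the number of jumps from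
below (`s = true`) or from above (`s = false`). An entry `(s, u, k)` of the path stands for the
inequality that the jump `u` is made at least, or at most, `k` times. -/
def branchSum (s : Bool) : List (Bool × (ℕ × ℕ × ℕ) × ℕ) → List ℕ → ℕ × ℕ × ℕ → ℕ
  | (s', u, _) :: path, b :: bs, t =>
      (if s == s' && u.1 == t.1 && u.2.1 == t.2.1 && u.2.2 == t.2.2 then b else 0) +
        branchSum s path bs t
  | _, _, _ => 0

/-- The total right-hand side of these branching inequalities. -/
def branchBound (s : Bool) : List (Bool × (ℕ × ℕ × ℕ) × ℕ) → List ℕ → ℕ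
  | (s', _, k) :: path, b :: bs => (if s == s' then b * k else 0) + branchBound s path bs
  | _, _ => 0

def cutSum (x : ℕ) (cuts : List Cut) (t : ℕ × ℕ × ℕ) : ℕ :=
  (cuts.map fun c => c.mult * c.value x t).sum

def cutBound (M : List (ℕ × ℕ × ℕ)) (K : ℕ) (cuts : List Cut) : ℕ :=
  (cuts.map fun c => c.mult * c.bound M K).sum

/-- The set of holes of a board as a number. -/
def boardMask (m : ℕ) (n : Fin 4 → ℕ) : ℕ := (holes n).foldr (fun p a => 2 ^ code m p ||| a) 0

section Check

variable (m : ℕ) (lo hi : Fin 4 → ℕ) (X : ℤ × ℤ)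

/-- The set `H` of a parity argument has to lie on the smaller board, and the parity has to be
odd. -/
def Cut.check (c : Cut) : Bool :=
  c.rows.all (rowValid (code m X) (boardMask m lo)) &&
  match c.parity with
  | none => true
  | some H =>
      (holes hi).all (fun p => onBoard lo p || !H.testBit (code m p)) &&
      (((holes lo).map fun p => bit H (code m p)).sum +
        boundSum (boardJumps m hi) (boardMask m lo) c.rows) % 2 == 1

/-- The conditions under which a proof tree shows that no cross board that contains the board `lo`
and is contained in the board `hi` can be solved at `X`. -/
def Cert.check : Cert → List (Bool × (ℕ × ℕ × ℕ) × ℕ) → Bool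
  | .leaf W cuts bs, path =>
      cuts.all (Cut.check m lo hi X) &&
      (holes hi).all (fun p => onBoard lo p || decide (512 ≤ field W (code m p))) &&
      (boardJumps m hi).all (fun t => decide (
        field W t.2.2 + 512 + cutSum (code m X) cuts t + branchSum true path bs t ≤
          field W t.1 + field W t.2.1 + branchSum false path bs t)) &&
      decide (((holes hi).map fun p => field W (code m p)).sum + 512 * 2 +
          branchBound false path bs <
        512 * (holes hi).length + 2 * field W (code m X) +
          cutBound (boardJumps m hi) (boardMask m lo) cuts + branchBound true path bs)
  | .split t k a b, path => a.check ((false, t, k) :: path) && b.check ((true, t, k + 1) :: path)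

end Check

theorem testBit_boardMask {m : ℕ} {n : Fin 4 → ℕ} {i : ℕ}
    (h : (boardMask m n).testBit i = true) : ∃ p ∈ crossBoard n, code m p = i := by
  simp only [← mem_holes]
  unfold boardMask at h
  generalize holes n = l at h
  induction l with
  | nil => simp at h
  | cons p l ih =>
    rw [List.foldr_cons, Nat.testBit_or, Bool.or_eq_true] at h
    rcases h with h | h
    · rw [Nat.testBit_two_pow] at h
      exact ⟨p, by simp, by simpa using h⟩
    · obtain ⟨q, hq, h⟩ := ih h
      exact ⟨q, List.mem_cons_of_mem _ hq, h⟩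

section Sound

variable {m : ℕ} {lo n hi : Fin 4 → ℕ} {X : ℤ × ℤ} {L : List ((ℤ × ℤ) × (ℤ × ℤ))}

/-- The inequality of a region holds for every solution. -/
theorem rowBound_le (hlo : ∀ i, lo i ≤ n i) (hhi : ∀ i, n i ≤ hi i)
    (hL : IsPlay (crossBoard n) ((crossBoard n).erase X) L {X}) {R : ℕ}
    (hR : rowValid (code m X) (boardMask m lo) R = true) :
    rowBound (boardJumps m hi) (boardMask m lo) R ≤
      (L.map fun j => hit (code m X) R (jumpCode m j)).sum := by
  by_cases h0 : R = 0
  · subst h0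
    refine le_trans (by simp [rowBound])
      ((hL.two_le_sum_landsAt (four_le_card_crossBoard n)).trans
        (List.sum_le_sum fun j _ => ?_))
    simp only [landsAt, hit, jumpCode]
    split_ifs with h <;> simp [h]
  · simp only [rowValid, h0, beq_iff_eq, Bool.or_eq_true, false_or, Bool.and_eq_true, bne_iff_ne,
      Bool.not_eq_true'] at hR
    obtain ⟨hK, hX⟩ := hR
    set S := (crossBoard n).filter fun p => R.testBit (code m p) = true with hS
    have hsum : (L.map fun j => hit (code m X) R (jumpCode m j)) = L.map (exits S) := by
      refine List.map_congr_left fun j hj => ?_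
      obtain ⟨-, h1, h2, h3⟩ := hL.legal j hj
      simp only [hit, h0, jumpCode, exits, hS, Finset.mem_filter, h1, h2, h3, true_and, if_false]
      split_ifs with h
      · simp [h.1, h.2]
      · by_contra hc
        apply h
        cases ha : R.testBit (code m j.1) <;> cases hb : R.testBit (code m (j.1 + j.2)) <;>
          cases hcc : R.testBit (code m (j.1 + j.2 + j.2)) <;> simp_all
    rw [hsum]
    have hSB : S ⊆ (crossBoard n).erase X := by
      intro p hp
      rw [hS, Finset.mem_filter] at hp
      refine Finset.mem_erase.2 ⟨?_, hp.1⟩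
      rintro rfl
      simp [hX] at hp
    have hST : ∀ p ∈ S, p ∉ ({X} : Finset (ℤ × ℤ)) := by
      intro p hp
      rw [Finset.mem_singleton]
      exact (Finset.mem_erase.1 (hSB hp)).1
    have hbit : ∀ i, (R &&& boardMask m lo).testBit i = true → ∃ p ∈ S, code m p = i := by
      intro i hi
      rw [Nat.testBit_and, Bool.and_eq_true] at hi
      obtain ⟨p, hp, rfl⟩ := testBit_boardMask hi.2
      exact ⟨p, by simp [hS, hi.1, crossBoard_mono hlo hp], rfl⟩
    have hne : S.Nonempty := by
      obtain ⟨i, hi⟩ := Nat.exists_testBit_of_ne_zero hK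
      obtain ⟨p, hp, -⟩ := hbit i hi
      exact ⟨p, hp⟩
    simp only [rowBound, h0, if_false]
    split_ifs with h2
    · refine hL.two_le_sum_exits hne hSB hST fun j hj => ?_
      obtain ⟨hd, h1, h2', h3⟩ := hL.legal j hj
      have hmem := jumpCode_mem_boardJumps (m := m) hd (crossBoard_mono hhi h1)
        (crossBoard_mono hhi h2') (crossBoard_mono hhi h3)
      have := List.all_eq_true.1 h2 _ hmem
      rw [bne_iff_ne] at this
      by_contra hc
      push Not at hc
      apply this
      apply Nat.eq_of_testBit_eq
      intro i
      rw [Nat.testBit_or]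
      cases hb : (R &&& boardMask m lo).testBit i with
      | false => simp
      | true =>
        obtain ⟨p, hp, rfl⟩ := hbit i hb
        by_cases hp1 : p = j.1
        · subst hp1; simp [jumpCode, Nat.testBit_or, Nat.testBit_two_pow]
        · have := hc p hp hp1
          subst this; simp [jumpCode, Nat.testBit_or, Nat.testBit_two_pow]
    · obtain ⟨p, hp⟩ := hne
      exact hL.one_le_sum_exits ⟨p, hp, hSB hp⟩ hST

theorem boundSum_le (hlo : ∀ i, lo i ≤ n i) (hhi : ∀ i, n i ≤ hi i)
    (hL : IsPlay (crossBoard n) ((crossBoard n).erase X) L {X}) {rows : List ℕ}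
    (hR : ∀ R ∈ rows, rowValid (code m X) (boardMask m lo) R = true) :
    boundSum (boardJumps m hi) (boardMask m lo) rows ≤
      (L.map fun j => hitSum (code m X) rows (jumpCode m j)).sum := by
  induction rows with
  | nil => simp [boundSum]
  | cons R rows ih =>
    have h1 := rowBound_le hlo hhi hL (hR R (by simp))
    have h2 := ih fun R' h => hR R' (List.mem_cons_of_mem _ h)
    simp only [boundSum, hitSum, List.map_cons, List.sum_cons, List.sum_map_add] at h1 h2 ⊢
    omega

/-- Total weight of a position before and after a solution, in terms of the numbering. -/
theorem sum_drop_code (hX : X ∈ crossBoard n)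
    (hL : IsPlay (crossBoard n) ((crossBoard n).erase X) L {X}) (w : ℕ → ℤ) :
    (L.map fun j => w (jumpCode m j).1 + w (jumpCode m j).2.1 - w (jumpCode m j).2.2).sum =
      ∑ p ∈ crossBoard n, w (code m p) - 2 * w (code m X) := by
  have := hL.sum_drop fun p => w (code m p)
  rw [Finset.sum_erase_eq_sub hX, Finset.sum_singleton] at this
  rw [show (L.map fun j => w (jumpCode m j).1 + w (jumpCode m j).2.1 - w (jumpCode m j).2.2) =
    L.map (drop fun p => w (code m p)) from rfl, this]
  ring

theorem list_sum_mod_two {α : Type*} (L : List α) (f g : α → ℕ)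
    (h : ∀ a ∈ L, f a % 2 = g a % 2) : (L.map f).sum % 2 = (L.map g).sum % 2 := by
  induction L with
  | nil => rfl
  | cons a L ih =>
    have h1 := h a (by simp)
    have h2 := ih fun b hb => h b (List.mem_cons_of_mem _ hb)
    simp only [List.map_cons, List.sum_cons]
    omega

theorem sum_crossBoard_eq_of_support (hlo : ∀ i, lo i ≤ n i)
    (hhi : ∀ i, n i ≤ hi i) {w : ℤ × ℤ → ℤ}
    (hw : ∀ p ∈ crossBoard hi, p ∉ crossBoard lo → w p = 0) :
    ∑ p ∈ crossBoard n, w p = ∑ p ∈ crossBoard lo, w p :=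
  (Finset.sum_subset (crossBoard_mono hlo) fun p hp hp' => hw p (crossBoard_mono hhi hp) hp').symm

/-- The cuts hold for every solution. With parity: by balancing the number of pegs in `H`, the sum of
the jumps of odd coefficient and of the slacks of the rows is odd, and therefore at least `1`. -/
theorem Cut.bound_le (hlo : ∀ i, lo i ≤ n i) (hhi : ∀ i, n i ≤ hi i) (hX : X ∈ crossBoard n)
    (hL : IsPlay (crossBoard n) ((crossBoard n).erase X) L {X}) {c : Cut}
    (hc : c.check m lo hi X = true) :
    c.bound (boardJumps m hi) (boardMask m lo) ≤
      (L.map fun j => c.value (code m X) (jumpCode m j)).sum := by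
  obtain ⟨mult, parity, rows⟩ := c
  simp only [Cut.check, Bool.and_eq_true, List.all_eq_true] at hc
  obtain ⟨hrows, hpar⟩ := hc
  have hle := boundSum_le hlo hhi hL hrows
  cases parity with
  | none => exact hle
  | some H =>
    simp only [Bool.and_eq_true, beq_iff_eq, Bool.or_eq_true, Bool.not_eq_true',
      List.all_eq_true] at hpar
    obtain ⟨hH, hodd⟩ := hpar
    simp only [Cut.bound, Cut.value, List.sum_map_add]
    set z : (ℤ × ℤ) × (ℤ × ℤ) → ℕ := fun j =>
      (hitSum (code m X) rows (jumpCode m j) + bit H (jumpCode m j).1 + bit H (jumpCode m j).2.1 +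
        bit H (jumpCode m j).2.2) % 2 with hz
    -- otherwise all rows are tight and no jump has an odd coefficient
    by_contra hlt
    have heq : (L.map fun j => hitSum (code m X) rows (jumpCode m j)).sum =
        boundSum (boardJumps m hi) (boardMask m lo) rows := by omega
    have hz0 : (L.map z).sum = 0 := by omega
    have h1 := list_sum_mod_two L z (fun j => hitSum (code m X) rows (jumpCode m j) +
      (bit H (jumpCode m j).1 + bit H (jumpCode m j).2.1 + bit H (jumpCode m j).2.2))
      (fun j _ => by simp only [hz]; omega)
    rw [List.sum_map_add, hz0, heq] at h1
    have h2 := sum_drop_code (m := m) hX hL fun i => (bit H i : ℤ)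
    have h3 : ((L.map fun j => bit H (jumpCode m j).1 + bit H (jumpCode m j).2.1 +
        bit H (jumpCode m j).2.2).sum : ℤ) = (L.map fun j => (bit H (jumpCode m j).1 : ℤ) +
        bit H (jumpCode m j).2.1 - bit H (jumpCode m j).2.2).sum +
        2 * ((L.map fun j => bit H (jumpCode m j).2.2).sum : ℤ) := by
      clear h1 h2 hz0 heq hlt hle hL
      induction L with
      | nil => simp
      | cons j L ih =>
        simp only [List.map_cons, List.sum_cons, Nat.cast_add]
        linarith
    rw [h2, sum_crossBoard_eq_of_support hlo hhi (w := fun p => (bit H (code m p) : ℤ)),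
      sum_crossBoard] at h3
    · have h4 : (((holes lo).map fun p => (bit H (code m p) : ℤ)).sum : ℤ) =
          (((holes lo).map fun p => bit H (code m p)).sum : ℕ) := by
        rw [Nat.cast_list_sum, List.map_map]
        rfl
      rw [h4] at h3
      omega
    · intro p hp hp'
      rcases hH p (mem_holes.2 hp) with h | h
      · exact absurd (onBoard_iff.1 h) hp'
      · simp [bit, h]

theorem cutBound_le (hlo : ∀ i, lo i ≤ n i) (hhi : ∀ i, n i ≤ hi i) (hX : X ∈ crossBoard n)
    (hL : IsPlay (crossBoard n) ((crossBoard n).erase X) L {X}) {cuts : List Cut}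
    (hc : ∀ c ∈ cuts, c.check m lo hi X = true) :
    cutBound (boardJumps m hi) (boardMask m lo) cuts ≤
      (L.map fun j => cutSum (code m X) cuts (jumpCode m j)).sum := by
  induction cuts with
  | nil => simp [cutBound]
  | cons c cuts ih =>
    have h1 := Nat.mul_le_mul_left c.mult (Cut.bound_le hlo hhi hX hL (hc c (by simp)))
    have h2 := ih fun c' h => hc c' (List.mem_cons_of_mem _ h)
    simp only [cutBound, cutSum, List.map_cons, List.sum_cons, List.sum_map_add,
      List.sum_map_mul_left] at h1 h2 ⊢
    omega

/-- How often the jump `u` is made. -/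
def jumpCount (m : ℕ) (L : List ((ℤ × ℤ) × (ℤ × ℤ))) (u : ℕ × ℕ × ℕ) : ℕ :=
  (L.map fun j => if jumpCode m j = u then 1 else 0).sum

/-- The branching inequalities of a path hold for the jumps in `L`. -/
def pathHolds (m : ℕ) (L : List ((ℤ × ℤ) × (ℤ × ℤ)))
    (path : List (Bool × (ℕ × ℕ × ℕ) × ℕ)) : Prop :=
  ∀ e ∈ path, if e.1 then e.2.2 ≤ jumpCount m L e.2.1 else jumpCount m L e.2.1 ≤ e.2.2

theorem branch_term (L : List ((ℤ × ℤ) × (ℤ × ℤ))) (s s' : Bool) (u : ℕ × ℕ × ℕ) (b : ℕ) :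
    (L.map fun j => if s == s' && u.1 == (jumpCode m j).1 && u.2.1 == (jumpCode m j).2.1 &&
      u.2.2 == (jumpCode m j).2.2 then b else 0).sum =
    if s == s' then b * jumpCount m L u else 0 := by
  by_cases hs : s = s'
  · subst hs
    simp only [beq_self_eq_true, Bool.true_and, if_true, jumpCount, ← List.sum_map_mul_left]
    congr 1
    refine List.map_congr_left fun j _ => ?_
    obtain ⟨u1, u2, u3⟩ := u
    obtain ⟨t1, t2, t3⟩ := jumpCode m j
    by_cases h : t1 = u1 ∧ t2 = u2 ∧ t3 = u3
    · simp [h]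
    · have h' : ¬ (u1 = t1 ∧ u2 = t2 ∧ u3 = t3) := by
        rintro ⟨rfl, rfl, rfl⟩; exact h ⟨rfl, rfl, rfl⟩
      rw [if_neg (by simpa [and_assoc] using h'), if_neg (by simpa using h), mul_zero]
  · simp [hs]

theorem branchBound_le {path : List (Bool × (ℕ × ℕ × ℕ) × ℕ)} (h : pathHolds m L path)
    (bs : List ℕ) : branchBound true path bs ≤
      (L.map fun j => branchSum true path bs (jumpCode m j)).sum := by
  induction path generalizing bs with
  | nil => simp [branchBound]
  | cons e path ih =>
    obtain ⟨s', u, k⟩ := e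
    cases bs with
    | nil => simp [branchBound]
    | cons b bs =>
      have h1 := ih (fun e he => h e (List.mem_cons_of_mem _ he)) bs
      have h2 := h (s', u, k) (by simp)
      simp only [branchBound, branchSum, List.sum_map_add, branch_term]
      cases s' with
      | false => simpa using h1
      | true =>
        have := Nat.mul_le_mul_left b (show k ≤ jumpCount m L u from by simpa using h2)
        simp only [beq_self_eq_true, if_true]
        omega

theorem le_branchBound {path : List (Bool × (ℕ × ℕ × ℕ) × ℕ)} (h : pathHolds m L path)
    (bs : List ℕ) : (L.map fun j => branchSum false path bs (jumpCode m j)).sum ≤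
      branchBound false path bs := by
  induction path generalizing bs with
  | nil => simp [branchSum]
  | cons e path ih =>
    obtain ⟨s', u, k⟩ := e
    cases bs with
    | nil => simp [branchSum]
    | cons b bs =>
      have h1 := ih (fun e he => h e (List.mem_cons_of_mem _ he)) bs
      have h2 := h (s', u, k) (by simp)
      simp only [branchBound, branchSum, List.sum_map_add, branch_term]
      cases s' with
      | true => simpa using h1
      | false =>
        have := Nat.mul_le_mul_left b (show jumpCount m L u ≤ k from by simpa using h2)
        simp only [beq_self_eq_true, if_true]
        omega

/-- No proof tree passes the checker if there is a solution: at the leaf whose branching inequalities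
the solution satisfies, the weighted sum of the inequalities contradicts the balance of weights. -/
theorem Cert.sound (hlo : ∀ i, lo i ≤ n i) (hhi : ∀ i, n i ≤ hi i) (hX : X ∈ crossBoard n)
    (hL : IsPlay (crossBoard n) ((crossBoard n).erase X) L {X}) (c : Cert)
    (path : List (Bool × (ℕ × ℕ × ℕ) × ℕ)) (hpath : pathHolds m L path) :
    c.check m lo hi X path = false := by
  induction c generalizing path with
  | split t k a b iha ihb =>
    rw [Cert.check, Bool.and_eq_false_iff]
    rcases le_or_gt (jumpCount m L t) k with h | h
    · refine Or.inl (iha _ fun e he => ?_)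
      rcases List.mem_cons.1 he with rfl | he
      · simpa using h
      · exact hpath e he
    · refine Or.inr (ihb _ fun e he => ?_)
      rcases List.mem_cons.1 he with rfl | he
      · simpa using h
      · exact hpath e he
  | leaf W cuts bs =>
    rw [Bool.eq_false_iff]
    intro hc
    simp only [Cert.check, Bool.and_eq_true, List.all_eq_true, Bool.or_eq_true,
      decide_eq_true_eq] at hc
    obtain ⟨⟨⟨hcuts, hoff⟩, hjumps⟩, hlt⟩ := hc
    have h1 := cutBound_le hlo hhi hX hL hcuts
    have h2 := branchBound_le hpath bs
    have h3 := le_branchBound hpath bs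
    set w : ℕ → ℤ := fun i => (field W i : ℤ) - 512 with hw
    have h4 := sum_drop_code (m := m) hX hL w
    have h5 : ∑ p ∈ crossBoard n, w (code m p) ≤ ∑ p ∈ crossBoard hi, w (code m p) := by
      refine Finset.sum_le_sum_of_subset_of_nonneg (crossBoard_mono hhi) fun p hp hp' => ?_
      rcases hoff p (mem_holes.2 hp) with h | h
      · exact absurd (crossBoard_mono hlo (onBoard_iff.1 h)) hp'
      · simp only [hw]; omega
    have h6 : ∑ p ∈ crossBoard hi, w (code m p) =
        (((holes hi).map fun p => field W (code m p)).sum : ℕ) - 512 * (holes hi).length := by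
      rw [sum_crossBoard]
      generalize holes hi = l
      induction l with
      | nil => simp
      | cons p l ih =>
        simp only [hw] at ih ⊢
        simp only [List.map_cons, List.sum_cons, List.length_cons, Nat.cast_add, Nat.cast_one, ih]
        ring
    have h7 : ((L.map fun j => cutSum (code m X) cuts (jumpCode m j)).sum : ℤ) +
        (L.map fun j => branchSum true path bs (jumpCode m j)).sum ≤
        (L.map fun j => w (jumpCode m j).1 + w (jumpCode m j).2.1 - w (jumpCode m j).2.2).sum +
        (L.map fun j => branchSum false path bs (jumpCode m j)).sum := by
      have hmem : ∀ j ∈ L, jumpCode m j ∈ boardJumps m hi := fun j hj => by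
        obtain ⟨hd, g1, g2, g3⟩ := hL.legal j hj
        exact jumpCode_mem_boardJumps hd (crossBoard_mono hhi g1) (crossBoard_mono hhi g2)
          (crossBoard_mono hhi g3)
      clear h1 h2 h3 h4 h5 h6 hpath hL hlt
      induction L with
      | nil => simp
      | cons j L ih =>
        have g1 := ih fun j' h => hmem j' (List.mem_cons_of_mem _ h)
        have g2 := hjumps _ (hmem j (by simp))
        simp only [List.map_cons, List.sum_cons, Nat.cast_add, hw] at g1 ⊢
        omega
    simp only [hw] at h4 h5 h6 h7
    omega

/-- A board between `lo` and `hi` cannot be solved at `X` if there is a proof tree. -/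
theorem not_solvableAt_of_check (hX : X ∈ crossBoard lo) (c : Cert)
    (hc : c.check m lo hi X [] = true) (hlo : ∀ i, lo i ≤ n i) (hhi : ∀ i, n i ≤ hi i) :
    ¬ SolvableAt (crossBoard n) X := by
  intro h
  obtain ⟨L, hL⟩ := exists_isPlay h
  have := c.sound (m := m) hlo hhi (crossBoard_mono hlo hX) hL [] (by simp [pathHolds])
  rw [hc] at this
  exact absurd this (by simp)

end Sound

/-! ### Boards with an arm of length at least seven -/

/-- A geometric series bounds the sum of powers of `5 / 8` with distinct exponents `≥ m`. -/
theorem sum_pow_le {ι : Type*} (s : Finset ι) (e : ι → ℕ) (he : Set.InjOn e s) (m : ℕ)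
    (hm : ∀ i ∈ s, m ≤ e i) : ∑ i ∈ s, (5 / 8 : ℚ) ^ e i ≤ (5 / 8) ^ m * (8 / 3) := by
  have h1 : ∑ i ∈ s, (5 / 8 : ℚ) ^ e i = (5 / 8) ^ m * ∑ i ∈ s, (5 / 8 : ℚ) ^ (e i - m) := by
    rw [Finset.mul_sum]
    refine Finset.sum_congr rfl fun i hi => ?_
    rw [← pow_add, Nat.add_sub_cancel' (hm i hi)]
  rw [h1]
  refine mul_le_mul_of_nonneg_left ?_ (by positivity)
  have he' : Set.InjOn (fun i => e i - m) s := fun i hi j hj h => he hi hj (by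
    have := hm i hi
    have := hm j hj
    simp only at h
    omega)
  rw [← Finset.sum_image (f := fun k => (5 / 8 : ℚ) ^ k) he']
  obtain ⟨M, hM⟩ := (s.image fun i => e i - m).exists_nat_subset_range
  refine (Finset.sum_le_sum_of_subset_of_nonneg hM fun _ _ _ => by positivity).trans ?_
  have h2 : ((5 / 8 : ℚ) ^ M - 1) / (5 / 8 - 1) = 8 / 3 - 8 / 3 * (5 / 8) ^ M := by ring
  rw [geom_sum_eq (by norm_num), h2]
  have : (0 : ℚ) ≤ (5 / 8) ^ M := by positivity
  linarith

/-- The ratio `r = 5 / 8` satisfies `1 ≤ r ^ 2 + r`. -/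
theorem pow_le_pow_add_pow {a b c : ℕ} (ha : a ≤ c + 2) (hb : b ≤ c + 1) :
    (5 / 8 : ℚ) ^ c ≤ (5 / 8) ^ a + (5 / 8) ^ b := by
  have h1 := pow_le_pow_of_le_one (by norm_num : (0 : ℚ) ≤ 5 / 8) (by norm_num) ha
  have h2 := pow_le_pow_of_le_one (by norm_num : (0 : ℚ) ≤ 5 / 8) (by norm_num) hb
  have h3 : (0 : ℚ) < (5 / 8) ^ c := by positivity
  rw [pow_add] at h1 h2
  linarith

/-- The exponent of the weight of a hole on a board whose upper arm has length `N`. In the middle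
column it is the distance to the last hole but one; outside this column it is the distance to the
hole `(0, 1)`, increased by a constant. -/
def armExponent (N : ℕ) (p : ℤ × ℤ) : ℕ :=
  if p.1 = 0 then ((N : ℤ) - p.2).toNat else N - 1 + p.1.natAbs + (p.2 - 1).natAbs

/-- The weight of a hole on a board whose upper arm has length `N`: a power of `5 / 8`, except at the
end of the middle column of the arm, where it vanishes. -/
def armWeight (N : ℕ) (p : ℤ × ℤ) : ℚ :=
  if p = (0, (N : ℤ) + 1) then 0 else (5 / 8) ^ armExponent N p

theorem armWeight_nonneg (N : ℕ) (p : ℤ × ℤ) : 0 ≤ armWeight N p := by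
  unfold armWeight
  split_ifs
  · exact le_rfl
  · positivity

/-- No jump increases the total weight. -/
theorem drop_armWeight_nonneg {n : Fin 4 → ℕ} (hn : 1 ≤ n 0) {p d : ℤ × ℤ}
    (hd : d ∈ jumpDirections) (h1 : p ∈ crossBoard n) (h2 : p + d ∈ crossBoard n)
    (h3 : p + d + d ∈ crossBoard n) : 0 ≤ drop (armWeight (n 0)) (p, d) := by
  have hp := armWeight_nonneg (n 0) p
  have hq := armWeight_nonneg (n 0) (p + d)
  rw [drop]
  by_cases hs : p + d + d = (0, (n 0 : ℤ) + 1)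
  · have : armWeight (n 0) (p + d + d) = 0 := by simp [armWeight, hs]
    simp only [this]
    linarith
  suffices h : armWeight (n 0) (p + d + d) ≤ armWeight (n 0) p + armWeight (n 0) (p + d) by
    simp only
    linarith
  rw [mem_crossBoard] at h1 h2 h3
  obtain ⟨x, y⟩ := p
  have hd' : d = (1, 0) ∨ d = (-1, 0) ∨ d = (0, 1) ∨ d = (0, -1) := by
    simpa [jumpDirections] using hd
  have key : ∀ p q s : ℤ × ℤ, p ≠ (0, (n 0 : ℤ) + 1) → q ≠ (0, (n 0 : ℤ) + 1) →
      s ≠ (0, (n 0 : ℤ) + 1) → armExponent (n 0) p ≤ armExponent (n 0) s + 2 →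
      armExponent (n 0) q ≤ armExponent (n 0) s + 1 →
      armWeight (n 0) s ≤ armWeight (n 0) p + armWeight (n 0) q := by
    intro p q s hp hq hs h h'
    rw [armWeight, armWeight, armWeight, if_neg hp, if_neg hq, if_neg hs]
    exact pow_le_pow_add_pow h h'
  by_cases hpX : ((x, y) : ℤ × ℤ) = (0, (n 0 : ℤ) + 1)
  · -- a peg that starts at the end of the arm can only jump down the middle column
    rw [Prod.mk.injEq] at hpX
    obtain ⟨rfl, rfl⟩ := hpX
    refine le_trans ?_ (le_add_of_nonneg_left hp)
    rcases hd' with rfl | rfl | rfl | rfl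
    · simp at h3; omega
    · simp at h3; omega
    · simp at h3; omega
    · rw [armWeight, armWeight, if_neg hs, if_neg (by simp)]
      refine pow_le_pow_of_le_one (by norm_num) (by norm_num) ?_
      simp [armExponent]
  by_cases hqX : ((x, y) : ℤ × ℤ) + d = (0, (n 0 : ℤ) + 1)
  · -- a jump over the end of the arm is horizontal, and the weights are symmetric
    have hx : x = -d.1 := by
      have := congrArg Prod.fst hqX
      simp at this; omega
    have hy : y = n 0 + 1 - d.2 := by
      have := congrArg Prod.snd hqX
      simp at this; omega
    subst hx hy
    refine le_trans ?_ (le_add_of_nonneg_right hq)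
    rw [armWeight, armWeight, if_neg hs, if_neg hpX]
    refine pow_le_pow_of_le_one (by norm_num) (by norm_num) ?_
    rcases hd' with rfl | rfl | rfl | rfl <;> simp at h3 <;> (simp [armExponent]; try omega)
  refine key _ _ _ hpX hqX hs ?_ ?_
  all_goals
    clear key hp hq
    rcases hd' with rfl | rfl | rfl | rfl <;>
      simp only [armExponent, Prod.mk_add_mk, Prod.mk.injEq] at h1 h2 h3 hpX hqX hs ⊢ <;>
      split_ifs <;> omega

/-- A part of the board on which `armExponent` is injective: the middle column, the parts above and
below the level `1` of the two columns beside it, and the rows of the two side arms. -/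
def armPart (p : ℤ × ℤ) : ℕ :=
  if p.1 = 0 then 0
  else if p.1 = 1 then if 1 ≤ p.2 then 1 else 2
  else if p.1 = -1 then if 1 ≤ p.2 then 3 else 4
  else if 0 ≤ p.1 then if p.2 = 1 then 5 else if p.2 = 0 then 6 else 7
  else if p.2 = 1 then 8 else if p.2 = 0 then 9 else 10

set_option maxHeartbeats 1000000 in
theorem armExponent_injOn_armPart {N : ℕ} {p q : ℤ × ℤ}
    (hp : (p.1 = 0 → p.2 ≤ N) ∧ (p.1 ≤ -2 ∨ 2 ≤ p.1 → -1 ≤ p.2 ∧ p.2 ≤ 1))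
    (hq : (q.1 = 0 → q.2 ≤ N) ∧ (q.1 ≤ -2 ∨ 2 ≤ q.1 → -1 ≤ q.2 ∧ q.2 ≤ 1))
    (hpart : armPart p = armPart q) (h : armExponent N p = armExponent N q) : p = q := by
  obtain ⟨x, y⟩ := p
  obtain ⟨u, v⟩ := q
  simp only [armPart] at hp hq hpart
  rw [Prod.mk.injEq]
  simp only [armExponent] at h
  split_ifs at hpart <;> first
    | exact absurd hpart (by decide)
    | (clear hpart; split_ifs at h; omega)

/-- A lower bound for `armExponent` on each of the parts. -/
def armPartBound (k : ℕ) : ℕ := [0, 7, 8, 7, 8, 8, 9, 10, 8, 9, 10].getD k 0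

theorem sum_armWeight_lt {n : Fin 4 → ℕ} (hn : 7 ≤ n 0) :
    ∑ p ∈ (crossBoard n).erase (0, (n 0 : ℤ) + 1), armWeight (n 0) p < 13 / 4 := by
  have h0 : ∑ p ∈ (crossBoard n).erase (0, (n 0 : ℤ) + 1), armWeight (n 0) p =
      ∑ p ∈ (crossBoard n).erase (0, (n 0 : ℤ) + 1), (5 / 8 : ℚ) ^ armExponent (n 0) p :=
    Finset.sum_congr rfl fun p hp => if_neg (Finset.ne_of_mem_erase hp)
  have hmem : ∀ p ∈ (crossBoard n).erase (0, (n 0 : ℤ) + 1),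
      (p.1 = 0 → p.2 ≤ n 0) ∧ (p.1 ≤ -2 ∨ 2 ≤ p.1 → -1 ≤ p.2 ∧ p.2 ≤ 1) := by
    rintro ⟨x, y⟩ h
    rw [Finset.mem_erase, mem_crossBoard, Ne, Prod.mk.injEq] at h
    simp only at h ⊢
    omega
  have hmaps : ∀ p ∈ (crossBoard n).erase (0, (n 0 : ℤ) + 1), armPart p ∈ Finset.range 11 := by
    intro p _
    rw [Finset.mem_range, armPart]
    split_ifs <;> omega
  rw [h0, ← Finset.sum_fiberwise_of_maps_to hmaps]
  have hpart : ∀ k ∈ Finset.range 11,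
      ∑ p ∈ ((crossBoard n).erase (0, (n 0 : ℤ) + 1)).filter (fun p => armPart p = k),
        (5 / 8 : ℚ) ^ armExponent (n 0) p ≤ (5 / 8) ^ armPartBound k * (8 / 3) := by
    intro k _
    refine sum_pow_le _ _ ?_ _ ?_
    · intro p hp q hq h
      rw [Finset.mem_coe, Finset.mem_filter] at hp hq
      exact armExponent_injOn_armPart (hmem _ hp.1) (hmem _ hq.1) (hp.2.trans hq.2.symm) h
    · rintro ⟨x, y⟩ hp
      rw [Finset.mem_filter] at hp
      obtain ⟨hp, rfl⟩ := hp
      have h1 := hmem _ hp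
      simp only [armPart, armExponent] at h1 ⊢
      split_ifs <;> simp only [armPartBound, List.getD_cons_zero, List.getD_cons_succ] <;> omega
  refine (Finset.sum_le_sum hpart).trans_lt ?_
  simp only [Finset.sum_range_succ, Finset.sum_range_zero, armPartBound, List.getD_cons_zero,
    List.getD_cons_succ]
  norm_num

/-- The end of the middle column of an arm of length at least seven cannot be vacated and filled
again: the first and the last jump of a solution take away the weight `2 * (1 + 5 / 8)`, which is
more than the weight of the whole board. -/
theorem not_solvableAt_of_long_arm {n : Fin 4 → ℕ} (hn : 7 ≤ n 0) :
    ¬ SolvableAt (crossBoard n) (0, (n 0 : ℤ) + 1) := by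
  intro hsol
  obtain ⟨L, hL⟩ := exists_isPlay hsol
  have h2 := hL.two_le_sum_landsAt (four_le_card_crossBoard n)
  have hsum := hL.sum_drop (armWeight (n 0))
  have hX : armWeight (n 0) (0, (n 0 : ℤ) + 1) = 0 := if_pos rfl
  rw [Finset.sum_singleton, hX, sub_zero] at hsum
  have hlt := sum_armWeight_lt hn
  have hle : ∀ m ∈ L, (13 / 8 : ℚ) * landsAt (0, (n 0 : ℤ) + 1) m ≤ drop (armWeight (n 0)) m := by
    rintro ⟨p, d⟩ hm
    obtain ⟨hd, h1, h2, h3⟩ := hL.legal _ hm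
    simp only at hd h1 h2 h3
    rw [landsAt]
    split_ifs with hs
    · simp only at hs
      have hp : p = (0, (n 0 : ℤ) + 1) - d - d := by rw [← hs]; abel
      have hd' : d = (1, 0) ∨ d = (-1, 0) ∨ d = (0, 1) ∨ d = (0, -1) := by
        simpa [jumpDirections] using hd
      subst hp
      rw [mem_crossBoard] at h1 h2 h3
      rcases hd' with rfl | rfl | rfl | rfl
      · simp at h1; omega
      · simp at h1; omega
      · have hne : (n 0 : ℤ) - 1 ≠ n 0 + 1 := by omega
        simp [drop, armWeight, armExponent, hne]
        norm_num
      · simp at h1; omega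
    · simpa using drop_armWeight_nonneg (by omega) hd h1 h2 h3
  have h4 : (13 / 8 : ℚ) * ((L.map (landsAt (0, (n 0 : ℤ) + 1))).sum : ℕ) ≤
      (L.map (drop (armWeight (n 0)))).sum := by
    rw [Nat.cast_list_sum, List.map_map, ← List.sum_map_mul_left]
    exact List.sum_le_sum hle
  have h5 : (2 : ℚ) ≤ ((L.map (landsAt (0, (n 0 : ℤ) + 1))).sum : ℕ) := by exact_mod_cast h2
  linarith

/-! ### Congruence of boards -/

theorem orthMap_add (g : Bool × ℤˣ × ℤˣ) (p q : ℤ × ℤ) :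
    orthMap g (p + q) = orthMap g p + orthMap g q := by
  obtain ⟨s, a, b⟩ := g
  cases s <;> simp [orthMap, mul_add]

theorem orthMap_mem_jumpDirections (g : Bool × ℤˣ × ℤˣ) {d : ℤ × ℤ} (hd : d ∈ jumpDirections) :
    orthMap g d ∈ jumpDirections := by
  revert g d
  decide

/-- The inverse of an orthogonal map. -/
def orthInv (g : Bool × ℤˣ × ℤˣ) : Bool × ℤˣ × ℤˣ := if g.1 then (true, g.2.2, g.2.1) else g

theorem orthMap_orthInv (g : Bool × ℤˣ × ℤˣ) (p : ℤ × ℤ) :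
    orthMap (orthInv g) (orthMap g p) = p := by
  obtain ⟨s, a, b⟩ := g
  rcases Int.units_eq_one_or a with rfl | rfl <;> rcases Int.units_eq_one_or b with rfl | rfl <;>
    cases s <;> simp [orthMap, orthInv]

/-- The composition of two orthogonal maps. -/
def orthMul (g h : Bool × ℤˣ × ℤˣ) : Bool × ℤˣ × ℤˣ :=
  (xor g.1 h.1, if g.1 then (g.2.1 * h.2.2, g.2.2 * h.2.1) else (g.2.1 * h.2.1, g.2.2 * h.2.2))

theorem orthMap_orthMul (g h : Bool × ℤˣ × ℤˣ) (p : ℤ × ℤ) :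
    orthMap (orthMul g h) p = orthMap g (orthMap h p) := by
  obtain ⟨s, a, b⟩ := g
  obtain ⟨s', a', b'⟩ := h
  cases s <;> cases s' <;> simp [orthMap, orthMul, mul_assoc]

theorem orthMap_injective (g : Bool × ℤˣ × ℤˣ) : Function.Injective (orthMap g) :=
  Function.LeftInverse.injective (orthMap_orthInv g)

theorem orthMap_add_injective (g : Bool × ℤˣ × ℤˣ) (t : ℤ × ℤ) :
    Function.Injective fun p => orthMap g p + t :=
  (add_left_injective t).comp (orthMap_injective g)

theorem boardsCongruent_refl (B : Finset (ℤ × ℤ)) : BoardsCongruent B B :=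
  ⟨(false, 1, 1), 0, by simp [moveBoard, orthMap]⟩

theorem boardsCongruent_symm {B C : Finset (ℤ × ℤ)} (h : BoardsCongruent B C) :
    BoardsCongruent C B := by
  obtain ⟨g, t, rfl⟩ := h
  refine ⟨orthInv g, -orthMap (orthInv g) t, ?_⟩
  have hid : ((fun p => orthMap (orthInv g) p + -orthMap (orthInv g) t) ∘
      fun p => orthMap g p + t) = id := by
    ext1 p
    simp [orthMap_add, orthMap_orthInv]
  rw [moveBoard, moveBoard, Finset.image_image, hid, Finset.image_id]

theorem boardsCongruent_trans {B C D : Finset (ℤ × ℤ)} (h : BoardsCongruent B C)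
    (h' : BoardsCongruent C D) : BoardsCongruent B D := by
  obtain ⟨g, t, rfl⟩ := h
  obtain ⟨g', t', rfl⟩ := h'
  refine ⟨orthMul g' g, orthMap g' t + t', ?_⟩
  simp only [moveBoard, Finset.image_image]
  congr 1
  ext1 p
  simp [orthMap_orthMul, orthMap_add, add_assoc]

theorem solvableAt_moveBoard {B : Finset (ℤ × ℤ)} {X : ℤ × ℤ} (h : SolvableAt B X)
    (g : Bool × ℤˣ × ℤˣ) (t : ℤ × ℤ) : SolvableAt (moveBoard g t B) (orthMap g X + t) := by
  have hinj := orthMap_add_injective g t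
  have key : Relation.ReflTransGen (Jump (moveBoard g t B))
      ((B.erase X).image fun p => orthMap g p + t)
      (({X} : Finset _).image fun p => orthMap g p + t) := by
    refine Relation.ReflTransGen.lift (Finset.image fun p => orthMap g p + t)
      (fun S T hST => ?_) _ _ h
    obtain ⟨p, d, hd, h1, h2, h3, h4, h5, h6, rfl⟩ := hST
    have e1 : orthMap g p + t + orthMap g d = orthMap g (p + d) + t := by
      rw [orthMap_add]; abel
    have e2 : orthMap g (p + d) + t + orthMap g d = orthMap g (p + d + d) + t := by
      rw [orthMap_add _ (p + d)]; abel
    refine ⟨orthMap g p + t, orthMap g d, orthMap_mem_jumpDirections g hd, ?_⟩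
    rw [e1, e2]
    refine ⟨Finset.mem_image_of_mem _ h1, Finset.mem_image_of_mem _ h2,
      Finset.mem_image_of_mem _ h3, Finset.mem_image_of_mem _ h4, Finset.mem_image_of_mem _ h5,
      fun hc => h6 ((hinj.mem_finset_image).1 hc), ?_⟩
    rw [Finset.image_insert, Finset.image_erase hinj, Finset.image_erase hinj]
  rwa [Finset.image_singleton, Finset.image_erase hinj] at key

theorem solvableEverywhere_congr {B C : Finset (ℤ × ℤ)} (h : BoardsCongruent B C)
    (hB : SolvableEverywhere B) : SolvableEverywhere C := by
  obtain ⟨g, t, rfl⟩ := h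
  intro X hX
  obtain ⟨p, hp, rfl⟩ := Finset.mem_image.1 hX
  exact solvableAt_moveBoard (hB p hp) g t

/-- The arm lengths after a quarter turn of the board. -/
def turn (n : Fin 4 → ℕ) : Fin 4 → ℕ := ![n 1, n 2, n 3, n 0]

/-- The arm lengths after a reflection of the board that exchanges left and right. -/
def mirror (n : Fin 4 → ℕ) : Fin 4 → ℕ := ![n 0, n 3, n 2, n 1]

theorem boardsCongruent_turn (n : Fin 4 → ℕ) :
    BoardsCongruent (crossBoard n) (crossBoard (turn n)) := by
  refine ⟨(true, -1, 1), 0, ?_⟩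
  ext ⟨x, y⟩
  simp only [moveBoard, Finset.mem_image, mem_crossBoard, orthMap, turn, Prod.exists, add_zero]
  constructor
  · rintro ⟨a, b, h, h'⟩
    simp only [if_true, Prod.mk.injEq] at h'
    simp at h' ⊢
    omega
  · intro h
    refine ⟨y, -x, ?_, by simp⟩
    simp at h ⊢
    omega

theorem boardsCongruent_mirror (n : Fin 4 → ℕ) :
    BoardsCongruent (crossBoard n) (crossBoard (mirror n)) := by
  refine ⟨(false, -1, 1), 0, ?_⟩
  ext ⟨x, y⟩
  simp only [moveBoard, Finset.mem_image, mem_crossBoard, orthMap, mirror, Prod.exists, add_zero]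
  constructor
  · rintro ⟨a, b, h, h'⟩
    simp at h' h ⊢
    omega
  · intro h
    refine ⟨-x, y, ?_, by simp⟩
    simp at h ⊢
    omega

/-- The arm lengths of a board in its eight orientations. -/
def orientations (n : Fin 4 → ℕ) : List (Fin 4 → ℕ) :=
  let f := mirror n
  [n, turn n, turn (turn n), turn (turn (turn n)), f, turn f, turn (turn f), turn (turn (turn f))]

theorem boardsCongruent_of_mem_orientations {n k : Fin 4 → ℕ} (h : k ∈ orientations n) :
    BoardsCongruent (crossBoard n) (crossBoard k) := by
  have key : ∀ l, BoardsCongruent (crossBoard n) (crossBoard l) →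
      BoardsCongruent (crossBoard n) (crossBoard (turn l)) := fun l hl =>
    boardsCongruent_trans hl (boardsCongruent_turn l)
  have h0 := boardsCongruent_refl (crossBoard n)
  have h1 := boardsCongruent_mirror n
  simp only [orientations, List.mem_cons, List.not_mem_nil, or_false] at h
  rcases h with h | h | h | h | h | h | h | h <;> subst h
  · exact h0
  · exact key _ h0
  · exact key _ (key _ h0)
  · exact key _ (key _ (key _ h0))
  · exact h1
  · exact key _ h1
  · exact key _ (key _ h1)
  · exact key _ (key _ (key _ h1))

/-- The only translation that can complete `g` to an isometry from the board `n` to the board `k`: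
it is determined by the centres of mass. -/
def centreShift (g : Bool × ℤˣ × ℤˣ) (n k : Fin 4 → ℕ) : ℤ × ℤ :=
  ((((holes k).map Prod.fst).sum - ((holes n).map fun p => (orthMap g p).1).sum) / (holes k).length,
    (((holes k).map Prod.snd).sum - ((holes n).map fun p => (orthMap g p).2).sum) /
      (holes k).length)

/-- Whether there is an isometry from the board `n` to the board `k` with linear part `g`. -/
def isCongruence (g : Bool × ℤˣ × ℤˣ) (n k : Fin 4 → ℕ) : Bool :=
  (holes n).length == (holes k).length &&
    (holes n).all fun p => onBoard k (orthMap g p + centreShift g n k)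

theorem card_crossBoard (n : Fin 4 → ℕ) : (crossBoard n).card = (holes n).length := by
  rw [← toFinset_holes, List.toFinset_card_of_nodup (nodup_holes n)]

theorem exists_moveBoard_iff {g : Bool × ℤˣ × ℤˣ} {n k : Fin 4 → ℕ} :
    (∃ t, moveBoard g t (crossBoard n) = crossBoard k) ↔ isCongruence g n k = true := by
  have hc : ∀ t, (moveBoard g t (crossBoard n)).card = (crossBoard n).card := fun t =>
    Finset.card_image_of_injective _ (orthMap_add_injective g t)
  simp only [isCongruence, Bool.and_eq_true, beq_iff_eq, List.all_eq_true, onBoard_iff, mem_holes,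
    ← card_crossBoard]
  constructor
  · rintro ⟨t, ht⟩
    have hcard : (crossBoard n).card = (crossBoard k).card := by rw [← hc t, ht]
    have hpos : ((crossBoard k).card : ℤ) ≠ 0 := by
      have := four_le_card_crossBoard k
      omega
    have key : ∀ f : ℤ × ℤ →+ ℤ, ((holes k).map f).sum =
        ((holes n).map fun p => f (orthMap g p)).sum + (crossBoard k).card * f t := by
      intro f
      rw [← sum_crossBoard, ← sum_crossBoard, ← ht, moveBoard,
        Finset.sum_image fun p _ q _ h => orthMap_add_injective g t h]
      simp only [map_add, Finset.sum_add_distrib, Finset.sum_const, nsmul_eq_mul]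
      rw [← moveBoard, hc]
    have hshift : centreShift g n k = t := by
      have h1 := key (AddMonoidHom.fst ℤ ℤ)
      have h2 := key (AddMonoidHom.snd ℤ ℤ)
      simp only [AddMonoidHom.coe_fst, AddMonoidHom.coe_snd] at h1 h2
      rw [centreShift, h1, h2, ← card_crossBoard, add_sub_cancel_left, add_sub_cancel_left,
        Int.mul_ediv_cancel_left _ hpos, Int.mul_ediv_cancel_left _ hpos]
    refine ⟨hcard, fun p hp => ?_⟩
    rw [hshift, ← ht]
    exact Finset.mem_image_of_mem _ hp
  · rintro ⟨hcard, h⟩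
    refine ⟨centreShift g n k, Finset.eq_of_subset_of_card_le ?_ (by rw [hc, hcard])⟩
    intro q hq
    obtain ⟨p, hp, rfl⟩ := Finset.mem_image.1 hq
    exact h p hp

theorem symmetries_eq {n : Fin 4 → ℕ} {l : List (Bool × ℤˣ × ℤˣ)} {A : Set (Bool × ℤˣ × ℤˣ)}
    (h : ∀ g, isCongruence g n n = decide (g ∈ l)) (hl : ∀ g, g ∈ l ↔ g ∈ A) :
    symmetries (crossBoard n) = A := by
  ext g
  rw [symmetries, Set.mem_ofPred_eq, exists_moveBoard_iff, h, decide_eq_true_iff, hl]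

theorem pairwise_not_boardsCongruent :
    boardTable.Pairwise fun r s => ¬ BoardsCongruent (crossBoard r.1) (crossBoard s.1) := by
  have h : boardTable.Pairwise fun r s => ∀ g, isCongruence g r.1 s.1 = false := by
    decide +kernel
  refine h.imp fun {r s} hrs hc => ?_
  obtain ⟨g, hg⟩ := hc
  rw [exists_moveBoard_iff, hrs g] at hg
  exact absurd hg (by simp)

theorem card_and_symmetry_boardTable :
    ∀ r ∈ boardTable, (crossBoard r.1).card = r.2.1 ∧ HasSymmetryType (crossBoard r.1) r.2.2 := by
  have hcard : ∀ r ∈ boardTable, (holes r.1).length = r.2.1 := by decide +kernel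
  intro r hr
  refine ⟨(card_crossBoard _).trans (hcard r hr), ?_⟩
  simp only [boardTable, List.mem_cons, List.not_mem_nil, or_false] at hr
  rcases hr with rfl | rfl | rfl | rfl | rfl | rfl | rfl | rfl | rfl | rfl | rfl | rfl
  · exact Or.inr (symmetries_eq (l := [(false, 1, 1), (false, 1, -1)])
      (by decide +kernel) (by simp))
  · exact symmetries_eq (l := [(false, 1, 1), (false, -1, 1), (false, 1, -1), (false, -1, -1)])
      (by decide +kernel) (by simp)
  · exact Or.inl (symmetries_eq (l := [(false, 1, 1), (true, 1, 1)]) (by decide +kernel) (by simp))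
  · exact symmetries_eq (l := [(false, 1, 1)]) (by decide +kernel) (by simp)
  · exact symmetries_eq (l := [(false, 1, 1)]) (by decide +kernel) (by simp)
  · refine Set.eq_univ_of_forall fun g => exists_moveBoard_iff.2 ?_
    revert g
    decide +kernel
  · exact symmetries_eq (l := [(false, 1, 1)]) (by decide +kernel) (by simp)
  · exact symmetries_eq (l := [(false, 1, 1)]) (by decide +kernel) (by simp)
  · exact Or.inr (symmetries_eq (l := [(false, 1, 1), (false, 1, -1)])
      (by decide +kernel) (by simp))
  · exact symmetries_eq (l := [(false, 1, 1), (false, -1, 1), (false, 1, -1), (false, -1, -1)])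
      (by decide +kernel) (by simp)
  · exact Or.inl (symmetries_eq (l := [(false, 1, 1), (true, 1, 1)]) (by decide +kernel) (by simp))
  · exact Or.inr (symmetries_eq (l := [(false, 1, 1), (false, 1, -1)])
      (by decide +kernel) (by simp))

/-! ### Proof trees for the individual boards -/

/-- Boards with arms of length at most three, each with a hole at which it cannot be solved and a
proof tree for that. The weights and multipliers are, up to scaling, dual solutions of the linear
programs formed by the inequalities. -/
def shortArmCerts : List ((Fin 4 → ℕ) × (ℤ × ℤ) × Cert) :=
  [(![0,0,0,0], (-1, 1),
    (.leaf 0x1ff2001ff2002002001ff2001ff000000000000000000000000000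
     [] [])),
   (![1,0,0,0], (0, 1),
    (.leaf 0x200200200200201200200201200200202200000000000000000000000000000
     [⟨2, none, [0]⟩] [])),
   (![1,0,1,0], (-1, 1),
    (.leaf 0x1ff2001ff2012002012002002002012002011ff2001ff000000000000000000
     [] [])),
   (![1,1,0,0], (-1, -1),
    (.leaf 0x1ff2001ff0000000000000000000000000000000000000000000000000000000000000000000000001ff2001ff201200201200200200201200201000000000000000000000000000
     [] [])),
   (![1,1,1,0], (-1, 0),
    (.leaf 0x1ff2001ff0000000000000000000000000000000000000000000000000000000000000000000000001ff2001ff2012002012002002002012002011ff2001ff000000000000000000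
     [] [])),
   (![1,1,1,1], (-1, 1),
    (.leaf 0x1ff2001ff0000000000000000000000000001ff2001ff0000000000000000000000000000000000001ff2001ff2012002012002002002012002011ff2001ff000000000000000000
     [] [])),
   (![2,0,0,0], (-1, 2),
    (.leaf 0x1ff2001ff2012002012002002002012002011ff2001ff000000000000000000000000000
     [] [])),
   (![2,0,1,0], (0, 3),
    (.leaf 0x200200200200203200200202200200201200200201200200200200000000000000000000
     [⟨5, none, [0]⟩] [])),
   (![2,1,0,0], (2, 0),
    (.leaf 0x2002022000000000000000000000000000000000000000000000000000000000000000001fe2001fe203203202200200200203203202201201200000000000000000000000000000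
     [⟨4, none, [0]⟩, ⟨2, none, [0xe00]⟩, ⟨2, none, [0x200000000c00]⟩] [])),
   (![2,0,2,0], (0, 3),
    (.leaf 0x200200200200205200200203200200202200200201200200201200200200200000000000
     [⟨8, none, [0]⟩] [])),
   (![2,1,0,1], (-2, 0),
    (.leaf 0x1ff2001ff0000000000000000000000000001ff2001ff0000000000000000000000000001fe2001fe203202203201200201202202204201200201000000000000000000000000000
     [⟨6, none, [0]⟩, ⟨2, none, [0xe00]⟩] [])),
   (![2,1,1,0], (0, 3),
    (.leaf 0x2052032020000000000000000000000000000000000000000000000000000000000000002002012002002082022002052022002032012002022022002011ff000000000000000000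
     [⟨10, none, [0]⟩, ⟨4, none, [0x49200]⟩, ⟨1, some 0x448000, [0,0x248000]⟩,
      ⟨1, some 0x640000, [0]⟩] [])),
   (![2,2,0,0], (0, 3),
    (.leaf 0x1ff2001ff201200201000000000000000000000000000000000000000000000000000000000000000200200200200201200200201200200200200200201200000000000000000000000000000
     [⟨2, none, [0]⟩] [])),
   (![2,1,1,1], (-1, -1),
    (.leaf 0x1ff2001ff0000000000000000000000000001ff2001ff0000000000000000000000000002012002012002002002012002012002002002012002011ff2001ff000000000000000000
     [] [])),
   (![2,2,1,0], (0, 3),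
    (.leaf 0x1ff2001ff201200201000000000000000000000000000000000000000000000000000000000000000200200200200201200200201200200200200200201200200200200000000000000000000
     [⟨2, none, [0]⟩] [])),
   (![2,2,2,0], (3, 0),
    (.leaf 0x2002002002002012000000000000000000000000000000000000000000000000000000000000000001ff2001ff2012002012002002002012002012002002002012002011ff2001ff000000000
     [⟨2, none, [0]⟩] [])),
   (![2,2,2,1], (3, 0),
    (.leaf 0x2002002002002012000000000000000000000000000002002002000000000000000000000000000001ff2001ff2012002012002002002012002012002002002012002011ff2001ff000000000
     [⟨2, none, [0]⟩] [])),
   (![3,0,0,0], (0, 4),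
    (.leaf 0x200200200200203200200202200200201200200201200200200200000000000000000000000000000
     [⟨5, none, [0]⟩] [])),
   (![3,0,1,0], (0, 4),
    (.leaf 0x200200200200205200200203200200202200200201200200201200200200200000000000000000000
     [⟨8, none, [0]⟩] [])),
   (![3,1,0,0], (0, 4),
    (.leaf 0x201201200000000000000000000000000000000000000000000000000000000200200200200203200200202200200201200200201200200200200000000000000000000000000000
     [⟨5, none, [0]⟩] [])),
   (![3,0,2,0], (0, 4),
    (.leaf 0x200200200200208200200205200200203200200202200200201200200201200200200200000000000
     [⟨13, none, [0]⟩] [])),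
   (![3,1,0,1], (-1, -1),
    (.leaf 0x1ff2001ff0000000000000000000000000001ff2001ff0000000000000000001ff2001ff201200201200200200201200201200200200201200201000000000000000000000000000
     [] [])),
   (![3,1,1,0], (-1, -1),
    (.leaf 0x1ff2001ff0000000000000000000000000000000000000000000000000000001ff2001ff2012002012002002002012002012002002002012002011ff2001ff000000000000000000
     [] [])),
   (![3,2,0,0], (0, 4),
    (.leaf 0x1ff2001ff201200201000000000000000000000000000000000000000000000000000000200200200200202200200201200200201200200200200200201200000000000000000000000000000
     [⟨3, none, [0]⟩] [])),
   (![3,0,3,0], (0, 4),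
    (.leaf 0x20020020020020d200200208200200205200200203200200202200200201200200201200200200200
     [⟨21, none, [0]⟩] [])),
   (![3,1,1,1], (-2, 0),
    (.leaf 0x1ff2001ff0000000000000000000000000001ff2001ff0000000000000000001ff2001ff2012002012002002002012002012002002002012002011ff2001ff000000000000000000
     [] [])),
   (![3,1,2,0], (0, 4),
    (.leaf 0x21820f2090000000000000000000000000000000000000000000000000000001fa2001fa20624e20920023120320621d20620521420320120a20320420a2061fd2001fd000000000
     [⟨127, none, [0]⟩, ⟨6, none, [0x248000]⟩, ⟨12, none, [0x249240]⟩, ⟨1, none, [0x920000]⟩] [])),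
   (![3,2,1,0], (0, 4),
    (.leaf 0x1ff2001ff201200201000000000000000000000000000000000000000000000000000000200200200200202200200201200200201200200200200200201200200200200000000000000000000
     [⟨3, none, [0]⟩] [])),
   (![3,3,0,0], (0, 4),
    (.leaf 0x2012012002002002002012012000000000000000000000000000000000000000000000000000000001ff2001ff201206201200204200201202201201202201200200200000000000000000000000000000
     [⟨10, none, [0]⟩, ⟨2, none, [0x249000]⟩] [])),
   (![3,1,2,1], (-1, -2),
    (.leaf 0x1f32001f30000000000000000000000000001f32001f30000000000000000001ed2021ed21520621420220620121320321320620320920d20020d2132032131fa2001fa000000000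
     [⟨3, none, [0]⟩, ⟨2, none, [0x1240000]⟩, ⟨2, none, [0x4900000]⟩, ⟨6, none, [0xff8000]⟩,
      ⟨2, none, [0xd00000]⟩, ⟨3, some 0xc00003f08000, [0x920000,0x248000]⟩] [])),
   (![3,1,3,0], (0, 4),
    (.leaf 0x22321920a0000000000000000000000000000000000000000000000000000001e72001e721929e21920026220021923c21920d22620f20c21620a20121020520b21020f1f62001f6
     [⟨256, none, [0]⟩, ⟨10, none, [0x248000]⟩, ⟨20, none, [0x249000]⟩, ⟨20, none, [0x249248]⟩] [])),
   (![3,2,0,2], (0, 4),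
    (.leaf 0x1ff2001ff2012002010000000000000000000000000002012002011ff2001ff000000000200200200200202200200201200200201200200200200200201200000000000000000000000000000
     [⟨3, none, [0]⟩] [])),
   (![3,2,2,0], (0, 4),
    (.leaf 0x1ff2001ff203202201000000000000000000000000000000000000000000000000000000200200200200208200200205200200203200200202200200201200200201200200200200000000000
     [⟨13, none, [0]⟩] [])),
   (![3,3,1,0], (0, 4),
    (.leaf 0x1f22011f321020420e2022052010000000000000000000000000000000000000000000000000000001ee2001ee21223221220021e20021221421220520a20520d20a20d1f82001f8000000000000000000
     [⟨80, none, [0]⟩, ⟨10, none, [0x249200]⟩, ⟨10, none, [0x248000]⟩,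
      ⟨2, none, [0x9200000000000]⟩] [])),
   (![3,1,3,1], (-1, 1),
    (.leaf 0x1ff2001ff0000000000000000000000000001ff2001ff0000000000000000001ff2001ff2012002012002002002012002012002002002012002012002002002012002011ff2001ff
     [] [])),
   (![3,2,1,2], (0, 4),
    (.leaf 0x1ff2001ff2012002010000000000000000000000000002012002011ff2001ff000000000200200200200202200200201200200201200200200200200201200200200200000000000000000000
     [⟨3, none, [0]⟩] [])),
   (![3,2,3,0], (0, 4),
    (.leaf 0x1fe2001fe20520320200000000000000000000000000000000000000000000000000000020020020020020d200200208200200205200200203200200202200200201200200201200200200200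
     [⟨21, none, [0]⟩] [])),
   (![3,3,1,1], (-1, -1),
    (.leaf 0x1ff2001ff2012002012002002000000000000000000000000000001ff2001ff0000000000000000001ff2001ff2012002012002002002012002012002002002012002011ff2001ff000000000000000000
     [] [])),
   (![3,3,2,0], (0, 4),
    (.leaf 0x1f62071f620d20a21120320a2070000000000000000000000000000000000000000000000000000001f020b1eb21823621820822320321021321520621020c20a20320920e20d20520e20a206000000000
     [⟨76, none, [0]⟩, ⟨14, none, [0x249000]⟩, ⟨6, none, [0x1240000]⟩, ⟨6, none, [0x248000]⟩,
      ⟨16, none, [0x4900000]⟩, ⟨16, none, [0x130]⟩, ⟨2, none, [0x249240]⟩,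
      ⟨2, some 0x28a00006a61a48, [0,0x249000,0x130,0x58]⟩,
      ⟨7, some 0x10000000000000, [0x3200000000000,0x9200000000000]⟩] [])),
   (![3,2,2,2], (0, 4),
    (.leaf 0x1f82001f820a20520900000000000000000000000000020c2052081f82001f800000000020020020020122020320121420320220c2032032082032012082002042062031fd2021fd000000000
     [⟨40, none, [0]⟩, ⟨2, none, [0x200000000900]⟩, ⟨3, some 0x3200000, [0]⟩,
      ⟨2, some 0xc03209048, [0]⟩, ⟨6, some 0x6c00d80412000, [0]⟩,
      ⟨1, some 0x203208240, [0,0x800248000]⟩, ⟨2, some 0x6800a03298240, [0x248000]⟩] [])),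
   (![3,3,3,0], (0, 4),
    (.leaf 0x1c12061c724722724520822120c0000000000000000000000000000000000000000000000000000001b12591b227b2f227b22c29b22d24f25724e22324422123922022d20022420c2392182391c720c1d3
     [⟨308, none, [0]⟩, ⟨90, none, [0x1240000]⟩, ⟨24, none, [0x49]⟩, ⟨88, none, [0x4900000]⟩,
      ⟨12, none, [0x3200000000000]⟩, ⟨13, none, [0x1200000000920]⟩,
      ⟨12, none, [0x9200000000000]⟩, ⟨66, none, [0x249000]⟩] [])),
   (![3,3,3,1], (4, 0),
    (.leaf 0x1f620a1f620f21420f20520c2050000000000000000000000000001fa2001fa0000000000000000001f62001f620a20220a20020220020a20220a20820420420a20220a20020220020a20220a1f62001f6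
     [⟨22, none, [0]⟩, ⟨2, none, [0x248000]⟩, ⟨2, none, [0x4800000920000]⟩,
      ⟨10, none, [0x24800000000000]⟩, ⟨10, none, [0x9200000000000]⟩,
      ⟨2, none, [0x1200000000920]⟩, ⟨2, none, [0x248]⟩] [])),
   (![3,3,3,3], (0, 4),
    (.leaf 0x1fd2031fd2032032062002032030000000000000000000000000002002032032032032061fd2031fd1fd2061fd2062092062032062032032032032002032002032002032012032022042032051fd2021fd
     [⟨6, none, [0]⟩, ⟨6, none, [0x1240000]⟩, ⟨2, none, [0x124]⟩,
      ⟨3, none, [0x9200000000000]⟩, ⟨6, none, [0x4900000]⟩, ⟨2, none, [0x58]⟩,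
      ⟨1, some 0xc33209000, [0]⟩, ⟨3, none, [0x3200000000000]⟩,
      ⟨3, some 0x10000000, [0x248000000,0x2c0000000]⟩, ⟨2, some 0x30c00006824000, [0]⟩,
      ⟨2, none, [0x49]⟩] []))]

/-- Boards whose longest arm has length four, each with a proof tree that it cannot be solved at the
middle of the outer end of that arm. -/
def armFourCerts : List ((Fin 4 → ℕ) × (ℤ × ℤ) × Cert) :=
  [(![4,0,0,0], (0, 5),
    (.leaf 0x200200200200205200200203200200202200200201200200201200200200200000000000000000000000000000000000000
     [⟨8, none, [0]⟩] [])),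
   (![4,0,1,0], (0, 5),
    (.leaf 0x200200200200208200200205200200203200200202200200201200200201200200200200000000000000000000000000000
     [⟨13, none, [0]⟩] [])),
   (![4,1,0,0], (0, 5),
    (.leaf 0x201201200000000000000000000000000000000000000000000000000000000000000000200200200200205200200203200200202200200201200200201200200200200000000000000000000000000000000000000
     [⟨8, none, [0]⟩] [])),
   (![4,0,2,0], (0, 5),
    (.leaf 0x20020020020020d200200208200200205200200203200200202200200201200200201200200200200000000000000000000
     [⟨21, none, [0]⟩] [])),
   (![4,1,0,1], (0, 5),
    (.leaf 0x1ff2001ff0000000000000000000000000001ff2001ff0000000000000000000000000001fd2001fd203204203200202200203202203201200201202202202201200201000000000000000000000000000000000000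
     [⟨6, none, [0]⟩, ⟨2, none, [0x9200000]⟩, ⟨2, none, [0x24800000]⟩, ⟨2, none, [0x7000]⟩] [])),
   (![4,1,1,0], (0, 5),
    (.leaf 0x202201201000000000000000000000000000000000000000000000000000000000000000200200200200208200200205200200203200200202200200201200200201200200200200000000000000000000000000000
     [⟨13, none, [0]⟩] [])),
   (![4,2,0,0], (0, 5),
    (.leaf 0x1ff2001ff201200201000000000000000000000000000000000000000000000000000000000000000200200200200203200200202200200201200200201200200200200200201200000000000000000000000000000000000000
     [⟨5, none, [0]⟩] [])),
   (![4,0,3,0], (0, 5),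
    (.leaf 0x20020020020021520020020d200200208200200205200200203200200202200200201200200201200200200200000000000
     [⟨34, none, [0]⟩] [])),
   (![4,1,1,1], (0, 5),
    (.leaf 0x2012021ff0000000000000000000000000002012021ff00000000000000000000000000020120020120120a2012022062022012042012012022012002022002012002011ff2021ff000000000000000000000000000
     [⟨12, none, [0]⟩, ⟨2, none, [0x24800000]⟩, ⟨2, none, [0x9200000]⟩,
      ⟨2, some 0xc8000000, [0]⟩, ⟨2, some 0x1a0000000, [0]⟩] [])),
   (![4,1,2,0], (0, 5),
    (.leaf 0x20320220100000000000000000000000000000000000000000000000000000000000000020020020020020d200200208200200205200200203200200202200200201200200201200200200200000000000000000000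
     [⟨21, none, [0]⟩] [])),
   (![4,2,0,1], (0, 5),
    (.leaf 0x1fe2001fe2062082020000000000000000000000000002082082000000000000000000000000000001f42001f420c23c20c20022320020c21920c20420a20520820f207200202202000000000000000000000000000000000000
     [⟨95, none, [0]⟩, ⟨7, none, [0x9200000]⟩, ⟨3, none, [0x9240000]⟩,
      ⟨4, none, [0x40000000007000]⟩, ⟨8, none, [0x24800000]⟩] [])),
   (![4,2,1,0], (0, 5),
    (.leaf 0x1ff2001ff201200201000000000000000000000000000000000000000000000000000000000000000200200200200203200200202200200201200200201200200200200200201200200200200000000000000000000000000000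
     [⟨5, none, [0]⟩] [])),
   (![4,3,0,0], (0, 5),
    (.leaf 0x20020020020320320020320320000000000000000000000000000000000000000000000000000000000000000020020020020222d20020221b200204212200206209200206209200200200200000000000000000000000000000000000000
     [⟨72, none, [0]⟩] [])),
   (![4,0,4,0], (0, 5),
    (.leaf 0x20020020020022220020021520020020d200200208200200205200200203200200202200200201200200201200200200200
     [⟨55, none, [0]⟩] [])),
   (![4,1,2,1], (0, 5),
    (.leaf 0x2032022010000000000000000000000000002002002000000000000000000000000000001f82001f820922020f20121320720a20d20f2052062082052072072002012012052062061fb2001fb000000000000000000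
     [⟨42, none, [0]⟩, ⟨12, none, [0x9200000]⟩, ⟨6, none, [0x24800000]⟩,
      ⟨2, some 0x19480000, [0,0x9200000,0x9240000,0x24900000]⟩, ⟨7, some 0xc8000000, [0]⟩] [])),
   (![4,1,3,0], (0, 5),
    (.leaf 0x20520320200000000000000000000000000000000000000000000000000000000000000020020020020021520020020d200200208200200205200200203200200202200200201200200201200200200200000000000
     [⟨34, none, [0]⟩] [])),
   (![4,2,0,2], (0, 5),
    (.leaf 0x1ff2001ff2012002010000000000000000000000000002012002011ff2001ff000000000000000000200200200200203200200202200200201200200201200200200200200201200000000000000000000000000000000000000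
     [⟨5, none, [0]⟩] [])),
   (![4,2,1,1], (0, 5),
    (.leaf 0x1ff2001ff202201201000000000000000000000000000200200200000000000000000000000000000200200200200208203200205203200203203200202202200201201200201201200200200000000000000000000000000000
     [⟨10, none, [0]⟩, ⟨4, none, [0x9200000]⟩, ⟨3, some 0xc8000000, [0]⟩] [])),
   (![4,2,2,0], (0, 5),
    (.leaf 0x1ff2001ff20320220100000000000000000000000000000000000000000000000000000000000000020020020020020d200200208200200205200200203200200202200200201200200201200200200200000000000000000000
     [⟨21, none, [0]⟩] [])),
   (![4,3,0,1], (0, 5),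
    (.leaf 0x1fc2001fc2052092042012092000000000000000000000000000002012091fc0000000000000000000000000001ee2001ee21223f21220022320021221c21220620720620c21520c204202206000000000000000000000000000000000000
     [⟨98, none, [0]⟩, ⟨8, none, [0x240000000007000]⟩, ⟨12, none, [0x9200000]⟩,
      ⟨12, none, [0x24800000]⟩, ⟨4, none, [0x40000003000]⟩] [])),
   (![4,3,1,0], (0, 5),
    (.leaf 0x1fb2001fb20b2042072062042020000000000000000000000000000000000000000000000000000000000000001ff20120020d25d20020c23a20021922320021121720020820c20020920b2001ff201200000000000000000000000000000
     [⟨150, none, [0]⟩, ⟨2, none, [0x49249200]⟩, ⟨20, none, [0x24800000]⟩] [])),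
   (![4,4,0,0], (0, 5),
    (.leaf 0x20020020020120120020120120020220220000000000000000000000000000000000000000000000000000000000000000020020020020121920020120f20020220a200203205200203205200200200200000000000000000000000000000000000000
     [⟨40, none, [0]⟩] [])),
   (![4,1,3,1], (0, 5),
    (.leaf 0x2042051ff00000000000000000000000000020a20820200000000000000000000000000020020020021224620921222b20921221b20920c21020620620b2032062052092002062002062032091fa2031f7000000000
     [⟨86, none, [0]⟩, ⟨24, none, [0x24800000]⟩, ⟨6, none, [0x1240]⟩, ⟨12, none, [0x9200000]⟩,
      ⟨9, some 0xc8000000, [0]⟩, ⟨18, some 0x1a0000000, [0]⟩] [])),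
   (![4,1,4,0], (0, 5),
    (.leaf 0x20820520300000000000000000000000000000000000000000000000000000000000000020020020020022220020021520020020d200200208200200205200200203200200202200200201200200201200200200200
     [⟨55, none, [0]⟩] [])),
   (![4,2,1,2], (0, 5),
    (.leaf 0x1ff2001ff2012002010000000000000000000000000002012002011ff2001ff000000000000000000200200200200203200200202200200201200200201200200200200200201200200200200000000000000000000000000000
     [⟨5, none, [0]⟩] [])),
   (![4,2,2,1], (0, 5),
    (.leaf 0x1ff2001ff2022012010000000000000000000000000002022012010000000000000000000000000001fe2001fe20220a2022002062002022042022012022012012022012002012002012012011ff2001ff000000000000000000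
     [⟨15, none, [0]⟩, ⟨1, none, [0x9200000]⟩, ⟨1, none, [0x9240000]⟩,
      ⟨1, none, [0x24800000]⟩, ⟨1, none, [0x100000024900000]⟩, ⟨1, some 0x1400c8241200, [0]⟩] [])),
   (![4,2,3,0], (0, 5),
    (.leaf 0x1fe2001fe20520320200000000000000000000000000000000000000000000000000000000000000020020020020021520020020d200200208200200205200200203200200202200200201200200201200200200200000000000
     [⟨34, none, [0]⟩] [])),
   (![4,3,0,2], (0, 5),
    (.leaf 0x20420220220720b20420720920600000000000000000000000000021221420a1f82001f80000000000000000001e22001e221e26d21e20023f20021e22e21e20a21120a21421d21420a208202000000000000000000000000000000000000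
     [⟨172, none, [0]⟩, ⟨12, none, [0x40000007000]⟩, ⟨20, none, [0x9200000]⟩,
      ⟨20, none, [0x24800000]⟩, ⟨8, none, [0x240000000004000]⟩, ⟨11, none, [0x100009248000]⟩,
      ⟨4, none, [0x6800000000000000]⟩] [])),
   (![4,3,1,1], (0, 5),
    (.leaf 0x1f72041f720920220b2002042020000000000000000000000000002012051fc00000000000000000000000000020120120120b22720920c21820a20b20f2092092092082022062012092052091f92011f8000000000000000000000000000
     [⟨46, none, [0]⟩, ⟨6, none, [0x9200000]⟩, ⟨10, none, [0x24800000]⟩,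
      ⟨8, some 0xc8000000, [0]⟩, ⟨8, some 0x1a0000000, [0]⟩, ⟨2, some 0x6100000168900000, []⟩,
      ⟨4, none, [0x1240000000000000]⟩, ⟨4, some 0xc014c209000, [0x9200000,0x24800000]⟩,
      ⟨1, some 0xc0048209000, [0x49200000]⟩] [])),
   (![4,3,2,0], (0, 5),
    (.leaf 0x21220021221821820022a2182120000000000000000000000000000000000000000000000000000000000000001ae2001ae25939e2522072fc2002602a225223025a22a2302482282002122122302362261e42081ec000000000000000000
     [⟨666, none, [0]⟩, ⟨20, none, [0x9249340]⟩, ⟨40, none, [0x9200000]⟩,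
      ⟨44, none, [0x9240000]⟩, ⟨55, none, [0x24800000]⟩, ⟨16, none, [0x12c0]⟩,
      ⟨20, none, [0x9248000]⟩] [])),
   (![4,4,0,1], (0, 5),
    (.leaf 0x1fb2001fb20f20e20920a20e20421921c20500000000000000000000000000021d21e1ff0000000000000000000000000001b32001b324d2ec24d20028620024d26624d22322022522a246228209204205000000000000000000000000000000000000
     [⟨342, none, [0]⟩, ⟨12, none, [0x9200000]⟩, ⟨8, none, [0x1240000000004000]⟩,
      ⟨14, none, [0x24800000]⟩, ⟨6, none, [0x9240000]⟩, ⟨8, none, [0x7000]⟩,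
      ⟨25, some 0x3d480000, [0,0x9200000,0x24800000,0x9240000,0x24900000]⟩,
      ⟨3, some 0x3d480000, [0,0x9200000,0x24800000,0x9240000,0x4900000024900000]⟩] [])),
   (![4,1,4,1], (0, 5),
    (.leaf 0x2042051ff0000000000000000000000000002042051ff0000000000000000000000000001fd2001fd20f23d20f20c22520c20f21820f20920d20920620b2062032022032092092092002062002092062091f72001f7
     [⟨74, none, [0]⟩, ⟨18, none, [0x24800000]⟩, ⟨18, none, [0x9200000]⟩,
      ⟨12, some 0xc8000000, [0]⟩, ⟨12, some 0x1a0000000, [0]⟩, ⟨6, none, [0x920]⟩,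
      ⟨3, some 0x180180012090400, [0x248,0x2d8]⟩] [])),
   (![4,2,2,2], (0, 5),
    (.leaf 0x1ff2001ff2012002010000000000000000000000000002012002011ff2001ff000000000000000000200200200200203200200202200200201200200201200200200200200201200200201200200200200000000000000000000
     [⟨5, none, [0]⟩] [])),
   (![4,2,3,1], (0, 5),
    (.leaf 0x1e32001e32402232270000000000000000000000000001fe2021fc0000000000000000000000000001f62001f621433827720a2c126d21427727720a24a24c20a22d22b20a21d22120021020a20a20d2171f62031f3000000000
     [⟨386, none, [0]⟩, ⟨152, none, [0x9200000]⟩, ⟨20, none, [0x24800000]⟩,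
      ⟨109, some 0xc8000000, [0]⟩, ⟨10, some 0x1a0000000, [0]⟩] [])),
   (![4,2,4,0], (0, 5),
    (.leaf 0x1fd2001fd20820520300000000000000000000000000000000000000000000000000000000000000020020020020022220020021520020020d200200208200200205200200203200200202200200201200200201200200200200
     [⟨55, none, [0]⟩] [])),
   (![4,3,0,3], (0, 5),
    (.leaf 0x1e72031ea21921921c2002162060000000000000000000000000002012112002172112161ea2001ea0000000001e82001e823729d23021f25b21823724223021921921821e229218216210216000000000000000000000000000000000000
     [⟨182, none, [0]⟩, ⟨50, none, [0x24800000]⟩, ⟨48, none, [0x9200000]⟩,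
      ⟨16, none, [0x48000003000]⟩, ⟨6, none, [0x640000000000000]⟩,
      ⟨16, none, [0x240000000006000]⟩, ⟨6, none, [0x1240000000000000]⟩,
      ⟨11, some 0x1a0820000, [0,0x24820000]⟩, ⟨24, some 0xc8000000, [0]⟩,
      ⟨31, some 0x1a0000000, [0]⟩] [])),
   (![4,3,1,2], (0, 5),
    (.leaf 0x1fb2001fb20720220520220220000000000000000000000000000020b2062051fb2001fb00000000000000000020020020020d22d20020d21c20020d21120020920b2002042062002052052001ff201200000000000000000000000000000
     [⟨60, none, [0]⟩, ⟨16, none, [0x24800000]⟩, ⟨12, some 0x1a0000000, [0]⟩,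
      ⟨1, some 0x184000000, [0,0x24800000]⟩] [])),
   (![4,3,2,1], (0, 5),
    (.leaf 0x2002002002012012002012012000000000000000000000000000002012012000000000000000000000000000001fe2001fe20420f2042022092022042062042022032022022032022002002002022032021fe2001fe000000000000000000
     [⟨20, none, [0]⟩, ⟨4, none, [0x9200000]⟩, ⟨4, none, [0x24800000]⟩,
      ⟨3, some 0x6c01800ca653200, []⟩, ⟨2, some 0xc8000000, [0]⟩, ⟨2, some 0x1a0000000, [0]⟩] [])),
   (![4,3,3,0], (0, 5),
    (.leaf 0x1fc2061f620c20220a2082082000000000000000000000000000000000000000000000000000000000000000001f02001f021927821020924a20021e22e21021421c20620a21220a20a20a20a20020820220a20820c1f62001f6000000000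
     [⟨194, none, [0]⟩, ⟨19, none, [0x24800000]⟩, ⟨4, none, [0x9249240]⟩,
      ⟨8, none, [0x9200000]⟩, ⟨4, none, [0x9248000]⟩,
      ⟨2, some 0x6c00000c3652240, [0x1240,0x9200000,0x9248000]⟩,
      ⟨4, some 0x6c00001ab45a240, [0x9249240]⟩] [])),
   (![4,4,0,2], (0, 5),
    (.leaf 0x1ff2001ff2012012012002012002012012010000000000000000000000000002022022011ff2001ff0000000000000000001fd2001fd20320c203200207200203205203201202201202203202201201200000000000000000000000000000000000000
     [⟨19, none, [0]⟩, ⟨1, none, [0x1240000000004000]⟩, ⟨1, none, [0x100009248000]⟩,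
      ⟨2, none, [0x24800000]⟩, ⟨1, none, [0x40000007000]⟩, ⟨2, none, [0x9200000]⟩] [])),
   (![4,4,1,1], (0, 5),
    (.leaf 0x1f52001f520b20420b20020420020b20820b0000000000000000000000000002002051fb00000000000000000000000000020520020520623921120b22321620721621120620d20d20120920420720420b1fa2071fb000000000000000000000000000
     [⟨70, none, [0]⟩, ⟨12, none, [0x24800000]⟩, ⟨26, none, [0x9200000]⟩,
      ⟨4, none, [0x4900000000000000]⟩, ⟨22, some 0xc8000000, [0]⟩,
      ⟨6, some 0x180009048200, []⟩, ⟨4, none, [0x1240000000000000]⟩, ⟨2, none, [0x1600]⟩] [])),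
   (![4,2,3,2], (0, 5),
    (.leaf 0x1ff2001ff2012002010000000000000000000000000002012002011ff2001ff000000000000000000200200200200203200200202200200201200200201200200200200200201200200200200200201200200200200000000000
     [⟨5, none, [0]⟩] [])),
   (![4,2,4,1], (0, 5),
    (.leaf 0x1d22001d225422622e0000000000000000000000000002042002040000000000000000000000000001da2001da24c4062c522634029f24c2c62c522627a27722624c24e20022e22a22621e23620421020622a20e2301da2041d6
     [⟨640, none, [0]⟩, ⟨236, none, [0x9200000]⟩, ⟨76, none, [0x24800000]⟩,
      ⟨18, none, [0x248]⟩, ⟨8, none, [0x124]⟩, ⟨38, some 0x1a0000000, [0]⟩,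
      ⟨1, some 0xc1240000, [0,0x9200000,0x9240000]⟩, ⟨159, some 0xc8000000, [0]⟩] [])),
   (![4,3,1,3], (0, 5),
    (.leaf 0x1ff2011ff2012012022002012010000000000000000000000000002002012012012012021ff2011ff0000000002012002012012052012022032022012022012012012012002012002012002011ff2011ff000000000000000000000000000
     [⟨6, none, [0]⟩, ⟨2, none, [0x24800000]⟩, ⟨2, none, [0x9200000]⟩,
      ⟨2, some 0xc8000000, [0]⟩, ⟨1, some 0x186009048200, []⟩,
      ⟨1, some 0x2000000000000000, [0x1240000000000000,0x640000000000000]⟩,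
      ⟨1, some 0x2000000000, [0x49000000000,0x58000000000]⟩] [])),
   (![4,3,2,2], (0, 5),
    (.leaf 0x1fd2001fd20f20c20320c20c2000000000000000000000000000002162132031fd2001fd0000000000000000001eb2001eb2332bd22521e27221023324b22521b2272122182242132032032002172212131ee2011ed000000000000000000
     [⟨256, none, [0]⟩, ⟨34, none, [0x9200000]⟩, ⟨54, none, [0x24800000]⟩,
      ⟨30, some 0x1a0000000, [0]⟩, ⟨1, some 0xc1240000, [0,0x9200000,0x9240000]⟩,
      ⟨16, some 0xc8000000, [0]⟩, ⟨2, none, [0x980]⟩, ⟨29, some 0x6c01980ca653200, []⟩] [])),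
   (![4,3,3,1], (0, 5),
    (.leaf 0x1f52071f620b2082112002082070000000000000000000000000002032071fc00000000000000000000000000020020020020f23920b20f22220b20f21720d20b20b20820420c20520a20320a20620920021020920a1f62061f6000000000
     [⟨68, none, [0]⟩, ⟨19, none, [0x24800000]⟩, ⟨16, none, [0x9200000]⟩,
      ⟨2, none, [0x1240000000000000]⟩, ⟨9, some 0xc8000000, [0]⟩, ⟨14, some 0x1a0000000, [0]⟩,
      ⟨6, some 0x2000000000000000, [0x1240000000000000,0x640000000000000]⟩,
      ⟨1, some 0x6100000000900000, []⟩, ⟨1, some 0x6c01800ca652240, [0x1240]⟩,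
      ⟨2, some 0x6c00000c361a240, [0x1240]⟩, ⟨6, some 0xb400000d86c3608, [0x920,0x980]⟩] [])),
   (![4,3,4,0], (0, 5),
    (.leaf 0x20520020520720720020c2072050000000000000000000000000000000000000000000000000000000000000001ec2001ec21426621420023f20021422721420c21820c20820f2082042092042042062042002032002042032041fc2001fc
     [⟨165, none, [0]⟩, ⟨8, none, [0x24800000]⟩, ⟨16, none, [0x9240000]⟩,
      ⟨8, none, [0x9200000]⟩, ⟨8, none, [0x9249000]⟩] [])),
   (![4,4,0,3], (0, 5),
    (.leaf 0x18720018727a24f28f20124f21627b26c28500000000000000000000000000020a24220c26724226a1a32001a30000000001952001952b84a32f524d38f28a2b83142f524d27b27126b29a28425423e276000000000000000000000000000000000000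
     [⟨798, none, [0]⟩, ⟨92, none, [0x24800000]⟩, ⟨226, none, [0x9200000]⟩,
      ⟨43, none, [0x9208000]⟩, ⟨68, none, [0x48000001000]⟩,
      ⟨26, some 0x2d0fc6c7000, [0x24800000,0x24900000,0x1240000000000000,0x1240000000004000]⟩,
      ⟨109, some 0xc8000000, [0]⟩, ⟨29, some 0x1860c1048000, [0]⟩,
      ⟨61, some 0x1a0820000, [0,0x24820000]⟩,
      ⟨5, some 0x801b0036090000, [0x24800000,0x24900000]⟩,
      ⟨12, some 0x400d8186c36000, [0x7000,0x40000000007000]⟩,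
      ⟨1, some 0x48000f515eaf1000, [0x1240000000006000,0x4900000000000000]⟩,
      ⟨45, some 0x48800ee19dcee000, [0x1240000000000000,0x4900000000000000]⟩,
      ⟨77, some 0x1a0000000, [0]⟩] [])),
   (![4,4,1,2], (0, 5),
    (.leaf 0x1f82001f820820220820020220020820220800000000000000000000000000021020520b1f52001f500000000000000000020020020020c23a20020c22520020c21520020821020020420520020520b200200200200000000000000000000000000000
     [⟨83, none, [0]⟩, ⟨2, none, [0x1240000000000000]⟩, ⟨16, none, [0x24800000]⟩,
      ⟨1, some 0x180c361f000, []⟩, ⟨11, some 0x1a0000000, [0]⟩,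
      ⟨1, some 0x30d801b01b2090000, [0]⟩] [])),
   (![4,2,4,2], (0, 5),
    (.leaf 0x1fd2001fd2032002030000000000000000000000000002032002031fd2001fd000000000000000000200200200200209200200206200200203200200203200200200200200203200200202200200201200200201200200200200
     [⟨15, none, [0]⟩] [])),
   (![4,3,2,3], (0, 5),
    (.leaf 0x1ee20e1ee23923522021922720e0000000000000000000000000002162282122312312241e52091ee0000000001d52001d527d3d128425231725927d2ba28424425d24723925d23d21220021224825d2391e820f1d9000000000000000000
     [⟨558, none, [0]⟩, ⟨136, none, [0x24800000]⟩, ⟨18, none, [0x49000000000]⟩,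
      ⟨142, none, [0x9200000]⟩, ⟨89, some 0xc8000000, [0]⟩, ⟨78, some 0x6c019d0ca653200, []⟩,
      ⟨4, some 0x67400001a0900000, [0]⟩, ⟨82, some 0x1a0000000, [0]⟩,
      ⟨8, some 0x1860c1240000, [0,0x9208000]⟩, ⟨18, none, [0x58000000000]⟩,
      ⟨30, none, [0x980]⟩, ⟨3, some 0x1a0820000, [0,0x24820000]⟩,
      ⟨14, some 0x2c00000000000000, [0x1240000000000000,0x6800000000000000,0x640000000000000]⟩] [])),
   (![4,3,3,2], (0, 5),
    (.leaf 0x1e12001e122f21021f2102102000000000000000000000000000002402242381e92081ec0000000000000000001fc2001fc25f34d22825b2ce22425f27f22823f24f21c22023020c21f21f21920121220421e21221d1e32041e7000000000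
     [⟨412, none, [0]⟩, ⟨40, none, [0x9200000]⟩, ⟨120, none, [0x24800000]⟩,
      ⟨6, none, [0x58000000000]⟩, ⟨36, some 0xc8000000, [0]⟩, ⟨91, some 0x1a0000000, [0]⟩,
      ⟨8, none, [0x248]⟩, ⟨4, some 0xb400680d86c2640, [0x40000001240]⟩,
      ⟨3, some 0x10002d000000, [0x9200000,0x24800000,0x9240000]⟩,
      ⟨5, some 0x6c01d00c3652240, [0x9200000,0x9240000,0x58000000000,0x130000000000,0x68000001240]⟩] [])),
   (![4,3,4,1], (0, 5),
    (.split (4,7,10) 0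
     (.leaf 0x1fa2021fc2092092082032072040000000000000000000000000002032071fc0000000000000000000000000001fc2001fc21424b21321022d20f21421e21420c20f20c20820f20820420020420420f2042002002002042002041fc2001fc
      [⟨90, none, [0]⟩, ⟨22, none, [0x9200000]⟩, ⟨24, none, [0x24800000]⟩,
       ⟨4, none, [0x1240000000000000]⟩, ⟨14, some 0xc8000000, [0]⟩,
       ⟨4, none, [0x640000000000000]⟩, ⟨16, some 0x1a0000000, [0]⟩,
       ⟨1, some 0xd8018001b090400, [0x9200000]⟩, ⟨14, some 0xd80180012090400, []⟩] [30])
     (.split (62,61,60) 0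
      (.leaf 0x1f81fc1fd20a2082042012022010000000000000000000000000002042032010000000000000000000000000001fc2001fc21123320c20d21f20821121420d20a20b20720720920620320220320a20720920120920220b20a20b1f62031f7
       [⟨62, none, [0]⟩, ⟨14, none, [0x9200000]⟩, ⟨20, none, [0x24800000]⟩,
        ⟨2, none, [0x124]⟩, ⟨7, some 0xc8000000, [0]⟩, ⟨6, none, [0x920]⟩,
        ⟨13, some 0x1a0000000, [0]⟩, ⟨2, none, [0x248]⟩, ⟨4, none, [0x49]⟩,
        ⟨2, some 0x180009049000, [0x248,0x1248]⟩,
        ⟨1, some 0x2c00000000000000, [0x1240000000000000,0x640000000000000,0x6800000000000000]⟩] [10, 12])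
      (.leaf 0x2032071fc2042002042072072000000000000000000000000000002062062000000000000000000000000000001fd2001fd21224d21220f22f20f21221e21220b21120b20720d20720420420620a20920d20020920320a20c2101f62031f9
       [⟨94, none, [0]⟩, ⟨22, none, [0x9200000]⟩, ⟨22, none, [0x24800000]⟩,
        ⟨1, none, [0x24920000]⟩, ⟨15, some 0xc8000000, [0]⟩, ⟨6, none, [0x920]⟩,
        ⟨15, some 0x1a0000000, [0]⟩, ⟨8, none, [0x248]⟩, ⟨6, none, [0xb]⟩,
        ⟨2, some 0x180009049000, [0x248,0x1248]⟩] [14, 12])))),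
   (![4,4,0,4], (0, 5),
    (.leaf 0x1c72001c723b22423920222420023d2372390000000000000000000000000002262232262002132002262132261da2001da1ca2001ca27237625c23c2e122627229525c23124c22624124923621e21e20b000000000000000000000000000000000000
     [⟨450, none, [0]⟩, ⟨76, none, [0x9200000]⟩, ⟨90, none, [0x24800000]⟩,
      ⟨5, some 0xd8626416000, [0,0x24820000]⟩, ⟨26, some 0x186da9048000, [0]⟩,
      ⟨34, some 0x1a0000000, [0]⟩, ⟨3, some 0x80089145a2a000, [0x49000000000,0x7000]⟩,
      ⟨10, none, [0x1240000000000000]⟩, ⟨11, some 0x2d0d32d0000, [0,0x24920000,0x9208000]⟩,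
      ⟨5, some 0x2d0d32d0000, [0,0x6d80000024920000,0x9208000]⟩,
      ⟨4, some 0x168a34486000, [0,0x24800000,0x1240000000000000,0x1240000000004000,0x24900000]⟩,
      ⟨8, some 0x7000, [0x49000000000,0x49000001000,0x1240000000000000,0x1240000000004000]⟩,
      ⟨14, some 0x80186c2d168000, [0x4900000000000000]⟩, ⟨38, some 0xc8000000, [0]⟩,
      ⟨15, some 0x1a0820000, [0,0x24820000]⟩, ⟨11, some 0x186da9868000, [0,0x24820000]⟩] [])),
   (![4,4,1,3], (0, 5),
    (.leaf 0x1ec2001ec21420a21420020a20021420a2140000000000000000000000000002022062042102062121f22041f200000000020320020320a25021520d23221820a21e21520a21421220020a20420a20a20e1f62001f6000000000000000000000000000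
     [⟨100, none, [0]⟩, ⟨6, none, [0x24800000]⟩, ⟨18, none, [0x9200000]⟩,
      ⟨15, some 0xc8000000, [0]⟩, ⟨8, some 0xc1000000, [0,0x9200000]⟩,
      ⟨1, some 0x24200000, [0x24800000,0x9200000]⟩, ⟨7, some 0x1a0000000, [0]⟩,
      ⟨6, some 0xc3145209000, [0x24800000]⟩,
      ⟨4, some 0x2000000000, [0x58000000000,0x49000000000]⟩,
      ⟨10, some 0x345000d8186c36000, [0x1240000000000000,0x4d00000000000000]⟩] [])),
   (![4,4,2,2], (0, 5),
    (.leaf 0x1d52011d622b20c22b20020d20122b21922a00000000000000000000000000024121c2251db2001db0000000000000000001df2001df2513722362302e421525128e23622b25621c22623821c20522520022122521c1e42001e4000000000000000000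
     [⟨490, none, [0]⟩, ⟨86, none, [0x24800000]⟩, ⟨40, none, [0x9200000]⟩,
      ⟨2, none, [0x9200000000000000]⟩, ⟨10, none, [0x1240000000000000]⟩,
      ⟨48, some 0x1a0000000, [0]⟩,
      ⟨7, some 0x30d80000019480000, [0,0x9200000,0x100009240000]⟩,
      ⟨14, some 0x1400c8241200, [0]⟩, ⟨18, some 0x30d800f00da2d1200, [0]⟩,
      ⟨21, some 0xc8000000, [0]⟩] [])),
   (![4,3,3,3], (0, 5),
    (.split (61,58,55) 0
     (.leaf 0x1c72001c723a23a27220124523900000000000000000000000000020024123923c23e2721c42391c700000000020220b20d24835824d24a2ca25a24828e24d23b23c23c20d25221323920023922c25222626525225f1c72521c7000000000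
      [⟨382, none, [0]⟩, ⟨87, none, [0x24800000]⟩, ⟨6, none, [0x49000000000]⟩,
       ⟨96, none, [0x9200000]⟩, ⟨90, some 0xc8000000, [0]⟩,
       ⟨44, some 0xb4002d0d86c3608, [0x980,0x920]⟩, ⟨63, some 0x1a0000000, [0]⟩,
       ⟨114, none, [0x640000000000000]⟩,
       ⟨54, some 0x2000000000, [0x49000000000,0x58000000000]⟩, ⟨2, none, [0x90000008000]⟩,
       ⟨38, some 0xb4002d0d86c3608, [0x2c0,0x248]⟩,
       ⟨11, some 0x6100000009900000, [0x49200000]⟩] [136])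
     (.leaf 0x1fd2061fd2032032062002032030000000000000000000000000002002032032032032061fd2031fd00000000020020120020421120420420a2042042072042032032032012042012032002032022042022052042051fd2041fd000000000
      [⟨18, none, [0]⟩, ⟨3, none, [0x24800000]⟩, ⟨4, none, [0x9200000]⟩,
       ⟨1, some 0xc1000000, [0,0x9200000]⟩, ⟨3, some 0xc8000000, [0]⟩,
       ⟨2, some 0xb4002d0d86c3608, [0x980,0x920]⟩, ⟨4, some 0x1a0000000, [0]⟩,
       ⟨6, none, [0x1240000000000000]⟩,
       ⟨1, some 0x6c000341f8fc0000, [0x24800000,0x124800000,0x49000000000,0x58000000000]⟩,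
       ⟨2, some 0x2000000000, [0x49000000000,0x58000000000]⟩,
       ⟨2, some 0xb4002d0d86c3608, [0x2c0,0x248]⟩] [6]))),
   (![4,3,4,2], (0, 5),
    (.split (62,61,60) 0
     (.leaf 0x1db1e61f522621a20c20120020100000000000000000000000000021c20e2101f22001f20000000000000000001f42001f42402ac21a23426a20e24024221a22722820e21a21a20c20d20e20221120c20e20020720321120a2111ef2031f2
      [⟨212, none, [0]⟩, ⟨24, none, [0x9200000]⟩, ⟨77, none, [0x24800000]⟩,
       ⟨4, none, [0x920]⟩, ⟨14, some 0xc8000000, [0]⟩, ⟨52, some 0x1a0000000, [0]⟩,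
       ⟨2, some 0x130009000000, [0x9200000,0x100009240000]⟩, ⟨4, none, [0x248]⟩,
       ⟨5, some 0xd801b0012090400, []⟩, ⟨6, none, [0x49]⟩] [52])
     (.leaf 0x20f2191f620020a20a20f20f20000000000000000000000000000021620c20e1f62001f60000000000000000001f82001f821f28221421725020c21f23221420f21e20c21021420820a20a20420b20a20b20020720020b20720b1f52001f5
      [⟨166, none, [0]⟩, ⟨16, none, [0x9200000]⟩, ⟨30, none, [0x24800000]⟩,
       ⟨12, some 0xc8000000, [0]⟩, ⟨23, some 0x1a0000000, [0]⟩,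
       ⟨4, some 0x130009000000, [0x9200000,0x100009240000]⟩, ⟨6, none, [0x248]⟩,
       ⟨5, some 0x6180000184900000, [0,0x24820000]⟩, ⟨4, some 0x1a0820000, [0,0x24820000]⟩,
       ⟨3, some 0xd801b0012090400, []⟩, ⟨1, some 0x5a000e81b9dce448, [0x920,0x248]⟩] [50]))),
   (![4,4,1,4], (0, 5),
    (.leaf 0x1c52001c523b21c23b20021c20023b21c23b00000000000000000000000000023721a2372002122002372122371c92001c920c20020c2222f822322e29b22f22225d22321f23e21e20321f20521f21f21e1e72061ea000000000000000000000000000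
     [⟨310, none, [0]⟩, ⟨44, none, [0x9200000]⟩, ⟨49, none, [0x24800000]⟩,
      ⟨8, none, [0x49000000000]⟩, ⟨43, some 0x1a0000000, [0]⟩,
      ⟨3, some 0x1a9000000, [0,0x9200000]⟩, ⟨47, some 0xc8000000, [0]⟩,
      ⟨3, some 0x36186c7b200, [0x9200000,0x1600,0x17de09240000,0x49000000000,0x59000000000,0x4c00]⟩,
      ⟨2, some 0xf5600049000, [0x9200000,0x17da09240000,0x49000000000,0x59000000000]⟩,
      ⟨28, some 0x345000d8786c36000, [0x1240000000000000,0x4900000000000000]⟩,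
      ⟨18, none, [0x124000000000]⟩] [])),
   (![4,4,3,2], (0, 5),
    (.leaf 0x1152001152eb2372eb2002372002eb26e2eb0000000000000000000000000003623193221b725520c0000000000000000001db2001db33183a36e30c5dc34933145e36e2bf37e2f42722e027a2b429e2842252422002c325c28419621a17c000000000
     [⟨1985, none, [0]⟩, ⟨382, none, [0x24800000]⟩, ⟨19, none, [0x1e8009249240]⟩,
      ⟨55, none, [0x1240000000000000]⟩, ⟨414, none, [0x9200000]⟩,
      ⟨170, none, [0x58000000000]⟩, ⟨329, some 0xc8000000, [0]⟩, ⟨10, none, [0x40000001240]⟩,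
      ⟨95, none, [0x180009248000]⟩, ⟨65, none, [0x9248000]⟩,
      ⟨37, some 0x100009000000, [0x9240000,0x9200000]⟩, ⟨268, some 0x1a0000000, [0]⟩,
      ⟨103, none, [0x4900]⟩, ⟨44, none, [0x4900000000000000]⟩, ⟨52, none, [0x130]⟩] [])),
   (![4,3,4,3], (0, 5),
    (.split (56,20,19) 1
     (.split (57,58,59) 0
      (.split (21,24,27) 0
       (.leaf 0x1ea2041ee21c21121620621520400000000000000000000000000020f21720821f2172181f02081f00000000001bf2001bf24232127f2012af23e24227224c22223d22e22023521e21220821022e22d22e20021e20022e21e22e1d22001d2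
        [⟨350, none, [0]⟩, ⟨30, none, [0x24800000]⟩, ⟨28, none, [0x920]⟩,
         ⟨12, none, [0x24900000]⟩, ⟨92, none, [0x9200000]⟩, ⟨12, some 0xd801b0012090400, []⟩,
         ⟨113, some 0xc8000000, [0]⟩, ⟨30, none, [0x248]⟩, ⟨1, some 0x1a0000000, [0]⟩,
         ⟨2, some 0x61800d81a2d12000, []⟩, ⟨4, some 0xd8186c32000, [0x240000000004000]⟩,
         ⟨8, none, [0x1240000000000000]⟩, ⟨20, none, [0x900000024900000]⟩,
         ⟨8, some 0x2000000000, [0x49000000000,0x58000000000]⟩,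
         ⟨3, some 0x4801b0036090400, [0x24800000,0x900000024900000]⟩] [102, 8, 56])
       (.split (4,7,10) 0
        (.leaf 0x1de2121f022220021e20021220e00000000000000000000000000020a20e20221a20e2121f02021f00000000002002002002322ba21e23227021e23224a23a2222262242122242162102022102112222122002022012112022121ef2001ef
         [⟨246, none, [0]⟩, ⟨66, none, [0x24800000]⟩, ⟨52, none, [0x9200000]⟩,
          ⟨32, some 0xd801b0012090400, []⟩, ⟨2, some 0xc8000000, [0]⟩,
          ⟨8, none, [0x120009240000]⟩, ⟨2, none, [0x248]⟩, ⟨50, some 0x1a0000000, [0]⟩,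
          ⟨28, none, [0x1240000000000000]⟩,
          ⟨2, some 0x2000000000, [0x49000000000,0x58000000000]⟩,
          ⟨2, some 0x6c00480c361a000, [0x48000001000]⟩,
          ⟨1, some 0x30c00c3145a2d248, [0x920,0x248]⟩] [62, 56, 32, 4])
        (.leaf 0x1fc2021fe2042002042002022020000000000000000000000000002012022012032022031fe2011fe00000000020020020020621420420620c204206208206204204204202204202202200202204204204202204202206208206200204200
         [⟨24, none, [0]⟩, ⟨8, none, [0x24800000]⟩, ⟨4, none, [0x920]⟩,
          ⟨5, none, [0x9200000]⟩, ⟨4, none, [0xb]⟩, ⟨1, some 0xc8000000, [0]⟩,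
          ⟨1, some 0xc1000000, [0,0x9200000]⟩, ⟨1, none, [0x100009240000]⟩,
          ⟨4, none, [0x248]⟩, ⟨6, some 0x1a0000000, [0]⟩, ⟨4, none, [0x1240000000000000]⟩,
          ⟨1, some 0x2000000000, [0x49000000000,0x58000000000]⟩, ⟨4, none, [0x26]⟩] [8, 4, 4, 0])))
      (.split (22,25,28) 1
       (.split (62,61,60) 0
        (.split (38,37,36) 0
         (.leaf 0x1fc1fe1fe2042042022002022000000000000000000000000000002002012012062052031fa1fd1fe0000000001fe2001fe20721e20a20521120820720b20a2042062062032052042022012022052042052002032002052032051fb2001fb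
          [⟨34, none, [0]⟩, ⟨8, none, [0x24800000]⟩, ⟨2, none, [0x920]⟩,
           ⟨12, none, [0x9200000]⟩, ⟨1, some 0xd801b0012090400, []⟩,
           ⟨8, some 0xc8000000, [0]⟩, ⟨2, none, [0x248]⟩, ⟨5, some 0x1a0000000, [0]⟩,
           ⟨1, some 0x61800d81a2d12000, []⟩,
           ⟨1, some 0x2000000000, [0x49000000000,0x58000000000]⟩,
           ⟨1, some 0x3b800ee19dcee448, [0x920,0x248]⟩] [8, 4, 2, 2, 2])
         (.leaf 0x1be1d41ea2422342162002082000000000000000000000000000002202202002102062162102261ea0000000001ea2001ea26e35a2502582c823a26e27e25024224a23022c23422021621621622d21e22d20021720022d21722d1d32001d3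
          [⟨400, none, [0]⟩, ⟨132, none, [0x24800000]⟩, ⟨14, none, [0x920]⟩,
           ⟨84, none, [0x9200000]⟩, ⟨7, some 0xd801b0012090400, []⟩,
           ⟨58, some 0xc8000000, [0]⟩, ⟨14, none, [0x248]⟩, ⟨88, some 0x1a0000000, [0]⟩,
           ⟨9, some 0x5a000ee1b9dce448, [0x920,0x248]⟩,
           ⟨6, some 0x6c00ee0c3652000, [0x9200000,0x9240000]⟩] [76, 88, 20, 8, 8]))
        (.leaf 0x26d2ee19320027727726d27720a00000000000000000000000000022f23820029c23826d1932001930000000001fd2001fd29567433229249332f29539933226d2fa2cb22829f26726d25b26d29524429520e23620e2a324429518720e179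
         [⟨1318, none, [0]⟩, ⟨154, none, [0x24800000]⟩, ⟨406, none, [0x9200000]⟩,
          ⟨14, some 0xd801b0012090400, []⟩, ⟨303, some 0xc8000000, [0]⟩,
          ⟨146, some 0x1a0000000, [0]⟩, ⟨8, some 0x61800d81a2d12000, []⟩,
          ⟨32, some 0x6c00000184900000, [0,0x24800000,0x24900000]⟩,
          ⟨20, none, [0x1240000000000000]⟩, ⟨9, some 0x6c00480c361a000, [0x48000001000]⟩,
          ⟨28, none, [0x26]⟩, ⟨14, some 0x30c00c3145a2d248, [0x920,0x248]⟩,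
          ⟨40, some 0x3b800ee19dcee448, [0x920,0x248]⟩] [456, 72, 218, 64]))
       (.leaf 0x20020020020020620620020620000000000000000000000000000020620620020c2062061fa2001fa0000000001f42281f021821a21720c24220720c22a21e20021821220c21220c20620620620f20c20f20020920020f20920f1f12001f1
        [⟨52, none, [0]⟩, ⟨6, none, [0x920]⟩, ⟨16, none, [0x9200000]⟩,
         ⟨3, some 0xd801b001b090400, [0x9200000]⟩, ⟨6, none, [0x248]⟩,
         ⟨24, none, [0x124000000]⟩, ⟨3, some 0x5a000ee1b9dce448, [0x920,0x248]⟩] [82, 12, 24])))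
     (.split (11,8,5) 0
      (.split (60,61,62) 0
       (.split (9,12,15) 0
        (.split (38,37,36) 0
         (.leaf 0x1f32001f321e21621221121620500000000000000000000000000020020620624023a2121c01d21f40000000001df2001df25633426d2352ba24c25627a27422f24024022723a23420d20620c2262342401f32272002332272401c02001c0
          [⟨372, none, [0]⟩, ⟨92, none, [0x24800000]⟩, ⟨128, none, [0x9200000]⟩,
           ⟨14, some 0xd801b0012090400, []⟩, ⟨69, some 0xc8000000, [0]⟩, ⟨52, none, [0x248]⟩,
           ⟨53, some 0x1a0000000, [0]⟩, ⟨2, some 0x61800d81a2d12000, []⟩,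
           ⟨3, some 0x67400d81a2d12000, []⟩, ⟨10, none, [0x1240000000000000]⟩,
           ⟨6, some 0x2000000000, [0x49000000000,0x58000000000]⟩,
           ⟨12, some 0x5a001681b0d86400, [0x980]⟩] [104, 28, 10, 50, 0])
         (.split (40,43,15) 0
          (.split (58,55,17) 0
           (.split (61,58,55) 0
            (.leaf 0x2021fc1fe2022002022042042000000000000000000000000000002032032002022002022012031fe0000000001fc2001fc20b22120920721420520b20d2092062072052052062042022022022042042061ff2032002052032061fa2001fa
             [⟨40, none, [0]⟩, ⟨12, none, [0x24800000]⟩, ⟨8, none, [0x9200000]⟩,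
              ⟨1, some 0xd801b0012090400, []⟩, ⟨5, some 0xc8000000, [0]⟩, ⟨4, none, [0x248]⟩,
              ⟨7, some 0x1a0000000, [0]⟩, ⟨1, some 0x67400d81a2d12000, []⟩,
              ⟨1, some 0x6c00ee0c3652000, [0x9200000,0x100009240000]⟩,
              ⟨1, some 0x5a001681b0d86400, [0x980]⟩, ⟨1, some 0xd801b0010480000, [0]⟩] [8, 2, 2, 6, 0, 8, 4, 3])
            (.leaf 0x1ce2241f223222921320020520500000000000000000000000000021221720520e2052132042171f20000000001ea2001ea2562e823624028d22025625b23b23223222022422922020e20920e21e22022e1f821820022621822e1d22001d2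
             [⟨282, none, [0]⟩, ⟨100, none, [0x24800000]⟩, ⟨54, none, [0x9200000]⟩,
              ⟨8, some 0xd801b0012090400, []⟩, ⟨27, some 0xc8000000, [0]⟩,
              ⟨32, none, [0x248]⟩, ⟨64, some 0x1a0000000, [0]⟩,
              ⟨10, none, [0x1240000000000000]⟩,
              ⟨5, some 0x2000000000, [0x49000000000,0x58000000000]⟩,
              ⟨8, some 0x5a001681b0d86400, [0x980]⟩, ⟨5, some 0x186000040000, [0x9200000]⟩,
              ⟨9, some 0x6c015e0ca652000, []⟩] [72, 0, 28, 36, 4, 0, 32, 0]))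
           (.leaf 0x2071fa1fd20121520620820f2030000000000000000000000000002032062032032032062002061fd0000000001fd2001fd20f22d20920c21b20620f2122092092092062062092062032002032092092092002062002092062091f72001f7
            [⟨54, none, [0]⟩, ⟨18, none, [0x24800000]⟩, ⟨6, none, [0x920]⟩,
             ⟨4, none, [0x2480000000000000]⟩, ⟨6, none, [0x9200000]⟩,
             ⟨3, some 0xd801b0012090400, []⟩, ⟨6, some 0xc8000000, [0]⟩, ⟨6, none, [0x248]⟩,
             ⟨12, some 0x1a0000000, [0]⟩, ⟨6, none, [0x1240000000000000]⟩,
             ⟨3, some 0x2000000000, [0x49000000000,0x58000000000]⟩,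
             ⟨3, some 0x186000040000, [0x9200000]⟩] [26, 6, 6, 0, 26, 0, 8]))
          (.leaf 0x1ef2001ef21a21a22220921a2110000000000000000000000000002212322112102322222312641ef0000000001ff2001ff2352dc21723428421623525821722322c21121222c20621120021122322c21721021620423322a21b1fd2141f1
           [⟨272, none, [0]⟩, ⟨70, none, [0x24800000]⟩, ⟨34, none, [0x920]⟩,
            ⟨34, none, [0x49000000000]⟩, ⟨22, none, [0x9200000]⟩,
            ⟨20, some 0xd801b0012090400, []⟩, ⟨8, none, [0xb]⟩, ⟨22, some 0xc8000000, [0]⟩,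
            ⟨10, none, [0x248]⟩, ⟨52, some 0x1a0000000, [0]⟩,
            ⟨34, none, [0x1240000000000000]⟩, ⟨32, none, [0x26]⟩, ⟨32, none, [0x26000000000]⟩,
            ⟨6, some 0x360c1240000, [0,0x9200000,0x9240000]⟩] [88, 134, 0, 34, 0, 0])))
        (.split (4,7,10) 0
         (.leaf 0x1f92001f920820620c20120620500000000000000000000000000020120820720820a20e1f92071f90000000001fd2001fd20f23620d20c22020a20f21620d20920a20920620c20420720020720920c2092002022002092022091f72001f7
          [⟨64, none, [0]⟩, ⟨18, none, [0x24800000]⟩, ⟨10, none, [0x9200000]⟩,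
           ⟨10, some 0xd801b0012090400, []⟩, ⟨6, some 0xc8000000, [0]⟩,
           ⟨4, some 0xc1000000, [0,0x9200000]⟩, ⟨12, some 0x1a0000000, [0]⟩,
           ⟨10, none, [0x1240000000000000]⟩,
           ⟨7, some 0x2000000000, [0x49000000000,0x58000000000]⟩,
           ⟨2, some 0x3b800ee19dcee448, [0x920,0x248]⟩, ⟨2, some 0xb400260d86c0000, []⟩] [20, 10, 10, 0, 0])
         (.leaf 0x1cc2001cc23a22725520622722100000000000000000000000000020823c23424024b26c1c82341c80000000001d82001d827434626724c2bb23f27428b26724023024823425b21f23420423826825725723425b2042ea2b225b20025f1a9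
          [⟨374, none, [0]⟩, ⟨128, none, [0x24800000]⟩, ⟨104, none, [0x920]⟩,
           ⟨94, none, [0x9200000]⟩, ⟨63, some 0xc8000000, [0]⟩, ⟨16, none, [0x120009240000]⟩,
           ⟨16, none, [0x9240000]⟩, ⟨27, none, [0x248]⟩, ⟨76, some 0x1a0000000, [0]⟩,
           ⟨66, none, [0x1240000000000000]⟩, ⟨8, none, [0x49]⟩,
           ⟨52, some 0x2000000000, [0x49000000000,0x58000000000]⟩, ⟨182, none, [0x26]⟩,
           ⟨15, some 0xb400260d86c0000, []⟩] [182, 85, 66, 78, 22])))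
       (.split (38,37,36) 0
        (.leaf 0x1e22161f821e21920b20020320300000000000000000000000000020020520521e21920f1e21f11f60000000001ef2001ef23428c22d22325521c23423723221e21e21e21621921420820520a21221421e1fa20e20021820e21e1e22001e2
         [⟨170, none, [0]⟩, ⟨54, none, [0x24800000]⟩, ⟨40, none, [0x9200000]⟩,
          ⟨4, some 0xd801b001b090400, [0x9200000]⟩, ⟨19, some 0xc8000000, [0]⟩,
          ⟨1, some 0xc1000000, [0,0x9200000]⟩, ⟨20, none, [0x248]⟩,
          ⟨35, some 0x1a0000000, [0]⟩, ⟨5, some 0x2000000000, [0x49000000000,0x58000000000]⟩,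
          ⟨4, some 0x5a001681b0d86400, [0x980]⟩, ⟨6, none, [0x640000000000000]⟩,
          ⟨3, some 0x6c00d80e7412000, [0x24800000,0x9200000]⟩] [40, 44, 20, 0])
        (.leaf 0x1da21b1f522621d20d20020220200000000000000000000000000021221420220620720d20c21b1f50000000001f02001f02412ac22623126921624124322a22622621621b21d21420b20920b21521421f1fb20f20021a20f21f1e12001e1
         [⟨210, none, [0]⟩, ⟨76, none, [0x24800000]⟩, ⟨4, none, [0x49000000000]⟩,
          ⟨40, none, [0x9200000]⟩, ⟨5, some 0xd801b0012090400, []⟩,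
          ⟨18, some 0xc8000000, [0]⟩, ⟨20, none, [0x248]⟩, ⟨49, some 0x1a0000000, [0]⟩,
          ⟨5, some 0x5a001681b0d86400, [0x980]⟩, ⟨7, some 0x6c015e0ca652000, []⟩,
          ⟨2, some 0x6c00d80c3652000, [0x9200000,0x9240000]⟩, ⟨4, none, [0x640000000000000]⟩] [50, 54, 20, 0])))
      (.split (4,7,10) 0
       (.split (38,37,36) 0
        (.leaf 0x1fd2031fd2052052062022052030000000000000000000000000002002032032092092061f71fd1fd0000000001ff2001ff20b22d20c20a21b20b20b21220f2072092092042092062032002032052092052002022002052022051fb2001fb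
         [⟨54, none, [0]⟩, ⟨14, none, [0x24800000]⟩, ⟨16, none, [0x9200000]⟩,
          ⟨7, some 0xd801b0012090400, []⟩, ⟨7, some 0xc8000000, [0]⟩,
          ⟨1, some 0xc1000000, [0,0x9200000]⟩, ⟨10, some 0x1a0000000, [0]⟩,
          ⟨3, some 0x2000000000, [0x49000000000,0x58000000000]⟩,
          ⟨2, some 0x3b800ee19dcee448, [0x920,0x248]⟩,
          ⟨3, some 0x2000000000000000, [0x1240000000000000,0x640000000000000]⟩] [12, 14, 0, 0])
        (.leaf 0x1f72091f721021021220721020900000000000000000000000000020b21220720a2082102022121f70000000001fb2001fb22529622022025a21b22523c22021721e21420e21e20c20920020920d21e20d20020420020d20420d1f32001f3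
         [⟨180, none, [0]⟩, ⟨46, none, [0x24800000]⟩, ⟨38, none, [0x9200000]⟩,
          ⟨26, some 0xd801b0012090400, []⟩, ⟨27, some 0xc8000000, [0]⟩,
          ⟨32, some 0x1a0000000, [0]⟩, ⟨6, some 0x2000000000, [0x49000000000,0x58000000000]⟩,
          ⟨4, some 0x3b800ee19dcee448, [0x920,0x248]⟩,
          ⟨1, some 0x360c1240000, [0,0x9200000,0x9240000]⟩,
          ⟨9, some 0x2000000000000000, [0x1240000000000000,0x640000000000000]⟩,
          ⟨1, some 0x32000000000, [0x49000000000,0x58000000000,0x26000000000]⟩] [22, 52, 0, 0]))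
       (.split (62,61,60) 0
        (.leaf 0x1a31e51dc25d25724220021e21e00000000000000000000000000020922d22423623c2481dc2241dc0000000001eb2001eb29635f2432812cd22e29629226025d23b23623925722a22420022425d25724e22d25721e24e28426c1df22d1ee
         [⟨410, none, [0]⟩, ⟨186, none, [0x24800000]⟩, ⟨72, none, [0x920]⟩,
          ⟨88, none, [0x9200000]⟩, ⟨60, none, [0xb]⟩, ⟨17, some 0xc8000000, [0]⟩,
          ⟨4, none, [0x120009240000]⟩, ⟨72, none, [0x248]⟩, ⟨129, some 0x1a0000000, [0]⟩,
          ⟨30, none, [0x124]⟩, ⟨27, some 0x2000000000, [0x49000000000,0x58000000000]⟩,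
          ⟨6, some 0xb400260d86c0000, []⟩,
          ⟨30, some 0x2000000000000000, [0x1240000000000000,0x640000000000000]⟩,
          ⟨9, some 0x32000000000, [0x49000000000,0x58000000000,0x26000000000]⟩] [114, 132, 60, 34])
        (.leaf 0x20320b1fa20820420820920b20200000000000000000000000000020120720620a20e20e1f82061f80000000001f82001f821a24321221222720a21a21c21220f20b20a20b21120a20620220821120f21220721120621021a2181f72091fa
         [⟨78, none, [0]⟩, ⟨28, none, [0x24800000]⟩, ⟨12, none, [0x920]⟩,
          ⟨16, none, [0x9200000]⟩, ⟨2, some 0x6180000168b00000, [0x9200000]⟩,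
          ⟨12, none, [0xb]⟩, ⟨10, some 0xc8000000, [0]⟩, ⟨16, none, [0x248]⟩,
          ⟨18, some 0x1a0000000, [0]⟩, ⟨6, none, [0x126]⟩,
          ⟨5, some 0x2000000000, [0x49000000000,0x58000000000]⟩,
          ⟨2, some 0xb400260d86c0000, []⟩, ⟨3, some 0xd800260d86c0000, []⟩,
          ⟨1, some 0x260fc6c0000, [0x24800000,0x24900000]⟩,
          ⟨2, some 0x2c00000000000000, [0x6800000000000000,0x1240000000000000,0x640000000000000]⟩,
          ⟨1, some 0x32000000000, [0x49000000000,0x58000000000,0x26000000000]⟩] [18, 28, 8, 12])))))),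
   (![4,4,3,3], (0, 5),
    (.split (32,31,30) 0
     (.split (19,20,56) 0
      (.split (42,12,13) 0
       (.leaf 0x1f02001f021020821020020820021020821000000000000000000000000000020120e20d20620e2121fb20d1fb0000000001f71f520321423820920b22020c20c2182092042082072082102022082082052002082032082062081f82031fb000000000
        [⟨86, none, [0]⟩, ⟨14, none, [0x9200000]⟩, ⟨14, none, [0x124000000]⟩,
         ⟨12, some 0xc8000000, [0]⟩, ⟨13, some 0x2000000000, [0x58000000000,0x49000000000]⟩,
         ⟨8, some 0x37300000000000000, [0x4900000000000000,0x1240000000000000]⟩,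
         ⟨1, some 0xa4000000, [0,0x124000000]⟩, ⟨4, none, [0x248]⟩,
         ⟨2, some 0x186c00d81a2412000, []⟩,
         ⟨3, some 0x186c00d8186d12000, [0x24800000,0x24900000]⟩,
         ⟨1, some 0x30d801b0036990400, [0x24800000,0x24900000,0x2c0,0x248]⟩] [16, 16, 38])
       (.split (37,40,43) 0
        (.leaf 0x18820018827822227820022220027822227800000000000000000000000000020f23720f2652002651aa2001aa0000000001b71ea1f72ae41a29c2653472932772d329c23a27426523d25f23725622725621423821f26a2382751aa2221aa000000000
         [⟨698, none, [0]⟩, ⟨48, none, [0x24800000]⟩, ⟨202, none, [0x9200000]⟩,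
          ⟨34, none, [0x920]⟩, ⟨26, none, [0x124000000]⟩, ⟨147, some 0xc8000000, [0]⟩,
          ⟨6, none, [0x980]⟩, ⟨28, none, [0x2c0]⟩, ⟨5, some 0x15e18fc7a240, [0x4900]⟩,
          ⟨34, some 0x37300000000000000, [0x4900000000000000,0x1240000000000000]⟩,
          ⟨42, some 0xa4000000, [0,0x124000000]⟩, ⟨15, some 0xb6000000000, []⟩,
          ⟨34, none, [0x248]⟩, ⟨40, some 0x106168240000, []⟩,
          ⟨6, some 0x186c00d8186412000, [0x24800000,0x124800000,0x124000000]⟩,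
          ⟨28, some 0x186c00d8186d12000, [0x24800000,0x24900000]⟩] [110, 62, 8, 166])
        (.leaf 0x1b22001b224e21424e20021420024e21424e00000000000000000000000000020020020025623c2401aa2161c00000000001c92001de26437a29222d2e827024f29229222725625622823c23c23a21c24020a22020a24421c2441c620e1c6000000000
         [⟨464, none, [0]⟩, ⟨42, none, [0x24800000]⟩, ⟨162, none, [0x9200000]⟩,
          ⟨8, none, [0x920]⟩, ⟨112, some 0xc8000000, [0]⟩,
          ⟨8, some 0x6c0015e18fc7a240, [0x4900]⟩,
          ⟨20, some 0x37300000000000000, [0x4900000000000000,0x1240000000000000]⟩,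
          ⟨16, some 0xa4000000, [0,0x124000000]⟩, ⟨18, some 0x1a0000000, [0]⟩,
          ⟨5, some 0x186c00d8082412000, [0x24800000,0x9200000,0x49200000,0x124000000]⟩,
          ⟨2, some 0x186c00d8186412000, [0x24800000,0x124800000,0x124000000]⟩,
          ⟨7, some 0x186c00d8186d12000, [0x24800000,0x24900000]⟩,
          ⟨6, some 0x30d801b0012090608, [0x920,0x980,0x248]⟩,
          ⟨4, some 0x30d801b0036990400, [0x24800000,0x24900000,0x2c0,0x248]⟩] [82, 36, 0, 46])))
      (.leaf 0x602000603a029c3a220029c2023a02ed3a400000000000000000000000000026f2c425537d2c43630f22550f20000000001992001c0455c554c43ee8584844555fd4ca3a045b3ec2b53a22de3082b930e2362e923633e28933e0f82660f8000000000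
       [⟨3248, none, [0]⟩, ⟨228, none, [0x24800000]⟩, ⟨154, none, [0x4900000024900000]⟩,
        ⟨748, none, [0x9200000]⟩, ⟨96, none, [0x920]⟩, ⟨158, none, [0x1240000000000000]⟩,
        ⟨118, some 0xc1000000, [0,0x9200000]⟩,
        ⟨75, some 0x30d00000024000000, [0x24800000,0x24900000]⟩, ⟨520, some 0xc8000000, [0]⟩,
        ⟨29, some 0x15e18fc7a240, [0x4900]⟩,
        ⟨85, some 0x2000000000, [0x58000000000,0x49000000000]⟩, ⟨383, some 0x1a0000000, [0]⟩,
        ⟨96, none, [0x248]⟩, ⟨39, some 0x186c00d80a6412000, [0x24800000]⟩,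
        ⟨111, some 0x186c00d8186412000, [0x24800000,0x124800000,0x124000000]⟩,
        ⟨6, some 0x30d801b0012090608, [0x920,0x980,0x248]⟩] [528, 300]))
     (.leaf 0x17920017928924828c20224820528b24f28700000000000000000000000000021e22320f25f2232501bf20a1bf00000000024c24c2002414762af28d3862af2412f02af24c29627820b25a23724b23c24b20a21e20a25521e2551b52141b5000000000
      [⟨628, none, [0]⟩, ⟨130, none, [0x24800000]⟩, ⟨220, none, [0x9200000]⟩,
       ⟨20, none, [0x920]⟩, ⟨10, none, [0x1240]⟩, ⟨10, some 0xc1000000, [0,0x9200000]⟩,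
       ⟨165, some 0xc8000000, [0]⟩, ⟨5, some 0x2000000000, [0x58000000000,0x49000000000]⟩,
       ⟨5, some 0x34000000000, [0x58000000000,0x49000000000]⟩,
       ⟨65, some 0x37300000000000000, [0x4900000000000000,0x1240000000000000]⟩,
       ⟨141, some 0x1a0000000, [0]⟩, ⟨10, none, [0x1240000000004900]⟩, ⟨20, none, [0x248]⟩] [152]))),
   (![4,4,4,2], (0, 5),
    (.leaf 0x1f52001f520b20420b20020420020b20420b00000000000000000000000000021120720c1f62001f60000000000000000001fb2001fb21325a20c20e23820721322220c20b21620720820c20520520a2022072062072002042002072042071f92001f9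
     [⟨123, none, [0]⟩, ⟨4, none, [0x1240000000000000]⟩, ⟨22, none, [0x24800000]⟩,
      ⟨10, none, [0x9200000]⟩, ⟨4, none, [0x248]⟩, ⟨14, some 0x1a0000000, [0]⟩,
      ⟨7, some 0xc8000000, [0]⟩, ⟨2, some 0x30d8008001b090000, [0x100009240000,0x9200000]⟩,
      ⟨2, some 0x28b40168010482400, [0]⟩, ⟨2, some 0x36180000024124000, [0x920,0x4920]⟩] [])),
   (![4,4,3,4], (0, 5),
    (.split (32,31,30) 0
     (.split (37,40,43) 0
      (.leaf 0x16620016629a23a29a20023a20029a23a29a0000000000000000000000000002582582582002032002582032581a82001a81c41ba20a2a24f627c2663d02862a232627c2602aa25824227c22426025825220022c20e26023a2601a020e1ae000000000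
       [⟨1068, none, [0]⟩, ⟨164, none, [0x9200000]⟩, ⟨168, none, [0x24800000]⟩,
        ⟨28, none, [0x248]⟩, ⟨102, some 0x1a0000000, [0]⟩, ⟨122, some 0xc8000000, [0]⟩,
        ⟨12, some 0x186c00d86ca412000, []⟩,
        ⟨58, some 0x37300000000000000, [0x4900000000000000,0x1240000000000000]⟩,
        ⟨3, some 0x4a600000000, [0x49000000000]⟩, ⟨49, some 0x58600000000, []⟩,
        ⟨6, some 0x130c09000000, [0x9200000,0x9240000]⟩, ⟨20, none, [0x24900000]⟩,
        ⟨2, some 0x1eac015ebabd5a000, [0x24900000]⟩,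
        ⟨30, some 0x1eac006e6fc7e0240, [0x1240,0x4900]⟩] [170, 140])
      (.leaf 0x1d82001d822820b22820020b20022820b22800000000000000000000000000022421022a20621c20022a21622a1dc2061d61f51f520022e2da22422328822422e25222421d23621821121c20c21b21a21820320f20021e2122181eb2031e8000000000
       [⟨294, none, [0]⟩, ⟨48, none, [0x9200000]⟩, ⟨52, none, [0x24800000]⟩,
        ⟨8, none, [0x1240]⟩, ⟨8, none, [0x4900]⟩, ⟨18, none, [0x49000000000]⟩,
        ⟨35, some 0x1a0000000, [0]⟩, ⟨36, some 0xc8000000, [0]⟩,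
        ⟨11, some 0x37300000000000000, [0x4900000000000000,0x1240000000000000]⟩,
        ⟨2, none, [0x24900000]⟩, ⟨5, some 0xd8786c32000, [0x4900]⟩,
        ⟨2, some 0x1dcc00d87a2d12000, [0x124900000]⟩, ⟨4, none, [0x49000001240]⟩,
        ⟨12, none, [0x24800000000]⟩, ⟨6, none, [0x124000000000]⟩, ⟨6, none, [0x130]⟩] [34, 26]))
     (.leaf 0x1382001382c82602c82002602002c82602c80000000000000000000000000002a62312a62002242002a62242a615a20015a2682a71c12605402d82c84082992603382d82682d0290208268248268268278210240200278230278198210188000000000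
      [⟨832, none, [0]⟩, ⟨212, none, [0x9200000]⟩, ⟨192, none, [0x24800000]⟩,
       ⟨48, none, [0x1240]⟩, ⟨50, none, [0x9240000]⟩, ⟨26, none, [0x49000000000]⟩,
       ⟨200, some 0x1a0000000, [0]⟩, ⟨153, some 0xc8000000, [0]⟩, ⟨17, none, [0x9248000]⟩,
       ⟨32, none, [0x920]⟩,
       ⟨96, some 0x37300000000000000, [0x4900000000000000,0x1240000000000000]⟩,
       ⟨10, some 0x4a600000000, [0x49000000000]⟩,
       ⟨13, some 0x130c09000000, [0x9200000,0x9240000]⟩, ⟨8, some 0xd8786c32000, [0x4900]⟩,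
       ⟨22, none, [0x124000000000]⟩] [334]))),
   (![4,4,4,4], (0, 5),
    (.split (12,15,18) 0
     (.split (38,41,44) 1
      (.split (42,39,36) 1
       (.split (35,34,33) 0
        (.leaf 0x1f12001f121120920f20220920021220c20f00000000000000000000000000021c21220c1ff20120021b21120c1e41f01f41fa2001fa21e29622121825c21b21e23a22121222221b20c21820620620b20520a20d20a20020920020a20920a1f62001f6
         [⟨184, none, [0]⟩, ⟨19, none, [0x9200000]⟩, ⟨2, none, [0x49000000000]⟩,
          ⟨36, none, [0x24800000]⟩, ⟨8, none, [0x9240000]⟩, ⟨4, none, [0x1240000000000000]⟩,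
          ⟨4, some 0x30d801b0c12090400, []⟩, ⟨7, some 0x360c1240000, [0,0x9200000,0x9240000]⟩,
          ⟨3, none, [0x920]⟩, ⟨24, some 0x1a0000000, [0]⟩, ⟨27, some 0xc8000000, [0]⟩,
          ⟨1, some 0x5a000ee7b9dce448, [0x248,0x920]⟩,
          ⟨2, some 0x36100000000000000, [0x4900000000000000]⟩,
          ⟨6, some 0x186c00ee6c3652000, [0x9200000,0x9240000]⟩,
          ⟨4, some 0x186c09049000, [0x248,0x1248]⟩,
          ⟨1, some 0x31f0002d0d86c0000, [0x1240000000000000]⟩,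
          ⟨2, some 0x1a240000000000000, [0x1240000000000000]⟩] [32, 0, 2, 35])
        (.leaf 0x1292001292e32602d720c2602002ee26c2d70000000000000000000000000003472992d01e02791883272213480b927904018720018739f9643a032669232739f4d23a02f93c03272a63122792532af23728f26328f20024d20028f24d28f171200171
         [⟨2340, none, [0]⟩, ⟨276, none, [0x9200000]⟩, ⟨422, none, [0x24800000]⟩,
          ⟨34, none, [0x9240000]⟩, ⟨2, none, [0x1240000000000000]⟩,
          ⟨133, some 0x360c1240000, [0,0x9200000,0x9240000]⟩, ⟨10, none, [0x920]⟩,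
          ⟨294, some 0x1a0000000, [0]⟩, ⟨295, some 0xc8000000, [0]⟩,
          ⟨33, some 0x5a000ee7b9dce448, [0x248,0x920]⟩,
          ⟨1, some 0x36100000000000000, [0x4900000000000000]⟩,
          ⟨1, some 0x130c09000000, [0x9200000,0x9240000]⟩,
          ⟨1, some 0x186c00ee6c3652000, [0x9200000,0x9240000]⟩,
          ⟨18, some 0x19dc09049000, [0x248,0x1248]⟩,
          ⟨43, some 0x1a240000000000000, [0x1240000000000000]⟩,
          ⟨33, some 0x1cea09049000, [0x49000000000]⟩,
          ⟨37, some 0x31f00000024000000, [0x24800000,0x1240000000000000,0x24900000]⟩,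
          ⟨1, some 0x32900000024000000, [0x24800000,0x1240000000000000,0x24900000]⟩,
          ⟨17, some 0x5a00168bb0d86400, [0x920]⟩,
          ⟨1, some 0x19440168a09002400, [0x9200000,0x9240000,0x1240000000000000]⟩,
          ⟨4, some 0x28b400c36d868b400, [0x9200000,0x248,0x9240000,0x1248]⟩] [242, 240, 64, 312]))
       (.leaf 0x1172001172e92652e92002652002e92772e90000000000000000000000000002cc29d2f826225c2be20026825126220c26d16b20016b37d8e13e12e863734c37d4aa3e12d738d32e2a631d2b32532a72622b52762b52002642002b52642b514b20014b
        [⟨2158, none, [0]⟩, ⟨386, none, [0x9200000]⟩, ⟨23, none, [0x9200000000]⟩,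
         ⟨161, none, [0x49000000000]⟩, ⟨364, none, [0x24800000]⟩,
         ⟨36, none, [0x1240000000000000]⟩, ⟨15, some 0x30d801b0c12090400, []⟩,
         ⟨70, some 0x360c1240000, [0,0x9200000,0x9240000]⟩, ⟨31, none, [0x920]⟩,
         ⟨33, some 0x5a00000184900000, [0,0x24800000,0x24900000]⟩,
         ⟨232, some 0x1a0000000, [0]⟩, ⟨332, some 0xc8000000, [0]⟩,
         ⟨65, some 0x5a000ee7b9dce448, [0x248,0x920]⟩,
         ⟨18, some 0x36100000000000000, [0x4900000000000000]⟩,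
         ⟨15, some 0x19dcc1240000, [0,0x9208000]⟩,
         ⟨39, some 0x12bc09000000, [0x9200000,0x9240000]⟩, ⟨36, some 0x186c0145aca652000, []⟩,
         ⟨17, some 0x186c09049000, [0x248,0x1248]⟩,
         ⟨48, some 0x31f0002d0d86c0000, [0x1240000000000000]⟩,
         ⟨16, some 0x1a240000000000000, [0x1240000000000000]⟩,
         ⟨2, some 0x5a00168bb0d86400, [0x920]⟩] [357, 106, 212]))
      (.leaf 0x1f02001f021020721020020720021020921000000000000000000000000000020e20b20e21120b20621f20b2141f22001f21fc2001fc21527c22821124c22421923022820e21c21f20b21420920520b20520b20920b20020720020b20720b1f52001f5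
       [⟨152, none, [0]⟩, ⟨28, none, [0x9200000]⟩, ⟨28, none, [0x24800000]⟩,
        ⟨4, none, [0x1240000000000000]⟩, ⟨13, some 0x1a0000000, [0]⟩,
        ⟨35, some 0xc8000000, [0]⟩, ⟨1, some 0x1b0c000014c824000, []⟩,
        ⟨3, some 0x5a000ee7b9dce448, [0x248,0x920]⟩,
        ⟨2, some 0x36100000000000000, [0x4900000000000000]⟩,
        ⟨1, some 0xf5600049000, [0x9200000,0x16d009240000]⟩,
        ⟨2, some 0x12bc09000000, [0x9200000,0x16d009240000]⟩,
        ⟨9, some 0x12bc09000000, [0x9200000,0x9240000]⟩,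
        ⟨5, some 0x186c00ee6c3652000, [0x9200000,0x9240000]⟩,
        ⟨2, some 0x186c09049000, [0x248,0x1248]⟩,
        ⟨3, some 0x329000360d86c0000, [0x1240000000000000]⟩,
        ⟨2, some 0x5a00168bb0d86400, [0x920]⟩] [34, 28]))
     (.split (59,56,20) 0
      (.split (38,41,44) 1
       (.leaf 0x1e02001e022021022020021020022021022000000000000000000000000000021d20e21d1f920720021620721d1e32001e31eb2001eb2502dc22a23b28721525025522a23023221522022321521021420f21f20f21f20020f20021f20f21f1e12001e1
        [⟨270, none, [0]⟩, ⟨42, none, [0x9200000]⟩, ⟨14, none, [0x49000000000]⟩,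
         ⟨86, none, [0x24800000]⟩, ⟨59, some 0x1a0000000, [0]⟩, ⟨21, some 0xc8000000, [0]⟩,
         ⟨5, some 0x5a000ee7b9dce448, [0x248,0x920]⟩,
         ⟨5, some 0x168a34480000, [0,0x24800000,0x24900000]⟩,
         ⟨1, some 0x5a00168bb0d86448, [0x248,0x9a0]⟩,
         ⟨4, some 0x2f5c0000000000000, [0x4900000000000000,0x1240000000000000]⟩,
         ⟨12, some 0x37300000000000000, [0x4900000000000000,0x1240000000000000]⟩,
         ⟨9, some 0x35780168bb0d86448, [0x248,0x920,0x24920000]⟩] [14, 32, 15])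
       (.leaf 0x1e82001e821820c21820020c20021820c21800000000000000000000000000020b21020b21c2102172272102221f52001f51e92001e923c2ac23622526821f23c24423622422421e21822021820c20c20c21c21421c20021020021c21021c1e42001e4
        [⟨208, none, [0]⟩, ⟨50, none, [0x9200000]⟩, ⟨8, none, [0x248]⟩,
         ⟨53, none, [0x24800000]⟩, ⟨4, some 0x30d801b0c12090400, []⟩, ⟨3, none, [0x24900000]⟩,
         ⟨8, none, [0x920]⟩, ⟨37, some 0x1a0000000, [0]⟩, ⟨31, some 0xc8000000, [0]⟩,
         ⟨7, some 0x5a000ee7b9dce448, [0x248,0x920]⟩,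
         ⟨5, some 0x130c09000000, [0x9200000,0x9240000]⟩,
         ⟨1, some 0x357800ee7b9dce448, [0x248,0x920,0x24920000]⟩,
         ⟨11, some 0x4a600000000, [0x49000000000]⟩,
         ⟨12, some 0x37300000000000000, [0x4900000000000000,0x1240000000000000]⟩,
         ⟨8, some 0x186c0168a36092000, [0x24800000,0x24900000]⟩] [56, 24, 6]))
      (.split (16,19,22) 2
       (.split (27,24,21) 0
        (.leaf 0x1f32001f320e20720d20120720020f20820d00000000000000000000000000020e20720e20020520020e20520e1f22001f21fe20920720e24920220c22c20920e21d20e20a20f20220420c20c20620820620a20420a20020420020a20420a1f62001f6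
         [⟨70, none, [0]⟩, ⟨2, none, [0x9200000]⟩, ⟨2, none, [0x49000000000]⟩,
          ⟨12, none, [0x24800000]⟩, ⟨12, some 0x1a0000000, [0]⟩, ⟨21, some 0xc8000000, [0]⟩,
          ⟨1, some 0x122c09000000, [0x9200000,0x49000000000,0x16d009240000]⟩,
          ⟨1, some 0x1a240000000000000, [0x1240000000000000]⟩,
          ⟨1, some 0x6c001b0c10480000, [0,0x4900000000000000]⟩,
          ⟨5, some 0x37300000000000000, [0x4900000000000000,0x1240000000000000]⟩,
          ⟨2, some 0x92000000000, [0x49000000000]⟩,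
          ⟨4, some 0x1b0c34480000, [0,0x24800000,0x24900000]⟩,
          ⟨4, some 0x33b800ee79dcee448, [0x248,0x920]⟩, ⟨18, none, [0x49000000]⟩] [42, 2, 0, 16])
        (.leaf 0x1312001312e82482cf2192482003012612cf00000000000000000000000000028427128420023b20028423b28417c20017c0f224513730e6a94152004d834c30e3d12c928430728428a2b624524528a24528a24528a20024520028a24528a176200176
         [⟨1720, none, [0]⟩, ⟨262, none, [0x9200000]⟩, ⟨2, none, [0x49000000000]⟩,
          ⟨12, none, [0x24800000]⟩, ⟨75, some 0x5a00000184900000, [0,0x24800000,0x24900000]⟩,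
          ⟨1, some 0x130c09000000, [0x9200000,0x9240000]⟩,
          ⟨31, some 0x31f00000024000000, [0x24800000,0x1240000000000000,0x24900000]⟩,
          ⟨16, some 0x32900000024000000, [0x24800000,0x1240000000000000,0x24900000]⟩,
          ⟨53, some 0x30d80161a10480000, [0,0x49000000000]⟩,
          ⟨4, some 0x168a34480000, [0,0x24800000,0x24900000]⟩,
          ⟨4, some 0x4a600000000, [0x49000000000]⟩,
          ⟨69, some 0x5a00168bb0d86448, [0x248,0x920]⟩, ⟨138, none, [0x49000000]⟩] [526, 20, 150, 6]))
       (.leaf 0x8720008738c29937921329920039f2ac3790000000000000000000000000003782ac3782002842003782843780882000880382000383c86703c82005402003c83303c82984102983303dc33029833c2983342a033420029c20033429c3340cc2000cc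
        [⟨1968, none, [0]⟩, ⟨304, none, [0x9200000]⟩, ⟨8, none, [0x248]⟩,
         ⟨40, none, [0x49000000000]⟩, ⟨304, none, [0x24800000]⟩, ⟨8, none, [0x920]⟩,
         ⟨148, some 0x5a000ee7b9dce448, [0x248,0x920]⟩,
         ⟨91, some 0x1a240000000000000, [0x1240000000000000]⟩,
         ⟨4, some 0x1f840168bb0d82400, [0x1240000000000000]⟩,
         ⟨92, some 0x4a600000000, [0x49000000000]⟩,
         ⟨39, some 0x37300000000000000, [0x4900000000000000,0x1240000000000000]⟩] [700, 243, 304])))))]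

/-- A proof tree for the hole `(0, 6)` of every board whose upper arm has length five and whose other
arms are not longer. -/
def armFiveCert : Cert :=
  (.leaf 0x20020020020d20820520d20820521a21020a22721820f00000000000000000000000000022721820f21a21020a20d20820520d20820520020020016520016529b4c82aa2003b820f29b3102aa25a2a826924126824122824022821922821920f21820f20a21020a205208205205208205200200200
   [⟨1122, none, [0]⟩, ⟨80, none, [0x248000000]⟩, ⟨50, none, [0x920000000]⟩,
    ⟨130, none, [0x249000000]⟩, ⟨100, none, [0x924000000]⟩,
    ⟨15, some 0x6124000000, [0,0x920000000,0x924000000]⟩, ⟨15, some 0x3200000000, [0]⟩] [])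

/-- A proof tree for the hole `(0, 7)` of every board whose upper arm has length six and whose other
arms are not longer. -/
def armSixCert : Cert :=
  (.leaf 0x2002002002022012012022012012032022012052032022082052030000000000000000000000000002082052032052032022032022012022012012022012012002002001e22001e221e2db21e20028820021e25421e20a23420a21422021420c21420c20820c208205208205203205203202203202201202201201201201201201201200200200
   [⟨355, none, [0]⟩, ⟨20, none, [0x9200000000]⟩, ⟨17, none, [0x9248000000]⟩,
    ⟨20, none, [0x24800000000]⟩, ⟨17, none, [0x24920000000]⟩] [])

theorem shortArmCerts_check :
    shortArmCerts.all (fun e => onBoard e.1 e.2.1 && e.2.2.check 3 e.1 e.1 e.2.1 []) = true := by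
  decide +kernel

theorem armFourCerts_check :
    armFourCerts.all (fun e => onBoard e.1 e.2.1 && e.2.2.check 4 e.1 e.1 e.2.1 []) = true := by
  decide +kernel

theorem armFiveCert_check :
    armFiveCert.check 5 ![5, 0, 0, 0] ![5, 5, 5, 5] (0, 6) [] = true := by
  decide +kernel

theorem armSixCert_check :
    armSixCert.check 6 ![6, 0, 0, 0] ![6, 6, 6, 6] (0, 7) [] = true := by
  decide +kernel

/-! ### Solutions of the boards of the table -/

/-- The position on the board `n` that is given by the bits of a number. -/
noncomputable def position (n : Fin 4 → ℕ) (s : ℕ) : Finset (ℤ × ℤ) :=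
  (crossBoard n).filter fun p => s.testBit (code 3 p) = true

/-- The hole with a given number: the inverse of `code 3`. -/
def decodeHole (c : ℕ) : ℤ × ℤ :=
  if c < 27 then ((c % 3 : ℕ) - 1, (c / 3 : ℕ) - 4)
  else (((c - 27) / 3 : ℕ) - 4, ((c - 27) % 3 : ℕ) - 1)

def decodeDirection : ℕ → ℤ × ℤ
  | 0 => (1, 0)
  | 1 => (-1, 0)
  | 2 => (0, 1)
  | _ => (0, -1)

/-- The jump from `p` in the direction `d`, if it is possible. -/
def jumpStep (n : Fin 4 → ℕ) (s : ℕ) (p d : ℤ × ℤ) : Option ℕ :=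
  if onBoard n p && onBoard n (p + d) && onBoard n (p + d + d) && s.testBit (code 3 p) &&
      s.testBit (code 3 (p + d)) && !s.testBit (code 3 (p + d + d)) then
    some (s ^^^ (2 ^ code 3 p ||| 2 ^ code 3 (p + d) ||| 2 ^ code 3 (p + d + d)))
  else none

/-- Makes `k` jumps. Each of them is stored as a byte, the lowest one first: the number of the
starting hole and two bits for the direction. -/
def runJumps (n : Fin 4 → ℕ) : ℕ → ℕ → ℕ → Option ℕ
  | 0, s, _ => some s
  | k + 1, s, js =>
    match jumpStep n s (decodeHole (js / 4 % 64)) (decodeDirection (js % 4)) with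
    | none => none
    | some s' => runJumps n k s' (js / 256)

/-- Whether the jumps stored in `js` solve the board `n` at `X`. There are two jumps fewer than
holes, and the numbers `code 3` of the holes are less than `54`. -/
def isSolution (n : Fin 4 → ℕ) (X : ℤ × ℤ) (js : ℕ) : Bool :=
  match runJumps n ((holes n).length - 2) ((2 ^ 54 - 1) ^^^ 2 ^ code 3 X) js with
  | none => false
  | some s => (holes n).all fun p => s.testBit (code 3 p) == (code 3 p == code 3 X)

/-- Whether the second list gives solutions at the holes in the first list, in the same order. -/
def areSolutions (n : Fin 4 → ℕ) : List (ℤ × ℤ) → List ℕ → Bool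
  | [], _ => true
  | X :: Xs, js :: l => isSolution n X js && areSolutions n Xs l
  | _ :: _, [] => false

theorem decodeDirection_mem (c : ℕ) : decodeDirection c ∈ jumpDirections := by
  rcases c with _ | _ | _ | c <;> simp [decodeDirection, jumpDirections]

theorem code_lt {n : Fin 4 → ℕ} (hn : ∀ i, n i ≤ 3) {p : ℤ × ℤ} (hp : p ∈ crossBoard n) :
    code 3 p < 54 := by
  have h0 := hn 0
  have h1 := hn 1
  have h2 := hn 2
  have h3 := hn 3
  rw [mem_crossBoard] at hp
  simp only [code]
  split_ifs <;> omega

theorem jump_of_jumpStep {n : Fin 4 → ℕ} (hn : ∀ i, n i ≤ 3) {s s' : ℕ} {p d : ℤ × ℤ}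
    (hd : d ∈ jumpDirections) (h : jumpStep n s p d = some s') :
    Jump (crossBoard n) (position n s) (position n s') := by
  unfold jumpStep at h
  split_ifs at h with hc
  simp only [Bool.and_eq_true, onBoard_iff, Bool.not_eq_true'] at hc
  obtain ⟨⟨⟨⟨⟨h1, h2⟩, h3⟩, h4⟩, h5⟩, h6⟩ := hc
  refine ⟨p, d, hd, h1, h2, h3, ?_, ?_, ?_, ?_⟩
  · simp [position, h1, h4]
  · simp [position, h2, h5]
  · simp [position, h6]
  · rw [Option.some.injEq] at h
    subst h
    ext x
    simp only [position, Finset.mem_filter, Finset.mem_insert, Finset.mem_erase, Nat.testBit_xor,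
      Nat.testBit_or, Nat.testBit_two_pow]
    have hd0 := ne_zero_of_mem_jumpDirections hd
    have hpq : p + d ≠ p := by simpa using hd0
    by_cases hx : x ∈ crossBoard n
    · have key : ∀ y ∈ crossBoard n, (code 3 y = code 3 x ↔ x = y) := fun y hy =>
        ⟨fun h => (code_injOn hn hy hx h).symm, fun h => by rw [h]⟩
      simp only [key p h1, key _ h2, key _ h3, hx, true_and]
      by_cases hx3 : x = p + d + d
      · subst hx3; simp [h6]
      · by_cases hx2 : x = p + d
        · subst hx2; simp [h5, hx3]
        · by_cases hx1 : x = p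
          · subst hx1; simp [h4, hx3]
          · simp [hx1, hx2, hx3]
    · simp only [hx, false_and, and_false, or_false, false_iff]
      rintro rfl
      exact hx h3

theorem reflTransGen_of_runJumps {n : Fin 4 → ℕ} (hn : ∀ i, n i ≤ 3) {k s s' js : ℕ}
    (h : runJumps n k s js = some s') :
    Relation.ReflTransGen (Jump (crossBoard n)) (position n s) (position n s') := by
  induction k generalizing s js with
  | zero =>
    have h' : s = s' := Option.some.inj h
    rw [h']
  | succ k ih =>
    have h' : (match jumpStep n s (decodeHole (js / 4 % 64)) (decodeDirection (js % 4)) with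
      | none => none
      | some s1 => runJumps n k s1 (js / 256)) = some s' := h
    cases h1 : jumpStep n s (decodeHole (js / 4 % 64)) (decodeDirection (js % 4)) with
    | none => simp [h1] at h'
    | some s1 =>
      rw [h1] at h'
      exact .head (jump_of_jumpStep hn (decodeDirection_mem _) h1) (ih h')

theorem solvableAt_of_isSolution {n : Fin 4 → ℕ} (hn : ∀ i, n i ≤ 3) {X : ℤ × ℤ} {js : ℕ}
    (hX : X ∈ crossBoard n) (h : isSolution n X js = true) : SolvableAt (crossBoard n) X := by
  have key : ∀ p ∈ crossBoard n, (code 3 p = code 3 X ↔ p = X) := fun p hp =>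
    ⟨fun h => code_injOn hn hp hX h, fun h => by rw [h]⟩
  unfold isSolution at h
  split at h
  · exact absurd h (by simp)
  · rename_i s hs
    have hrun := reflTransGen_of_runJumps hn hs
    have h1 : position n ((2 ^ 54 - 1) ^^^ 2 ^ code 3 X) = (crossBoard n).erase X := by
      ext p
      by_cases hp : p ∈ crossBoard n
      · have hlt := code_lt hn hp
        rw [position, Finset.mem_filter, Nat.testBit_xor, Nat.testBit_two_pow_sub_one,
          Nat.testBit_two_pow, Finset.mem_erase]
        by_cases hpX : p = X
        · subst hpX; simp [hlt]
        · have h2 : ¬ code 3 X = code 3 p := fun h => hpX ((key p hp).1 h.symm)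
          simp [hp, hlt, hpX, h2]
      · simp [position, hp]
    have h2 : position n s = {X} := by
      rw [List.all_eq_true] at h
      ext p
      by_cases hp : p ∈ crossBoard n
      · have h3 := h p (mem_holes.2 hp)
        rw [beq_iff_eq] at h3
        simp [position, hp, h3, key p hp]
      · simp only [position, Finset.mem_filter, hp, false_and, Finset.mem_singleton, false_iff]
        rintro rfl
        exact hp hX
    rw [h1, h2] at hrun
    exact hrun

theorem solvableEverywhere_of_areSolutions {n : Fin 4 → ℕ} (hn : ∀ i, n i ≤ 3) {l : List ℕ}
    (h : areSolutions n (holes n) l = true) : SolvableEverywhere (crossBoard n) := by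
  suffices H : ∀ Xs l, areSolutions n Xs l = true → ∀ X ∈ Xs, X ∈ crossBoard n →
      SolvableAt (crossBoard n) X from fun X hX => H _ l h X (mem_holes.2 hX) hX
  intro Xs
  induction Xs with
  | nil => simp
  | cons X Xs ih =>
    intro l hl Y hY hYB
    cases l with
    | nil => exact absurd hl (by simp [areSolutions])
    | cons js l =>
      rw [areSolutions, Bool.and_eq_true] at hl
      rcases List.mem_cons.1 hY with rfl | hY
      · exact solvableAt_of_isSolution hn hYB hl.1
      · exact ih l hl.2 Y hY hYB

/-- For each board of the table, the solutions at its holes, in the order of `holes`. -/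
def solutionTable : List ((Fin 4 → ℕ) × List ℕ) :=
  [(![2, 1, 2, 0],
    [0x273f395732454b33515d572d1a3f16b5bf24b50c2b15,
     0x334b513a3657325d57514b2d1224b5bf0e24b5162d33,
     0x2d473c5732bd435d57514b1e30b9b5371a210e33150e,
     0x4b452ab52432bf5f405b573cbdb51e43163b0c162d1a,
     0x262d160c3b161ab5301e394fbd5f54304bb9303a5f45,
     0x32452ab524bf3c5b405f57bdb51e43163b0c162d1a32,
     0x5d422ab936bd3c5732535bb5240e122816b5242e453e,
     0x2bb537473c5732bf535d572e1a324853163b0c16b52b,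
     0x374fbd5f3a304b26545f3a3c53b9b50e24122816b537,
     0xb524bf405f3a545fbd433f481a1e302e53163b0c16b5,
     0xb9533c3a57325fbd48365b1a2d263c53163b0c16b51e,
     0xbd5f3a221816b628334b545f47304fb537180c162ebd,
     0x36bd5f3a22243b3f573c535bb91a30163b0c16b51e36,
     0x42bd5f3a221833545f474b36b6220e33150e242ebd42,
     0x2f243b533c5732bd485f47365bb50e2422b943152b0c,
     0x3b24533cbd573c3a305f5b40b5bf1e0e16b53712243b,
     0x473c26bd4b5f453248545f2a40b5bf1e0e16b5371224,
     0x533c2ab5245732bf4f5d573ab52a3c530e12163b2422,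
     0x3c2ab95732455fbd434b5b1e432224b50e33150e242e,
     0x3a301eb5160c3b161a283c575b32455fbd3cb6bd3648,
     0x5442bd3c2ab95d5732454b30b5240e122816b5242e46,
     0x28473c5732bd435d57514b1e30b9b51a30163b0c1628,
     0x34533cbdb62857325d573cbd4f1a163b300c16b51e34,
     0xb62816b524120e332d1a344fbd5f54304bb9303a5f40]),
   (![2, 1, 2, 1],
    [0x152f473cbd5751361e308c4f5d578437b9b52a418f0e842b15,
     0x332d16b5240ebfb524122d405b5f368c574fbd36868c4f3933,
     0x2d84473c573253395d573f8f1e842a4fb5bf370e1224b5162d,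
     0x391e842d168f84374157325d57538c4fb5bf18370c16b51e39,
     0x575136b92a843f1a2d12245d574f8fbd3cb5162d330e842a45,
     0x32452ab516184f3784bf8f4b2d5f543a5f841e0c16b52a4532,
     0x3e452a84b93cbd5f453f8f541a302d841e163b0c16b52a425d,
     0x2b8437120e884b26374fbd438c2d5f543a5f4016b5bf24b52b,
     0x37b5164f2a881a3b2136bd3c53575d32578c4f0e8437b91237,
     0xb524122d84bf475f408f5b3cbd30573c2d47842d16b5290e84,
     0x1e843f1a2d160c3b16b529455b3c578c455fbd30b936868c4f,
     0x2ab547221e845f472d438f5448245fbd3c0e33150e8428b6bd,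
     0x361eb5160c5b36b9bd3c2a4f57308c405fbd3b84162d1a8836,
     0x42bdb628160c842d5f3a3c26544bbd5f458c36881816b52a42,
     0x2f18160c37b5b9533c3a5b36575f8c4fbd2b43883784152b0c,
     0x3b240e15330e22431ebdb63c5b57368c4fbd5f45868c43243b,
     0x160c2bb53788bf34408c4f5f54bd36485f84b6bd1e43150e24,
     0x22240e15432b0c8c5732455d3b868c574f16b5bf24b52a3c53,
     0x5f3a3c2a84453f8f545f48531e8437b5bf1e0e16b53712242e,
     0x48368c86458c5f453248545f1a2d163b0c16b5bf24b51e303a,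
     0x463c2a844fbd36b9573f8f5d1a302d841e163b0c16b52a4254,
     0x28160c431e3bbd5f408c4854305f16842d1a8836bd4fb634bf,
     0x344f8c863657325d578c534f391eb5bf24b50e33150e242234,
     0xb6341e8437122d533c3a575d518cbf573c8816b5290e842a40,
     0x29b5160c182d843f24bf34455b3c578c455fb51628b6bd418f,
     0x354f8c86455f3a8c545f454b301a2d163b0c16b5bf24b51e35,
     0x412a84455f3a3f8f545f48531a2d163b0c16b5bf24b51e3586]),
   (![2, 2, 1, 1],
    [0x213718884b452ec18428cb5332575d3932578c4fc1bfb53721,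
     0x3f391e45c9c2b6845b36884b51578c453fc92a1a223a5f453f,
     0x39881a533c5b36bd2ec140c52d578c4fc93a5f3047842d211a,
     0x452a84c9405f443f8f4854b95f2a8422471822c1cb28c12e45,
     0x51361eb537841e8c453f1a5b435788c93a5fc54728c1223932,
     0x3e452a845f3ac93f458f5154c52ec11a3f1e842a223a5f453e,
     0x37844fbd5f3a363f8f545f4853b92234c1cb2884c11822b937,
     0x843f39573245c93e8f535b2ec53a5f45c11a32572d211a3f84,
     0x4fbd36881a2dc15b36338c4f57cb5f393f8428c122471822b9,
     0x2a881a213b53c9b648363f5b455f4784c2c922472d1a32578c,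
     0x36b92218c128cb448c5f4048545f47c9842a408822c12ebd36,
     0x428c3688395732bd5d573c53b92234c1cb2884c11822b92a42,
     0x18332dc143b9221a2a4f34c5478c575dc93245868c573c533b,
     0x4722c9b6341e301ac2384f53cb8c36575d3257868c4f34bfc1,
     0x304f3988bd368c5f4853542e40c9c53a5fc11a2d841e304722,
     0x2e24431e532ec5348c45485f54868c453fc9c11a22b9303a5f,
     0x3a22243f1a2ec5573239453f5b5f454bc9848fc12d841e303a,
     0x463c2a843a5f453f8f48545fc53ac91a2d84c11e2247302e46,
     0x28844730c94b453f8f51575db91a32572234c5c11e393f8428,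
     0x342218c14f8c452ec537bd41578c5f88365b40c947841e2234,
     0x40c98c452a8441573f8f515db9572ac21a3f841e2234b6c940,
     0x2c4722183c2a47c5573cbd515d5788368c4f348428c12238cb,
     0x38301a212dc1842d881a34c54f8c575d325734533c3ac95338,
     0x445f3a54428c36885d57514b30b91a302d84c1cb1e342238c2,
     0x29432dc1842d8f841ebf3f5b40575f47c91a3f2234c547b529,
     0x354b883945c98c45325f4853542ec53a5fc11a22472d841e35,
     0x412a84455f3a3f8f545f4853b9c92a40c2c91a2247b51e3586]),
   (![3, 2, 0, 1],
    [0x2d47c9c2b6842d8f354b268663695d4b6342465d578cc9453f,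
     0x394f30b98c452ab586c940675f48638c466b24c2c9532e454b,
     0x45c9c22ab54f2ab9368c2686405f546b608c42466bc9465d57,
     0x3245c9b6288c863444575d63694b51c526c12e408cc9453e63,
     0x3e513ac9c2b667422a842d264b635d57466bc94688368c425d,
     0x4a32452ec128cbc1842844b65f488c466b60c9533988364e69,
     0xb547285f486742bdb684c9468f633c6b2a40c2c9465d573f84,
     0x884b452ab5633e26b93c69635d57538cc940c2c9472d842a4f,
     0xbdb628c18428cbc12e8f35864f678c57516b3e634636485fbd,
     0x368c262d47c9c2b6842d4b2651676b4b635348c9883453b936,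
     0x428c264b452e53c9b62a886747636b4b3586c2c9532e458c42,
     0x4e36b92a8488428c53573c6b60466b2e53c1cb28c12ebd364e,
     0x473c532ec1262dc5398c26866b60544f536b8cc94636485f47,
     0x533c262dc1842d398c26c53a5f546b604b51883648466bc953,
     0x2ec1533c262d398c2686c53a5f546b604f8c466bc94636485f,
     0x3a3c532ec1262dc5398c26864863674b455f8c4f303ac9466b,
     0x463c262dc1842d398c26c53a5f546b604b51883648466bc946,
     0x523a3c532ec12a842d26c53a4b6369c9453e51578c88364e60,
     0x2847c9c2532e843f458f4b5b6b603624b6c9466b51573f8428,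
     0x34532ec14f2a842dc53a3c2667536b8c57513e63c9454b8834,
     0xb634532ec5886b4648365f634867514b47c92884c12d268c40,
     0x2c24438c575d462e4f2a6b46606bc93245868c573c53c238cb,
     0x38533488c94b458c6b515460c56b34264b2d84c12d263c5338,
     0x445f4836888c45514b546b60262d842a3c466bc1cb2e5338c2,
     0x2943bdb62dc9408c865f3a4f6757c2c9466b513e63264b358f,
     0x354b452ec128cbc1842844b663695b5f3e63458cc945884b35,
     0x412639532ec12d8c2686c53a5f546b603e458cc9466b515741]),
   (![3, 2, 1, 1],
    [0x213718842d8847435f4853548c2e246b60466bc940b5c2c953b93721,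
     0x2d84473f5f4548633e8f69c534c946b6635d571a3f1e842234bfc12d,
     0x3922884b452a843f4f5f5447c52e6b60466bc95339268cc11e432d1a,
     0x2639221e3f1ac1452e30475f48678c4246636bc9465d57c5868c2e45,
     0x51361eb52a8847438c4f6757bf2a6b511a3f8422c1cb28c12e453e63,
     0x3e2639c588391e3f1a5167573f6b51458cc9453e63842a22c12e453e,
     0x4a5d422a843f45633e8f69b92ac945c2631a3f841e2234b6c9465d4a,
     0x37843f575d46633e8f4f692ebd3663485fc1cb2884c122471822b937,
     0x4388bd5f546b46423e6739c5268c2e4063485fc12247c91822472d84,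
     0x1e842dc18f35bf4b4551cb67884b35636b2e46485f84c122472d1a88,
     0xbd2ec54722345f543e458824186b6022393f84c128b6c9466b51578c,
     0x36b9221834885348633e69375f4763c584c93a1e22c12e465d578c36,
     0x42bd36b922185f543e26346b60466b518c5786c1cb28c122b9368c42,
     0x4e36b95334c588348c42576b60c9466b1a3f1e842a22c12e53b9364e,
     0x3b30475f48463c6b5354602ec5476b1ec95334848f2d84c122b93718,
     0x243f842d1a47c55f45548f3e2e6b60466b51573fc984c12d211a3047,
     0x22475f48361ec534885354388c84374f6b60c9466bc2182234b6c953,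
     0x5f48368846633e694e602ac9458cb9366b5157c21a3f841e2234b6c9,
     0x48361ebdb6843c2a51573f458c1a88c934c26b6022b9365b40c9466b,
     0x463c2a886b4643485f5460b92a6b45c9c28c451a3f841e2234b6c946,
     0x52543e458c26391ec5433f6386692ec11a2247c92d268c453e634852,
     0x28472218843c2a47c5885f54426b60466bc9465d578c432ec1224728,
     0x34533c262d1ab95b436b6046888c573c6b53c9472d84c12234c51e34,
     0xb62847221834885f543e4563698cc534c9453e63485f84c1224728b6,
     0x2c472218374f8c8643575d1e8c366369263e63c946485f47c22238cb,
     0x38221834884b26c537514b676b4246635d578cc9453f84c11e342238,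
     0xc238301a3f575d462e4f2acb848f63693e63c122472d841e36485f44,
     0x8f35b9532ec186485334bf3c67cb6348536b2e53c11a1e3422b9358f,
     0x35b953341e3c5b45c9c2b66b46608c573c6b53c939888422472d1a35,
     0x412ab51e5751366b463e605b88c9366b51578c40c2c9471a22b93586]),
   (![2, 2, 2, 2],
    [0x272d438c4f2a267c41bd575d32b68041578cc94078c2c9163b530c163b2127,
     0x334b455f3a307c3f51542ec53a5f24804b223ac95378c13b12290e84162d33,
     0x3f1a212dc143b9cb445b305f407c285732804b84c9c12847b50e33150e2978,
     0x1a2d16b524122847b53cc5475b285732c9405f804bbd4378337cc10e332d1a,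
     0x80862943b953341e8c354f7cc52ec1223a575dc9530e3339150e33781a3257,
     0x32452a84c94b453f8f511a213b160cc53b575d32577883c12816b529781a32,
     0x5d463c263a7cc93f53481a213bc5163b0c8032575f78c1281a3216b52a453e,
     0x2b840e15330e2943b922475b7c37c9408c57b5c2c9405fbd418078293f842b,
     0x37b5472812c9c2408c2641577c325d80c9b65378290e84162ebd41578c4f37,
     0x438c57327c5d464f572a2ec53ac94084c1285fbd41803f12297816b5290e84,
     0x4fbd36884b357c51575d321a2d125732163b804b337829c1cb0e8428c122b9,
     0x8c452ec5472286293f571a325b125f3a80417a804bc953c13b162d330e842a,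
     0x36bd5f3a3c267c3f535b1a2d338041578c127829c1cb0e8428163bc122b936,
     0x422a840e29b51628128836474bc53b5f5478832978268cc1223ac9405fbd42,
     0xc27212d843f807a418f5b4737c53b571ac9405fbd41803f84c12816b52b0c,
     0x3b240e53c9c22c383340487c32575d12c92a78c21a328041578c40c953163b,
     0x24b53f391ec5345348bf5f543a80417a840e33155f80c1220e29868c40c947,
     0x532e240e22843a304f7c3f395f3354c53a5f15804bc10e29783318223ac953,
     0x3c2a840e883933458c2d1a211557415b8041c55fbd7a8041c12e0e268c40c9,
     0x3a3c2678bd3c8f8353481a2d3312163bc55f543a5f7829c1220e842a40c93a,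
     0x463c263a7c3f57514b5dc52a842dc93a12c1288016b5290e33781a32573c46,
     0x28122443bdb628883c5b5747c9b5408cc2c9405fbd7883294378290e841628,
     0x345348321a212d8880417a5f543a5fc53a804bc95384c13b0e33150e242234,
     0xb6344f8c260e287c35864b5312298041c93a5f54c578268c163bc1223a5f40,
     0xcb442e2412223f24458c7c3b575d51415732804b0e33781a30163bc12238cb,
     0x38304f347cbd3c5732535d571a322d804b3378c1cb12290e8428163bc12238,
     0x445f3a543e80327c304f1a2d33c1cb1228575f3a7816b5290e842a3c5338c2,
     0x250e29b54728c53f398843575b211a3280c9405fbd417a804bc12d33150e25,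
     0x3139c54f8c455f3a354b545f223ac953243b7883c1122816b5290e33781a31,
     0x3d2678415b36bd8f834f392678292212c1cb3b5f1628c10e8428b6bd41573d,
     0x290e15b547c534221e38435b33c9408c7c782957c2c9405fbd41803f840e29,
     0x351a213f1a3bc557325d4f47577c32804b227833c9c13b53163b0c162d1a35,
     0x41bd5f3ac52e24122d405b4388c95339c128578c840e29788316b529782641]),
   (![3, 2, 2, 1],
    [0x27213f1a455f3ac52e3f5b57463c6b60466bc95337848fc13b162d840c2b15,
     0x3339c588391e354b455167488c88c9532e6b5363c12e454b0e33150e843721,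
     0x2d1237841e47c53488435b3c5357b98cc922396b60466bc10e263c533b162d,
     0x1a2d4722331839c588395f544f8c436b6046c9c12d6b5384163b0c162d264b,
     0x452a885f4846438c674f39c5262d841e6b34c953634bb9c1220e3339150e26,
     0x516b463c2a8843bd604a1e2e43c51ac12d84163b6b0c162d268c40c9465d63,
     0x5d42bd2e24122d368853544b268c426b60b6c9466b34c50e841628c12e465d,
     0x4a321a215d573f39464288c5c93b1a162d84c10c6b60533b162d268c364e69,
     0x2b84374fbd433f8f5767513eb922c1cb28c12e636b5339264b0e33150e842b,
     0x37843f1a2d1247c5334f673957513e6322c13b6bc9530e268c162e454b8837,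
     0x431e840e15bdb62f243b8f5f3f544853c9406b60c2c9466b162e5339330e84,
     0xb9533c260ebd2e4b33402a4f6715c1223463c50e848f6bc946485f472d841e,
     0xbd2e304b8847516742572ac52e406b1a21c9465d63c10e334b150e842d268c,
     0x67422a843f575d463c8fbd1e3926634b22c1cb0e336b150e8428c12e53b936,
     0x428c86291237b51e3657325d578c466b60c940c2c9466b0e84162e53b92a42,
     0x4e36bd2e16532e24120eb642888c28c1cb57846b60466b3c5328c12ebd364e,
     0xc272d843f39c533474f8f675f48532a632e0e841e3648466bc953163bc12f,
     0x3b24438c453f5f4853542e24c5b51e396b60466bc953880e8437121628c13b,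
     0x47304b88516742575d391e35c52e84162d1a63888c3648466bc953c13b0c16,
     0x2218243f458c8657513e67394fc5268c366348c9b5163b536b0c1628c12e53,
     0x3c2a8843bd4f5f67484639c5266b2d1224634b2e53c12e0e84162d268c40c9,
     0x3ac5341e8437122d8f41575b3c53c93884c1286b600e268c40162cc2c9466b,
     0x464867422ab51e5f3a5436518cc5263ec945634b6b880e8437121628c12e46,
     0x523ac94648363257513ec5671a2d33c1122d636b848f162d840e242e464852,
     0x284722185f483239674246575d8c88c9366348466bc584c12e53163b0c1628,
     0x344f8c3688536b54524839c52e466b6024c9466b22c12e530e33150e841e34,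
     0x402a885f4846438c674f39c5262e6b461e634bc9c1223a5f0e33150e842a40,
     0xcb38304f34445f674846c52e24634b220e33156bc10e848f2d841e345338cb,
     0x38304f39888c5767513e452a841eb50e15c940634b6b33c2c953340e242238,
     0x44b6341e43882a4f8c6742c5575dc946634b346b22840e33150e242e5338c2,
     0x8f415b36bd425767513eb92622c1cb28634b0e336bc12e5339150e841e358f,
     0x354f3988bd365f4853542e8c406b601ac5c12e466bc953163b0c162d841e35,
     0x412ab92247305f454b54262e6b60468c4f6b12c95334c5c13b162d840e2986]),
   (![3, 3, 2, 1],
    [0x272d431ec1bfd15b43883853348c573c2c6b6046d5160c6bcd2cc2c953b937842b15,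
     0x33393f575d46428c674f86c92a458cc22ccdd71224632c6bcdb6c9530e162e454b33,
     0x2d12473c262d848f5b4b45c92ab64463695f3ed544d1630e84cdb6c9162d264b453f,
     0x4b262d47c9438c534f39882a674fb6842d1224cdd7632c6bcd0e162cc2c95339264b,
     0x455b368839c98c534f3586572e24c22c0e12248ccdd72c6b60466bcdb6c953162e45,
     0x32452ec1222abf474b2c5f544f842a8fd544ced5c2c96b60466b0e33150e841e3651,
     0x3e452a84c93f458f514b262db6d16712242e634b6b5144d5cd0e84162cbfc12d263e,
     0x4a5d462e24122d304fbd3cb66b4660c9d138848f6b37cd0e841e162cc2d5bd36514a,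
     0x2bb51637122847b5883c37575d468c426367c9c56b46485f4784cdd72ccd0e24b52b,
     0x3712b9301a2dc14f34cb6753882e8c57426b44cdd7162ccdb6c9465d634b330e8437,
     0x4388bd5f4836468c4f39671e30b5242ed544ce6348d5c2c9536b0e84162e53b93712,
     0x884b35b953341ec5c9453988633e69b537635d578c4f84cdd70e242ccd123716b51e,
     0x2ab9221847c9c22c53483c67345388842a426bcdd7163b630c162ccdb6c9465d578c,
     0x6742bd3c2a88575d46432e2463122d4b268cd544b66bc953d1b9cd0e843716b51e36,
     0x422a12b9532ec128162c43bd884b36d124cd2cd5bf6369c10e842d263e635d578c42,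
     0x4e361eb5371288bd424b5f26633e692a63454bd5b9d1cd0e84162cbfc12d268c364e,
     0xc273f391eb5c5475f486742466337848fc91e6b465d573f8437cdd72ccd16b52b0c,
     0x3b24438c453f5f485354c91e3988c22c6b604684376bcdd70e12242ccdb6c953163b,
     0x47301eb539885f48466742c93763c512248c456b3e545fcdd72c47cd2c0e841628c1,
     0x304b8845c98c45514b35c22c671e398884376348cdd70e12242ccdb6c9536b162e53,
     0x5f4836888c45514b54262a3cb9122d6b60466bc9533484b6cdd70e242ccd162cc2c9,
     0x3a303cbd57513e674f2ec524122d848f37d544c16b2e5363ced50e841e162ebd3648,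
     0x543e452a12881a2d4351c9478c573c336b60466b2d84b6cdd70e242ccd162cc2c946,
     0x523a22c9b634c5883446485f4424cdd72ccdb6c90e1563694b458c330e841e364e60,
     0xbf348840c953485f542a402ec28c12242c6b60466bc953b943cdd7162d840e242ccd,
     0x344fbd36888c573c535d39262dc1122863693e6348840e24d52ccd162cc2c95338d1,
     0x402a88435fbd4f4b54352ec524122d6b60466bc1848f2dd584ce0e242e53162e44d5,
     0x2c2412bfd1383f454b5b5f36262d848fc12d63693e634853d5840e242e44cbcd162c,
     0x38304b883445c98c534f672e24b612376b530e841e346348cdd72ccd162cc2c95338,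
     0x44b628123788c947435f543e1e6b60468437b56b51578c1e43cdd70e242ccd162cc2,
     0xb4bf2c24122d34c588475f543e6b4060c9466b51578c43cdd72c24cd2c0e841628b4,
     0xb8344f30388c5767513e45c91eb537634b886b53840e24cdd72ccd123716b51e34b8,
     0xceb4bf2c241234c588394f5367342d6b8c42264bcd0e841663d52d263e545f44b6bc,
     0x8f415b36bd425767513e262dd5c2c938d11224634b2c6b53b9cd0e843716b51e358f,
     0x354f39888c5767513e45c5c9341eb537634b126b53b93784cdd70e242ccd16b51e35,
     0x86354fbd368f4b51575db9301a2d163bd1c10c63693e63d5bf264b2ccd16b51e3586]),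
   (![3, 2, 3, 1],
    [0x1b152f3339c5473c5b45882b8c573c536b6034c9466b0e840a22c12e53b937001f09,
     0x152f18243f39c588455b4b36516b2e60578c466b16842dc953c12e4502273f090227,
     0x330e152f2b47c5434b5f885b458c3926c92d84c12d022763693e63454b060a210e33,
     0x3f575167428c36485d462e1ec53926c10e15842f634b6b53c94788370a2f000a210e,
     0x1a2137b9304f8c864534675f48468cc53b630e21276bc953c102060a2f18162e454b,
     0x262d1a020915472f3f43c52b5751673e848fc12dc94763842d6b1a02150e263e5157,
     0x513688bd3c6b46604a2ab62e4516182f6b8c4fc9c20227060a210e842a40c9465d63,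
     0x3e452e16182f24c5345b3f455f8c458663693ec90a22b963c10c000a2239268c453e,
     0x4a5167422a843f453e8f2ebd24c50e842d632127c1060a2f6b0218162e40c9465d4a,
     0x1f37b922842b34c588434b475f546b60466b0e268c4fc953340a2fc1000a22b9371f,
     0x2b8437b93f575d46438f1a3f1e6b602234c9c547021a060a22c12e466b51573f842b,
     0x37884b452e1618843551c53a675f488c466b2fc953c1060a2f630218162e454b8837,
     0x4388bd5f4836468c4f392622b96718160c633e6b51570a2fc1cb28c1000a22393f84,
     0x4fbd36888c5f4048542e24c53453c90e2106842d6b60466b27c1020a2f18162e53b9,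
     0x2a8843bd5f4846674f2ab984223418c1cb28633e6b160c0a2fc1000a22b93651578c,
     0x6742bd3c2a88575d46432e16182f6b53b9c1cb634b2884c12d0227060a210e268c36,
     0x428c36883957325d4657c52e1a3f1e6b60466b8416c953340c0a2fc1000a22b92a42,
     0x4e36b95334c588348c42571a3f1e6b22c946606b842ac102060a2f18162e53b9364e,
     0x1b152f2b47c534334b4f30675fb90e848f2d6348466bc9533484c10a22b9371f00,
     0xc27213f39532e2488486751454bc5c90e842d63266b468c36485f470a2fc1000a2f,
     0xa2f18062b33393f45235fc547543e6b601a88c9466b51578c432d84c12d02270c0a,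
     0x160c183721b588473c37575d46c58c4267c9270a2f6b4663485f47000a210e8428c1,
     0x304b8845c98c405f442ab6544f34c584286b166018c9466b2fc102060a2f18162e53,
     0x5f4836888c45514b54352e1ec539886b60466b06168418c953372fc1020a2f18162e,
     0x486742bd2e301e4743b61a5f8822478c2dc94063c2c90602270a210e842a453e546b,
     0x462e160c301e3a438c4f2a5f54454b88c56b608437c9466b0a2fc1000a2f18162e46,
     0x5248462e3047221e39c5674f8c34c98884371863160c6b460a2fc1000a22b9364852,
     0xbf342218062bb9438c40885751673e246b223463c946485fc547020a2fc1150e8428,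
     0x344fbd36888c5f404854c52e24530e842dc921276b60466bc102060a2f18162e5334,
     0x402a885f484643633e692ebd24c50e21842d27635d57c102060a2f18162e408cc940,
     0x2c160c272d84bf3f458f34c52b5f546b603e466b5157c1021a3f84061e340a2238cb,
     0x38301a21062b4f34c53f6757518c453ec91a0a2f021563c10e6b842d264b88345338,
     0x445f4867428c3688465b36b6281618842fc1cb6328c1060a2f6b0218162e46485f44,
     0x290eb54728c55f48365b4688368c4267c1210a2f84006bc94663485f470a2f150e29,
     0x354f39888c3653485f54b92234c51e346b60466bc953b984c10e1502272d09021a35,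
     0x86354fbd368f4b516748262e530e2127c1cb28636b4bc106020a2f18162e53b93586]),
   (![3, 2, 3, 2],
    [0x1b15330e2f4b26393f5145672b4b337cc5c12e066b537827c93a63803e51573f02270a211b,
     0x27788f252d1233474157c52d1a3f162e5b5380417a6b60c9466b80c12e533902273f090227,
     0x213788431e1a3bc55b3f455f474b357cc926224763693e63804b78330e060a22c13b212702,
     0x3f39267c3f534f575d398c2641c52dc11a210e2663693e63804bc978330a2f47000a2f150e,
     0x4b513ac5341e842d264b8f305f54470e0621c9276b604678830a226bc12e53b9432978021a,
     0x452a88431e1a2ebd3f57513e430621c12867cb1a803f7ac1021a0a22636bb93586803e5157,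
     0x51361e8c452e304b5b478843c52e1606182f021a7883296378266b3e46c9c10a223a526963,
     0x3e513657327cbd4f5d26393f22b92412804b0e2663693e0a2f6378c1cb28c1000a2239263e,
     0x4a513688bd4836513e67b92234180621c128cb631a803f7ac1021a6b0a22b93586803e514a,
     0x1f37b922842b47304b80417a0e265bc9405fc263693e63804b880a2f47c9000a2247b5371f,
     0x2bb5472237881a35b9c9405bc27c354bc9405f80bd63693e780227630902150e264b88432b,
     0x37b9533488434867514b267829830e2127060a2f0218c9c27816b5636b4b268c40c953b937,
     0xb5160cbf34c5405b3c3b572753163f7c2e0227096b60466b803fc953c13b02277829210e84,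
     0x1eb5160c273b3f454b5b5f303a7c26162dc940c263693e63804bc953b93502277809021a88,
     0x8c260e39412653b95b7c3f223457c51e15022709c12e6b60466bc953393f8041021a78268c,
     0x6742bd5f543e267c403f2ebd1a3021c1cb28630e15804bc12e6b53b93502277809021a8836,
     0x422a884b35b97c435367262e0e21277829634b803f6b5384c1cb28c102060a2f18162ebd42,
     0x4e36b9532e301a78298c4283573f12c1cb286b60466b162e53c12ebd02277809021a88364e,
     0x23182f334b513ac5348836575b3c53c12e062b6b6046c978836b53b91a358f7802270a0c23,
     0x2f18243f455b36b98c5f7c26412234804bc547782663693e6348c9533b160c0a2fc1000a2f,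
     0x3b3047221e7c3cbd4357325db9061857513ec1cb802863693e6316021a78264b303bc12f0a,
     0x47301a884b351e2e51575d43bd7c062bc5162e4063693e63c978264b803fc102270c0a2247,
     0x304b458c262d1224415b5f3ac52e537c0e26c947782263693e63804b263c470a2fc1000a22,
     0x5f4836888c45514b54352e1a88c5472d12022716096b607883c9466b2978021a302e53c12e,
     0x48368c262d47227c4f842a5f4147c50e6712290a2fc9477826634b803248000a22c12e466b,
     0x463c267c6b463f48525439c5262d1a3f216b601a803fc9466b021a7833c1060a2f18162e46,
     0x5248327c262d1237473c532e674846c9b6c21a6b46167826634b803fc90227090218223a52,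
     0x28164388391e843f535b2e57c51a3f3980417a6b60466bc953c13b8002273f0902270c1628,
     0x34532e240e337c3f4853842e15c547674f802f0ec929634b356b5378c10a2f000a211a8834,
     0x402e24123788534b5b357cb9350e211a782663693e0a2f6300804bc988c10a2234c53a5f40,
     0x2c160c2847c53b303cbd5f4f54277c35804b88346b60466bc122780227090218162e5338cb,
     0x38301a212d881a78344f308347b529675f4846c978c2060227634b6b0a210e268c40c95338,
     0x443c260e21273b8c455b417c162d264b63690c803e5f7826634b30470a2fc1cb000a2238c2,
     0x250e2127378839c53f3b4f67534834c95321807a1ac1060a2f0218636b162e53b9354b3183,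
     0x314b354fbd2e2422b6347c180621803f531ac94067c26bc94663485f4778020a22b9351a31,
     0x3d262d84415b361e7c4757513fc52e6b6046804b1606186b2fc95334c1020a22b9351a317a,
     0x290e21b527bf34c5475f543f407c336b600618803ec9224778021a0a22c12e466b51573f29,
     0x354b885136bd4f67482a842e5316182f80417ac1cb28636b06804bc1020a2f18162e53b935,
     0x41267cbd5f403f48672a2e531a210e337827c93ac5c1060a2f63803e0218162e466b515741]),
   (![3, 3, 2, 2],
    [0x152b43b9532e3748320c7c264b6751d1c1bf2c78264b63803ed5bd6bcd16b51e3651573f27,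
     0x2137881a3b357c534f3f39c933575dc54778b52463693e63804bcdd72ccd0e1224b5162d33,
     0x3f1a452ec1283f84cb447c212a573c5d46c10e33636915803e63485fd544ced5bfb50e2978,
     0x4b262d431ec1bd43511a3f7c33b9cb675737126b513e63804b0e3378cdd72c24cdb5162d1a,
     0x573239267c3f534f5d39c5262d4bc9472678b52463693e63804bcdd72ccd0e1224b5162d26,
     0x32391ec53422c1bf4088573484515d4bc92c807a0e33156369cdd70e242ccdb6bd41803e63,
     0x3e452a88438c51674f3926c52d4b12242e6b53c94763b5788324cdd72ccd0e16b52978263e,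
     0x4a5d422a8846438c674f2ab5bf1e36d11a7883163bc16b0cd5bf632ccd16b52978263e514a,
     0x2b43b95348321a2ebd5f3767484688c1cbcdd72c807a634b356b86803c53cd163b0c16b52b,
     0x371288392224b9d1304f3b4bbd35675f427cd5bd803c7826633e546b53b90e16b524cdb537,
     0x43884b357cbd51674f262a4bb9431e8030d138d5c2c92c634b6b53cd0e337827163b0c16b5,
     0x884b357c4fbd5f40542a263cbd122d84c1803ccbcdd72c6b60466bcd0e297816b5242e53b9,
     0x5b361eb5bfd1b62a4fbd3c47307c264b0e265f1563693ecdb563804b47d57833220e242ebd,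
     0x36bdb62e24d13f454bbf5b265f7c22473c7826b563693e63804bd5bdcd0e33150e24b51e36,
     0x428c26367cbd3f57513e2eb6d11a210e26416315804b7833676b53c938cd0e242cc2d5bd42,
     0x4e36b9304b267cbd423f5f1a2d26633e69d1b96312804b37d5bd78330e16b524cdb51e364e,
     0x2f4730b97c301ed1383c5b455f4bbd3080b5243b63693e63cd162cd5c2c9454b0e3378270c,
     0x3b2412c53f452e2a4b4f67513047804bc97a8626634b6b53b5803f24cdd72ccd0e16b5243b,
     0x243f1ab5455f3a543e51572a123fc97c33c578246b60466b2e53803c47cdd72ccd0e16b524,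
     0x2218337c354f2a474b674f30b9c9c22c538034781a88634b306bcdd7163b0c162ccdb6c953,
     0xc9402a881a353c4457515d4bb9307cd138d5b5210e26781563693e63804b33cd0e242cc2c9,
     0x3a303cbd57513e674fb62e24bd7c30d13822cd18163b6b0c80162c634bd578263c53c2c93a,
     0x4648321a2137c9453f3b677cc5265f4846781224634b803f6bb524cdd72ccd0e16b5242e46,
     0x523a301e2e84c5378f4f46674b34c9b6bd6b427883126324cdd72ccd0e16b52978263e5452,
     0x284730b92218d17c3c47302e53486751c938804b26634b6bc2d5bd78263c53163b0c162ccd,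
     0x34884b3545c98c534f3988c52e24b578832467126b530e29634878cdd72ccd16b5242e5334,
     0xb628472234c55f485432453e5fbd7c26c13b63693e6312804b7829d5ce0e84162d263c44d5,
     0xcb38304f347cbd3c53b9301a1e6734c5b578264b163b0c63803e6b51573f24cdd72ccd162c,
     0x3822183712473c26d17c5b2d533c57bd3c8033d5bd3c6b60466b7816b524cdb50e242e5338,
     0xc2382218d133394f373f53b97c30575d122463693e632c804b7826cd0e16b5242ebd3cd544,
     0xb42847223c26cb387c3f5b445f454bd126d51816b53763693e63804b7833cd180c162cbfb4,
     0xb834533c26387c4853c93f1a1e3580b5163b0c634b676b53887824cdd72ccd16b52a4f34b8,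
     0xbcb634221e473c445b43264b285fb680bdd17a8663693e63800e334bd5cd150e263c44b6bc,
     0x253f575136bd3e8f4f2a2e4067c9b6d1122478836b46cdb52963485f44d5bf7816b5290e25,
     0x311a2d47b5243c532e485367bf357cd1163bc10c6b51d5bf80782ccd16b51e354b63264b31,
     0x3d86351eb537b98f5753415bc934c512246b60466b2e53803c4778cdd72ccd16b5290e257a,
     0x8f357c4fbd5f543e45b62e303a5fbd411a7826d163693ecd162c63804bd5bfc12d330e1229,
     0x354fbd365f48468c674f3988c534b6c91a7883296b537826634bcdd72ccd163b0c16b51e35,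
     0x41267cbd3f5f454b54262a4f2eb6d1bf781224b56b60466b2a3c5380d5cd0e16b5242ebd41]),
   (![3, 3, 3, 2],
    [0x1b152f47301e3b7c354b885f435b45c9b64463693e63d1804b16cd2cd5bfc10227780902272d331b,
     0x273f39337c573f534f5d3926c92db64463693ed11a7826634b803f12d516cd2cbfc102272d090227,
     0x332d43240eb9bd434b5b332d7c265f12c128d1162c63693e80d544634b7827cdb6c9453f02270902,
     0x3f39267c3f534f67482a2e53c12ebf162cd10cd54427cdb66bc9530209807827634b0218162e453f,
     0x4b262d47c9438c534f39882a6742c22c1a12782983cdd7166b2ccdb663c9465d573f02277809021a,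
     0x57513e262d160c3b7c43bd3c24b667bd426b22d1387827803f0227d509021863cd162cc2c9465d57,
     0x32452ab524123c5b45bf5f2d4b4788d1b51a803f7a02271609cd2c6369d5bfc12d021a3586803e63,
     0x3e513657327cbd4f5d262a4bb943d12d1680b5241806cd2c63693e63d5bf78c12f02270a210e263e,
     0x4a513688bd4836513e67b61e8437c9c20e2127d54463ce807a060a2f02186bd5162ebd41803e514a,
     0x1f37881ab5bfc12bd135b9537c3f575d3463694f3e63804b35d5bf2ccd16b502277809021a88371f,
     0x2b43881a35b9d17c35bd4f2a225f38543ed5446369c1803e63cb060a227802cd1a8836485f47b52b,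
     0x37b547c52e161806334f532fc9472b674b0e337c7827cdd7802c633e6b51573fcd02270a0c16b537,
     0x4388bd5f4836468c4f2e24b60e2127d1bf676b467883b52963485fd5bd437824cd02060a2f1816b5,
     0x884b351e516742bd2e454b307c26c10e0621cb27633e80cdd7782c6b545f47cdb5021a3f240a22b9,
     0x5b36b930bd2e160c42533b677c271e3f57c1cb6b513e63804b35cdd72ccd16b502277809021a882a,
     0x3688bd5f4836468c4f2eb6d11a352106788329670e6b460a21c927634878cdb6445fd5bd021a8836,
     0x422a884b260e212736b951674b356b7cb553c9d138cd062b7826634b803f02270a0c162cc2d5bd42,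
     0x4e36884b35b97c35bd425f1a1e2234c5d54480c12e78ce63693e63060227d5bd0a210e264b88364e,
     0x23182fc12884cb38443c8f3057513e67d1387883296b4663485fd54478c1cbcdb52402060a2f1823,
     0xc272d47b52430b94b435b210e263cbd5f45633e69807ad186634b803fd5cd2cbf240a2fc1000a2f,
     0x3b24b53f24127c3045bf5b2d5f4b47d126b5782422d5380e63693e63804b263c44cdcbc10a2f000a,
     0x47301e393cbd57513e674f307c262e16b50cd544ce7827634b803fd5c26bc953b937022709021816,
     0x533c3a307c5fbd4f54263e2ab936d1b51e781a30636938803e63485fd544cdcb160c0a2fc1000a22,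
     0x5f3a3c267c3f5348542a2e53162ec1bf2cd10cd544803c276b60466b780227cdb6c953090218162e,
     0x3a221824b537b9305f4f543e47c97c30d13880210e15cd2c6b60c2d5bd02277809021a32573c466b,
     0x462e16182fc533473c5b457c3f062b57c9b524781a3f6b60468002276bcdd72ccd0a0c16b52a3c46,
     0x523a301eb524393c4648c9c222b90e267c3f6315804b6935d5445fced5bd02277809021a88364e60,
     0x28431ebdb63cbd573c475126673e7c30d1b90e06216327803e6b5157d578cdb5021a3f240a2234bf,
     0x341e304f8c865767513e1a35b9223480417ac1bfd544d1060a2f63804b6b880218162ccdb6c95334,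
     0x402e16532e8c86293548455f547c3fbdc5c12e800c276b60466b3c53d578ce0227090218162e44d5,
     0x2c161806330e2843242f47b5bf7c3f5751673ed1c10a216b27d5bf632c803e515778cd021a3f242c,
     0x3853343c57327c48535d26c9b644d11e0e06212763693e80cd2c634bd5bf3578c1021a88340a2238,
     0x445f3a221833393f4f377cc5264bc12e0e21276369803ed54463ce78060227d50a210e263e545f44,
     0xb428431e8c26cb387c445f48416746d116b537630c803e6b51573fd52778cd0227090218162cbfb4,
     0xb83422c1384f307cbd3c671e3557513e6b1a88d5442e80ce634b06d5bd7802270a210e263c5334b8,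
     0xbcc238532e162c24483257432d67513e80867ad10c6b5338634b80d5273fcd0227090218162cc2bc,
     0x253f7c3545c98f4b5126b61e4b340e062127cdd72c676b4663485f4478cdcbc1020a22b9351a3183,
     0x314b357c45633e514a5d26c9b6441e34cdd72ccdcbc12263693e63804bb9350e1502277809021a31,
     0x3d863557513e8f674f39261e22c1bf342c634b0e15d544ced5c26bc953b9350227788309021a317a,
     0x290e21273f847c453f573951673ec5296bb5c946062b63485f803f47cdd72ccd0227780a0c16b529,
     0x357c4fbd5f543e458c35b93686d1292238c10e150227096369803e63485fd544cb78cdb51e021a35,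
     0x41267cbd3f5f454b5b36b9262a4fd1b52a63693e1618cd2c6306804bd5bf78c12f02270a210e2641])]

theorem solutionTable_check :
    solutionTable.all (fun e => areSolutions e.1 (holes e.1) e.2) = true := by
  decide +kernel

/-! ### The classification -/

/-- Equality of arm lengths as a Boolean. -/
def sameArms (n k : Fin 4 → ℕ) : Bool := n 0 == k 0 && n 1 == k 1 && n 2 == k 2 && n 3 == k 3

theorem eq_of_sameArms {n k : Fin 4 → ℕ} (h : sameArms n k = true) : n = k := by
  simp only [sameArms, Bool.and_eq_true, beq_iff_eq] at h
  funext i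
  fin_cases i
  · exact h.1.1.1
  · exact h.1.1.2
  · exact h.1.2
  · exact h.2

theorem orientations_of_arms_le_four : ∀ a < 5, ∀ b < 5, ∀ c < 5, ∀ d < 5,
    ((orientations ![a, b, c, d]).any fun k =>
      boardTable.any (fun e => sameArms k e.1) || shortArmCerts.any (fun e => sameArms k e.1) ||
        armFourCerts.any fun e => sameArms k e.1) = true := by
  decide +kernel

theorem solvableEverywhere_boardTable :
    ∀ r ∈ boardTable, SolvableEverywhere (crossBoard r.1) := by
  have hmem : boardTable.map (fun r => r.1) = solutionTable.map fun e => e.1 := by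
    decide +kernel
  have hle : ∀ r ∈ boardTable, ∀ i, r.1 i ≤ 3 := by
    decide +kernel
  intro r hr
  have hr' : r.1 ∈ solutionTable.map fun e => e.1 := hmem ▸ List.mem_map_of_mem hr
  obtain ⟨e, he, her⟩ := List.mem_map.1 hr'
  have hsol := List.all_eq_true.1 solutionTable_check e he
  rw [← her]
  exact solvableEverywhere_of_areSolutions (her ▸ hle r hr) hsol

/-- A board that contains a hole with a verified proof tree is not solvable everywhere. -/
theorem not_solvableEverywhere_of_certs {m : ℕ} {l : List ((Fin 4 → ℕ) × (ℤ × ℤ) × Cert)}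
    (hl : l.all (fun e => onBoard e.1 e.2.1 && e.2.2.check m e.1 e.1 e.2.1 []) = true)
    {e : (Fin 4 → ℕ) × (ℤ × ℤ) × Cert} (he : e ∈ l) : ¬ SolvableEverywhere (crossBoard e.1) := by
  intro hsol
  have h := List.all_eq_true.1 hl e he
  rw [Bool.and_eq_true, onBoard_iff] at h
  exact not_solvableAt_of_check h.1 e.2.2 h.2 (fun _ => le_rfl) (fun _ => le_rfl) (hsol _ h.1)

theorem mem_table_of_arms_le_four {n : Fin 4 → ℕ} (hn : ∀ i, n i ≤ 4)
    (hsol : SolvableEverywhere (crossBoard n)) :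
    ∃ r ∈ boardTable, BoardsCongruent (crossBoard n) (crossBoard r.1) := by
  have h := orientations_of_arms_le_four (n 0) (Nat.lt_succ_of_le (hn 0)) (n 1)
    (Nat.lt_succ_of_le (hn 1)) (n 2) (Nat.lt_succ_of_le (hn 2)) (n 3) (Nat.lt_succ_of_le (hn 3))
  have hvec : ![n 0, n 1, n 2, n 3] = n := by
    funext i
    fin_cases i <;> rfl
  rw [hvec, List.any_eq_true] at h
  obtain ⟨k, hk, h⟩ := h
  have hcong := boardsCongruent_of_mem_orientations hk
  have hk' := solvableEverywhere_congr hcong hsol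
  simp only [Bool.or_eq_true, List.any_eq_true] at h
  rcases h with (⟨r, hr, h⟩ | ⟨e, he, h⟩) | ⟨e, he, h⟩
  · exact ⟨r, hr, eq_of_sameArms h ▸ hcong⟩
  · rw [eq_of_sameArms h] at hk'
    exact absurd hk' (not_solvableEverywhere_of_certs shortArmCerts_check he)
  · rw [eq_of_sameArms h] at hk'
    exact absurd hk' (not_solvableEverywhere_of_certs armFourCerts_check he)

theorem exists_congruent_max_first (n : Fin 4 → ℕ) : ∃ k : Fin 4 → ℕ,
    BoardsCongruent (crossBoard n) (crossBoard k) ∧ (∀ i, n i ≤ k 0) ∧ ∀ i, k i ≤ k 0 := by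
  obtain ⟨j, hj⟩ := Finite.exists_max n
  have h1 := boardsCongruent_turn n
  have h2 := boardsCongruent_trans h1 (boardsCongruent_turn _)
  have h3 := boardsCongruent_trans h2 (boardsCongruent_turn _)
  fin_cases j
  · exact ⟨n, boardsCongruent_refl _, hj, hj⟩
  · refine ⟨_, h1, hj, fun i => ?_⟩
    fin_cases i <;> exact hj _
  · refine ⟨_, h2, hj, fun i => ?_⟩
    fin_cases i <;> exact hj _
  · refine ⟨_, h3, hj, fun i => ?_⟩
    fin_cases i <;> exact hj _

theorem not_solvableEverywhere_of_five_le {n : Fin 4 → ℕ} {i : Fin 4} (hi : 5 ≤ n i) :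
    ¬ SolvableEverywhere (crossBoard n) := by
  obtain ⟨k, hcong, hle, hmax⟩ := exists_congruent_max_first n
  intro hsol
  have hk := solvableEverywhere_congr hcong hsol
  have h5 := hi.trans (hle i)
  have hX : (0, (k 0 : ℤ) + 1) ∈ crossBoard k := by
    rw [mem_crossBoard]
    simp only
    omega
  have hlo : ∀ N, N ≤ k 0 → ∀ i, (![N, 0, 0, 0] : Fin 4 → ℕ) i ≤ k i := by
    intro N hN i
    fin_cases i <;> simp [hN]
  have hhi : ∀ N, k 0 ≤ N → ∀ i, k i ≤ (![N, N, N, N] : Fin 4 → ℕ) i := by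
    intro N hN i
    have := (hmax i).trans hN
    fin_cases i <;> simpa using this
  rcases Nat.lt_or_ge (k 0) 7 with h7 | h7
  · obtain h | h : k 0 = 5 ∨ k 0 = 6 := by omega
    · refine not_solvableAt_of_check (onBoard_iff.1 (by decide)) armFiveCert armFiveCert_check
        (hlo 5 h.ge) (hhi 5 h.le) ?_
      simpa [h] using hk _ hX
    · refine not_solvableAt_of_check (onBoard_iff.1 (by decide)) armSixCert armSixCert_check
        (hlo 6 h.ge) (hhi 6 h.le) ?_
      simpa [h] using hk _ hX
  · exact not_solvableAt_of_long_arm h7 (hk _ hX)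

end PegSolitaire

theorem mainTheorem4 :
    boardTable.length = 12 ∧
    (boardTable.Pairwise fun r s => ¬ BoardsCongruent (crossBoard r.1) (crossBoard s.1)) ∧
    (∀ r ∈ boardTable, (crossBoard r.1).card = r.2.1 ∧ HasSymmetryType (crossBoard r.1) r.2.2) ∧
    (∀ n : Fin 4 → ℕ, SolvableEverywhere (crossBoard n) ↔
      ∃ r ∈ boardTable, BoardsCongruent (crossBoard n) (crossBoard r.1)) := by
  refine ⟨rfl, PegSolitaire.pairwise_not_boardsCongruent,
    PegSolitaire.card_and_symmetry_boardTable, fun n => ⟨fun hsol => ?_, ?_⟩⟩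
  · refine PegSolitaire.mem_table_of_arms_le_four (fun i => ?_) hsol
    by_contra hi
    exact PegSolitaire.not_solvableEverywhere_of_five_le (i := i) (by omega) hsol
  · rintro ⟨r, hr, h⟩
    exact PegSolitaire.solvableEverywhere_congr (PegSolitaire.boardsCongruent_symm h)
      (PegSolitaire.solvableEverywhere_boardTable r hr)
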